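/- **Setting.** Let $\gamma,T_-,\theta>0$, $\bar F\in\mathbb R$, $\omega=2\pi/\theta$, and let $\hat{\mathcal F}:\mathbb Z\setminus\{0\}\to\mathbb C$ satisfy $\hat{\mathcal F}(-\ell)=\overline{\hat{\mathcal F}(\ell)}$ and $\sum_{\ell\ne0}|\hat{\mathcal F}(\ell)|<\infty$. For $n\ge1$ put $$\mathcal F_n(t)=\bar F+\frac1{\sqrt n}\sum_{\ell\neq0}\hat{\mathcal F}(\ell)e^{i\ell\omega t}.$$ Let $(r_1,\dots,r_n,p_0,\dots,p_n)(t)$, $t\ge 0$ (depending on $n$, with the convention $r_0=r_{n+1}=0$), be an adapted process, with $p_0,\dots,p_n$ càdlàg, that solves $$dr_x=(p_x-p_{x-1})\,dt\quad(1\le x\le n),\qquad dp_0=(r_1-2\gamma p_0)\,dt+\sqrt{4\gamma T_-}\,dw_-,$$ $$dp_x=(r_{x+1}-r_x)\,dt-2p_x(t^-)\,dN_x(\gamma t)\quad(1\le x\le n-1),\qquad dp_n=(\mathcal F_n(t)-r_n)\,dt-2p_n(t^-)\,dN_n(\gamma t),$$ where $N_1,\dots,N_n$ are independent Poisson processes of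 intensity $1$ and $w_-$ is a standard Wiener process independent of them. The initial configuration is random, integrable and independent of the noises. Write $\bar r_x(t)=\mathbb E[r_x(t)]$, $\bar p_x(t)=\mathbb E[p_x(t)]$ and $$W_n(t)=\frac1n\int_0^{n^2t}\mathcal F_n(s)\,\bar p_n(s)\,ds .$$ **Assumptions.** (1) There is $\bar{\mathcal H}>0$ such that $\frac1n\sum_{x=0}^n(\bar r_x^2(0)+\bar p_x^2(0))\le\bar{\mathcal H}$ for all $n\ge1$. (2) There is a continuous $r_0:[0,1]\to\mathbb R$ such that $\lim_{n\to\infty}\frac1n\sum_{x=1}^n\big(\bar r_x(0)-r_0(x/n)\big)^2=0$. **Macroscopic stretch.** A weak solution of $$\partial_tr=\tfrac1{2\gamma}\partial_{uu}r\ \text{ on }(0,1),\qquad r(t,0)=0,\quad r(t,1)=\bar F,\quad r(0,\cdot)=r_0$$ is a map $t\mapsto r(t,du)$ that is continuous from $[0,\infty)$ to the finite signed measures on $[0,1]$ with the weak topology and satisfies, for all $t\ge0$ and all $\varphi\in C^2([0,1])$ with $\varphi(0)=\varphi(1)=0$, $$\int_0^1\varphi(u)\,r(t,du)-\int_0^1\varphi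 r_0\,du=\frac1{2\gamma}\int_0^tds\int_0^1\varphi''(u)\,r(s,du)-\frac{\bar Ft}{2\gamma}\varphi'(1).$$ **Theorem (macroscopic work).** For every $n\ge 1$ the averages $\bar p_n(t)$, $t\ge0$, and the integrals defining $W_n(t)$ are well defined. There is exactly one weak solution. For $t>0$ it has a density $r(t,u)$, which is $C^\infty$ on $(0,\infty)\times[0,1]$, and $s\mapsto\partial_ur(s,1)$ is integrable on $(0,t)$ for every $t>0$. For every $t>0$, $$\lim_{n\to\infty}W_n(t)=\frac{\bar F}{2\gamma}\int_0^t\partial_ur(s,1)\,ds+t\,\mathbb W^Q,$$ $$\mathbb W^Q=\sum_{\ell=1}^{\infty}|\hat{\mathcal F}(\ell)|^2\,\ell\omega\,\mathrm{Re}\sqrt{\frac4{(\ell\omega)^2-2i\gamma\ell\omega}-1},$$ where the series converges and $\sqrt{\cdot}$ is the branch of the square root with positive real part on $\mathbb C\setminus(-\infty,0]$. -/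

import Mathlib

open MeasureTheory ProbabilityTheory Filter Topology Set
open scoped NNReal unitInterval

namespace HarmonicChain

noncomputable section

/-! ### The noises -/

/-- A (unit intensity) Poisson process: almost every path starts at `0`, is nondecreasing and
right-continuous, the increments are independent, and `N t - N s` has the Poisson law of mean
`t - s` for `s ≤ t`. -/
structure IsPoissonProcess {Ω : Type*} [MeasurableSpace Ω] (N : ℝ≥0 → Ω → ℕ) (P : Measure Ω) :
    Prop where
  zero : ∀ᵐ ω ∂P, N 0 ω = 0
  mono : ∀ᵐ ω ∂P, Monotone (fun t => N t ω)
  rightCont : ∀ᵐ ω ∂P, ∀ t, ContinuousWithinAt (fun s => N s ω) (Ici t) t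
  indepIncrements : HasIndepIncrements N P
  hasLaw : ∀ s t : ℝ≥0, s ≤ t → HasLaw (fun ω => N t ω - N s ω) (poissonMeasure (t - s)) P

/-- The noises that drive the chain: Poisson processes `N x`, `x = 1, …, n`, of intensity `1` and a
standard Wiener process `w`, all independent. `ℱ` is a filtration to which `N x (γ t)` and `w t` are
adapted and such that the increments of all these processes after time `s` are jointly
independent of `ℱ s`. -/
structure IsChainNoise {Ω : Type*} [mΩ : MeasurableSpace Ω] (n : ℕ) (γ : ℝ) (P : Measure Ω)
    (ℱ : Filtration ℝ≥0 mΩ) (N : ℕ → ℝ≥0 → Ω → ℕ) (w : ℝ≥0 → Ω → ℝ) : Prop where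
  poisson : ∀ x ∈ Finset.Icc 1 n, IsPoissonProcess (N x) P
  wiener : IsBrownianReal w P
  indep_poisson : iIndepFun (fun (x : Finset.Icc 1 n) ω (t : ℝ≥0) => N x t ω) P
  indep_wiener :
    IndepFun (fun ω (x : Finset.Icc 1 n) (t : ℝ≥0) => N x t ω) (fun ω (t : ℝ≥0) => w t ω) P
  adapted_poisson : ∀ x ∈ Finset.Icc 1 n, ∀ t, Measurable[ℱ t] (N x (γ.toNNReal * t))
  adapted_wiener : ∀ t, Measurable[ℱ t] (w t)
  indep_past : ∀ s : ℝ≥0,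
    Indep (MeasurableSpace.comap
      (fun ω =>
        ((fun (x : Finset.Icc 1 n) (t : ℝ≥0) =>
            (N x (γ.toNNReal * (s + t)) ω : ℝ) - N x (γ.toNNReal * s) ω),
          (fun t : ℝ≥0 => w (s + t) ω - w s ω)))
      inferInstance) (ℱ s) P

/-! ### The microscopic dynamics -/

/-- The path `f` is right-continuous with left limits on `[0, ∞)`. -/
def IsCadlag (f : ℝ → ℝ) : Prop :=
  (∀ t, 0 ≤ t → ContinuousWithinAt f (Ici t) t) ∧ ∀ t, 0 < t → ∃ l, Tendsto f (𝓝[<] t) (𝓝 l)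

/-- The integral `∫_{(0,t]} f(s⁻) dN(s)` of a path against a counting path `N`: the sum of
`f(s⁻) (N(s) - N(s⁻))` over the (finitely many) jump times `s ∈ (0,t]` of `N`. -/
def jumpIntegral (f : ℝ → ℝ) (N : ℝ → ℕ) (t : ℝ) : ℝ :=
  ∑ᶠ s ∈ Ioc (0 : ℝ) t,
    Function.leftLim f s * ((N s : ℝ) - Function.leftLim (fun u => (N u : ℝ)) s)

/-- The angular frequency `ω = 2π / θ` of a force of period `θ`. -/
def angFreq (θ : ℝ) : ℝ := 2 * Real.pi / θ

/-- The force `F_n(t) = F̄ + n^{-1/2} ∑_{ℓ ≠ 0} F̂(ℓ) e^{iℓωt}`. (The sum is real as soon as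
`F̂(-ℓ)` is the conjugate of `F̂(ℓ)`.) -/
def force (θ Fbar : ℝ) (Fhat : ℤ → ℂ) (n : ℕ) (t : ℝ) : ℝ :=
  Fbar + (1 / √(n : ℝ)) *
    (∑' ℓ : {ℓ : ℤ // ℓ ≠ 0},
      Fhat ℓ * Complex.exp (Complex.I * ((ℓ : ℤ) : ℂ) * (angFreq θ : ℂ) * (t : ℂ))).re

/-- `(r, p)` is the stretch/momentum process of the chain with `n + 1` atoms `0, …, n`: with the
conventions `r_0 = r_{n+1} = 0` it solves, driven by the noises `N_1, …, N_n, w`,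
* `dr_x = (p_x - p_{x-1}) dt` for `x = 1, …, n`;
* `dp_0 = r_1 dt - 2γ p_0 dt + √(4γT) dw`;
* `dp_x = (r_{x+1} - r_x) dt - 2 p_x(t⁻) dN_x(γt)` for `x = 1, …, n - 1`;
* `dp_n = (F(t) - r_n) dt - 2 p_n(t⁻) dN_n(γt)`.
The initial configuration is random and known at time `0` (hence independent of the noises). -/
structure IsChainProcess {Ω : Type*} [mΩ : MeasurableSpace Ω] (n : ℕ) (γ T : ℝ) (F : ℝ → ℝ)
    (P : Measure Ω) (ℱ : Filtration ℝ≥0 mΩ) (N : ℕ → ℝ≥0 → Ω → ℕ) (w : ℝ≥0 → Ω → ℝ)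
    (r p : ℕ → ℝ → Ω → ℝ) : Prop where
  prob : IsProbabilityMeasure P
  noise : IsChainNoise n γ P ℱ N w
  adapted_r : ∀ x ≤ n, ∀ t : ℝ≥0, Measurable[ℱ t] (r x t)
  adapted_p : ∀ x ≤ n, ∀ t : ℝ≥0, Measurable[ℱ t] (p x t)
  cadlag_p : ∀ x ≤ n, ∀ᵐ ω ∂P, IsCadlag (fun t => p x t ω)
  r_left : ∀ t ω, r 0 t ω = 0
  r_right : ∀ t ω, r (n + 1) t ω = 0
  eq_r : ∀ x ∈ Finset.Icc 1 n, ∀ᵐ ω ∂P, ∀ t, 0 ≤ t →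
    r x t ω = r x 0 ω + ∫ s in (0 : ℝ)..t, (p x s ω - p (x - 1) s ω)
  eq_p_zero : ∀ᵐ ω ∂P, ∀ t, 0 ≤ t →
    p 0 t ω = p 0 0 ω + (∫ s in (0 : ℝ)..t, (r 1 s ω - 2 * γ * p 0 s ω))
      + √(4 * γ * T) * w t.toNNReal ω
  eq_p : ∀ x ∈ Finset.Icc 1 n, ∀ᵐ ω ∂P, ∀ t, 0 ≤ t →
    p x t ω = p x 0 ω
      + (∫ s in (0 : ℝ)..t, (r (x + 1) s ω - r x s ω + if x = n then F s else 0))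
      - 2 * jumpIntegral (fun s => p x s ω) (fun s => N x (γ * s).toNNReal ω) t

/-- The average work `W_n(t) = (1/n) ∫_0^{n²t} F_n(s) p̄_n(s) ds`, for the averaged momentum `pbar`
of the last atom. -/
def work (n : ℕ) (F pbar : ℝ → ℝ) (t : ℝ) : ℝ :=
  (1 / (n : ℝ)) * ∫ s in (0 : ℝ)..((n : ℝ) ^ 2 * t), F s * pbar s

/-! ### The macroscopic stretch -/

/-- `m` is a weak measure-valued solution of `∂_t r = (1/2γ) ∂_{uu} r` on `(0,1)` with boundary
conditions `r(t,0) = 0`, `r(t,1) = F̄` and initial datum `r₀`: it is continuous from `[0,∞)` to the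
finite signed measures on `[0,1]` with the weak topology, and satisfies the weak formulation for
all `φ ∈ C²([0,1])` with `φ(0) = φ(1) = 0`. (A function is in `C²([0,1])` if and only if it is the
restriction of a `C²` function on the line.) -/
structure IsWeakStretch (γ Fbar : ℝ) (r₀ : ℝ → ℝ) (m : ℝ → SignedMeasure I) : Prop where
  cont : ∀ f : C(I, ℝ), ContinuousOn (fun t => ∫ᵛ u, f u ∂•(m t)) (Ici 0)
  weak : ∀ φ : ℝ → ℝ, ContDiff ℝ 2 φ → φ 0 = 0 → φ 1 = 0 → ∀ t, 0 ≤ t →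
    (∫ᵛ u : I, φ u ∂•(m t)) - ∫ u in (0 : ℝ)..1, φ u * r₀ u
      = 1 / (2 * γ) * (∫ s in (0 : ℝ)..t, ∫ᵛ u : I, deriv (deriv φ) u ∂•(m s))
        - Fbar * t / (2 * γ) * deriv φ 1

/-- For `t > 0` the measure `m t` has the density `r t` with respect to the Lebesgue measure on
`[0,1]`, and `r` is smooth on `(0,∞) × [0,1]`. -/
structure HasSmoothDensity (m : ℝ → SignedMeasure I) (r : ℝ → ℝ → ℝ) : Prop where
  smooth : ContDiffOn ℝ (⊤ : ℕ∞) (fun q : ℝ × ℝ => r q.1 q.2) (Ioi 0 ×ˢ Icc 0 1)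
  density : ∀ t, 0 < t → m t = (volume : Measure I).withDensityᵥ (fun u : I => r t u)

/-- The boundary derivative `∂_u r(s,1)` (a left derivative, as `u` ranges over `[0,1]`). -/
def boundaryDeriv (r : ℝ → ℝ → ℝ) (s : ℝ) : ℝ := derivWithin (r s) (Icc 0 1) 1

/-! ### The thermal work -/

/-- The term `|F̂(ℓ)|² ℓω Re √(4/((ℓω)² - 2iγℓω) - 1)`. The power `z ^ (1/2)` is the
principal branch, the one with positive real part off `(-∞,0]`. -/
def thermalTerm (γ θ : ℝ) (Fhat : ℤ → ℂ) (ℓ : ℕ) : ℝ :=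
  ‖Fhat ℓ‖ ^ 2 * (ℓ * angFreq θ) *
    ((4 / (((ℓ * angFreq θ : ℝ) : ℂ) ^ 2
        - 2 * Complex.I * (γ : ℂ) * ((ℓ * angFreq θ : ℝ) : ℂ)) - 1) ^ (1 / 2 : ℂ)).re

/-- The rate `W^Q`, the sum of the terms `ℓ = 1, 2, …`. -/
def thermalWork (γ θ : ℝ) (Fhat : ℤ → ℂ) : ℝ := ∑' ℓ : ℕ, thermalTerm γ θ Fhat (ℓ + 1)

end

end HarmonicChain

/-! Only averages enter the work, and the averages obey a closed deterministic system. Along a path,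
`p_x` changes sign at each jump of its Poisson clock, so `(-1)^N p_x` has no jumps and is the time
integral of `(-1)^N` times the drift (`IsCountingPath.eq_sign_mul`). Taking means, the sign of a
future increment is independent of the past and has mean `exp (-2γ(t-s))`. Random flips thus become
a friction `2γ` on every momentum, while the Wiener noise at atom `0` has mean zero. This gives the
damped wave system `IsMeanChain`, with boundary values `R 0 = 0` and `R (n+1) = F`.

The work splits into `F̄ n⁻¹ ∫ Q_n` and `n^{-3/2} ∫ f Q_n`, where `F_n = F̄ + n^{-1/2} f`. Both rest
on one a priori estimate (`IsMeanChain.energy_le`): up to times of order `n²` the energy is `O(n)`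
and `∫ Q_n² = O(n)`. The dangerous term of the energy balance is `F̄ ∫ Q_n`. The linear-weight
moment of the stretches expresses this current through the configuration, and half of the energy
absorbs it. The oscillating force is absorbed by the friction at the last atom.

Constant part. The same moment identity reduces `n⁻¹ ∫ Q_n` to the first moment of the stretch
profile. Each discrete sine mode of the stretches is an overdamped oscillator, whose diffusive limit
is the corresponding mode of the heat equation (`tendsto_sineMode`). Parseval and the energy bound
pass from modes to continuous weights (`tendsto_weighted`). Integrating the sine series in time
identifies the change of the first moment with `∫ ∂_u r(s,1) ds` (`boundaryDeriv_integral`).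

Oscillating part. Pairing the chain with a solution of the adjoint equations at a nonzero frequency
leaves only terms at the driven end and at the two ends of the time interval. This adjoint solution
grows geometrically towards the driven end; normalised there, its time-boundary terms are `O(n)` and
vanish after division by `n^{3/2}`. Hence each harmonic of `Q_n` responds linearly to the same
harmonic of the force, with coefficient given by the root `η`, `‖η‖ > 1`, of a quadratic equation
(`tendsto_harmonic`). The real part of this coefficient is the square root in `W^Q`
(`IsGrowthFactor.two_mul_re`), and the bound on `∫ Q_n²` permits summation over harmonics by
dominated convergence.

Macroscopic side. A sine series with Gaussian-decaying coefficients gives a solution smooth up to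
the boundary for positive times. For uniqueness, the difference of two weak solutions annihilates
the sines by Grönwall, hence all `C²` functions vanishing at the ends; the weak equation then makes
it annihilate all their second derivatives, that is, all continuous functions, so that atoms at the
end points are excluded too. -/

/-! ### From the random chain to a deterministic damped chain. -/

namespace HarmonicChain

/-! ### Paths driven by a counting path with unit jumps -/

/-- A monotone right-continuous path with values in `ℕ` which starts at `0` and has unit jumps. -/
structure IsCountingPath (M : ℝ → ℕ) : Prop where
  mono : Monotone M
  rightCont : ∀ t, ContinuousWithinAt M (Ici t) t
  zero : M 0 = 0
  unitJump : ∀ t, 0 < t → ∃ u < t, M t ≤ M u + 1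

namespace IsCountingPath

variable {M : ℝ → ℕ} (hM : IsCountingPath M)
include hM

lemma eventually_right (t : ℝ) : ∃ v > t, ∀ s ∈ Ico t v, M s = M t := by
  have h := hM.rightCont t
  have h1 : ∀ᶠ s in 𝓝[≥] t, M s = M t := h (isOpen_discrete {M t} |>.mem_nhds rfl)
  obtain ⟨v, hv, h2⟩ := mem_nhdsGE_iff_exists_Ico_subset.1 h1
  exact ⟨v, hv, fun s hs => h2 hs⟩

lemma exists_left (t : ℝ) : ∃ u < t, ∀ s ∈ Ico u t, M s = M u := by
  have hb : BddAbove (M '' Iio t) := ⟨M t, by rintro _ ⟨s, hs, rfl⟩; exact hM.mono hs.le⟩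
  have hne : (M '' Iio t).Nonempty := ⟨_, t - 1, by simp, rfl⟩
  obtain ⟨u, hu, hu2⟩ := Nat.sSup_mem hne hb
  refine ⟨u, hu, fun s hs => le_antisymm ?_ (hM.mono hs.1)⟩
  rw [hu2]
  exact le_csSup hb ⟨s, hs.2, rfl⟩

omit hM in
lemma leftLim_eq {u t : ℝ} (hut : u < t) (h : ∀ s ∈ Ico u t, M s = M u) :
    Function.leftLim (fun v => (M v : ℝ)) t = M u := by
  apply leftLim_eq_of_tendsto
  apply tendsto_const_nhds.congr'
  filter_upwards [Ico_mem_nhdsLT hut] with s hs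
  rw [h s hs]

/-- The jump times before `t` are finitely many. -/
lemma finite_jumps (t : ℝ) :
    {s ∈ Ioc (0 : ℝ) t | (M s : ℝ) - Function.leftLim (fun v => (M v : ℝ)) s ≠ 0}.Finite := by
  -- `M` is injective on its jump times (equal values at `a < b` force `M` to be constant between
  -- them, so there is no jump at `b`), and it takes finitely many values up to `t`.
  apply Set.Finite.of_finite_image (f := M)
  · exact (Set.finite_Iic (M t)).subset (by rintro _ ⟨s, hs, rfl⟩; exact hM.mono hs.1.2)
  · have key : ∀ a b : ℝ, a < b → (M b : ℝ) - Function.leftLim (fun v => (M v : ℝ)) b ≠ 0 →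
        M a ≠ M b := by
      intro a b hab hb heq
      apply hb
      rw [leftLim_eq hab (fun s hs => le_antisymm ?_ (hM.mono hs.1)), heq, sub_self]
      rw [heq]; exact hM.mono hs.2.le
    intro a ha b hb hab
    rcases lt_trichotomy a b with h | h | h
    · exact absurd hab (key a b h hb.2)
    · exact h
    · exact absurd hab.symm (key b a h ha.2)

lemma jumpIntegral_eq_of_const (f : ℝ → ℝ) {s t : ℝ} (hst : s ≤ t)
    (h : M t = M s) : jumpIntegral f M t = jumpIntegral f M s := by
  apply finsum_mem_inter_support_eq
  ext u
  simp only [mem_inter_iff, mem_Ioc, Function.mem_support]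
  refine ⟨fun ⟨⟨h0, h1⟩, h2⟩ => ⟨⟨h0, ?_⟩, h2⟩, fun ⟨⟨h0, h1⟩, h2⟩ => ⟨⟨h0, h1.trans hst⟩, h2⟩⟩
  by_contra hu
  push Not at hu
  have hc : ∀ v ∈ Icc s t, M v = M s := fun v hv =>
    le_antisymm (h ▸ hM.mono hv.2) (hM.mono hv.1)
  apply h2
  rw [leftLim_eq hu (fun v hv => hc v ⟨hv.1, hv.2.le.trans h1⟩), hc u ⟨hu.le, h1⟩, sub_self,
    mul_zero]

/-- With no jump on `(s, t)`, the only possible new contribution is the one at `t` itself.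
Finiteness of the support is needed because a `finsum` with infinite support is `0` by default. -/
lemma jumpIntegral_eq_add (f : ℝ → ℝ) {s t : ℝ} (hs : 0 ≤ s) (hst : s < t)
    (h : ∀ v ∈ Ico s t, M v = M s) :
    jumpIntegral f M t = jumpIntegral f M s + Function.leftLim f t * ((M t : ℝ) - M s) := by
  set g : ℝ → ℝ := fun s =>
    Function.leftLim f s * ((M s : ℝ) - Function.leftLim (fun u => (M u : ℝ)) s) with hg
  have hfin : (Ioc (0 : ℝ) t ∩ Function.support g).Finite := by
    refine (hM.finite_jumps t).subset fun u hu => ⟨hu.1, fun h0 => hu.2 ?_⟩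
    simp only [hg, h0, mul_zero]
  have e1 : jumpIntegral f M t = ∑ᶠ u ∈ insert t (Ioc (0 : ℝ) s), g u := by
    apply finsum_mem_inter_support_eq
    ext u
    simp only [mem_inter_iff, mem_Ioc, Function.mem_support, mem_insert_iff]
    refine ⟨fun ⟨⟨h0, h1⟩, h2⟩ => ⟨?_, h2⟩, ?_⟩
    · by_contra hu
      push Not at hu
      have hsu := hu.2 h0
      have hut := lt_of_le_of_ne h1 hu.1
      apply h2
      rw [leftLim_eq hsu (fun v hv => h v ⟨hv.1, hv.2.trans hut⟩), h u ⟨hsu.le, hut⟩,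
        sub_self, mul_zero]
    · rintro ⟨rfl | ⟨h0, h1⟩, h2⟩
      · exact ⟨⟨hs.trans_lt hst, le_rfl⟩, h2⟩
      · exact ⟨⟨h0, h1.trans hst.le⟩, h2⟩
  rw [e1, finsum_mem_insert' _ (by simp [hst]) (hfin.subset
    (inter_subset_inter_left _ (Ioc_subset_Ioc_right hst.le))), add_comm]
  simp only [hg, leftLim_eq hst h]
  rfl

lemma measurable_sign : Measurable fun s => (-1 : ℝ) ^ M s :=
  (measurable_from_nat (f := fun k : ℕ => (-1 : ℝ) ^ k)).comp hM.mono.measurable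

lemma intervalIntegrable_sign_mul {g : ℝ → ℝ} {a b : ℝ} (hg : IntervalIntegrable g volume a b) :
    IntervalIntegrable (fun s => (-1 : ℝ) ^ M s * g s) volume a b := by
  have h : ∀ s : Set ℝ, IntegrableOn g s volume →
      IntegrableOn (fun s => (-1 : ℝ) ^ M s * g s) s volume := fun s hs =>
    Integrable.bdd_mul hs hM.measurable_sign.aestronglyMeasurable (c := 1)
      (Eventually.of_forall fun x => by simp)
  exact ⟨h _ hg.1, h _ hg.2⟩

/-- A path that solves `df = g dt - 2 f(t⁻) dM` flips its sign at each jump. -/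
theorem eq_sign_mul {f g : ℝ → ℝ} (hg : ∀ t, 0 ≤ t → IntervalIntegrable g volume 0 t)
    (hf : ∀ t, 0 ≤ t → f t = f 0 + (∫ s in (0 : ℝ)..t, g s) - 2 * jumpIntegral f M t)
    {t : ℝ} (ht : 0 ≤ t) :
    f t = (-1 : ℝ) ^ M t * (f 0 + ∫ s in (0 : ℝ)..t, (-1 : ℝ) ^ M s * g s) := by
  have hg' : ∀ a b, 0 ≤ a → 0 ≤ b → IntervalIntegrable g volume a b := fun a b ha hb =>
    (hg a ha).symm.trans (hg b hb)
  have hεg : ∀ a b, 0 ≤ a → 0 ≤ b →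
      IntervalIntegrable (fun s => (-1 : ℝ) ^ M s * g s) volume a b := fun a b ha hb =>
    hM.intervalIntegrable_sign_mul (hg' a b ha hb)
  have hconst : ∀ a b, 0 ≤ a → a ≤ b → M b = M a →
      ∫ s in a..b, (-1 : ℝ) ^ M s * g s = (-1 : ℝ) ^ M a * ∫ s in a..b, g s := by
    intro a b ha hab h
    rw [← intervalIntegral.integral_const_mul]
    apply intervalIntegral.integral_congr
    intro s hs
    rw [uIcc_of_le hab] at hs
    have : M s = M a := le_antisymm (h ▸ hM.mono hs.2) (hM.mono hs.1)
    simp only [this]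
  have hstep : ∀ a b, 0 ≤ a → a ≤ b → M b = M a →
      f b = f a + ∫ s in a..b, g s := by
    intro a b ha hab h
    rw [hf b (ha.trans hab), hf a ha, hM.jumpIntegral_eq_of_const f hab h,
      ← intervalIntegral.integral_add_adjacent_intervals (hg a ha) (hg' a b ha (ha.trans hab))]
    ring
  have hsq : ∀ k : ℕ, (-1 : ℝ) ^ k * (-1) ^ k = 1 := fun k => by
    rw [← mul_pow]; norm_num
  have hprop : ∀ a b, 0 ≤ a → a ≤ b → M b = M a →
      f a = (-1 : ℝ) ^ M a * (f 0 + ∫ s in (0 : ℝ)..a, (-1 : ℝ) ^ M s * g s) →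
      f b = (-1 : ℝ) ^ M b * (f 0 + ∫ s in (0 : ℝ)..b, (-1 : ℝ) ^ M s * g s) := by
    intro a b ha hab h hfa
    rw [hstep a b ha hab h, hfa, h, ← intervalIntegral.integral_add_adjacent_intervals
      (hεg 0 a le_rfl ha) (hεg a b ha (ha.trans hab)), hconst a b ha hab h]
    linear_combination (- ∫ s in a..b, g s) * hsq (M a)
  -- Strong induction on the number `k` of jumps made so far. The first time `τ` at level `k` is
  -- reached from a time `u` at a lower level, where the formula is known; after `τ` the path only
  -- follows its drift.
  suffices H : ∀ k, ∀ t, 0 ≤ t → M t = k →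
      f t = (-1 : ℝ) ^ M t * (f 0 + ∫ s in (0 : ℝ)..t, (-1 : ℝ) ^ M s * g s) from H _ t ht rfl
  intro k
  induction k using Nat.strong_induction_on with
  | _ k ih =>
  intro t ht hk
  rcases Nat.eq_zero_or_pos k with rfl | hkpos
  · exact hprop 0 t le_rfl ht (hk.trans hM.zero.symm) (by simp [hM.zero])
  set A : Set ℝ := {s | 0 ≤ s ∧ M s = k}
  have hA : A.Nonempty := ⟨t, ht, hk⟩
  have hAb : BddBelow A := ⟨0, fun s hs => hs.1⟩
  set τ := sInf A
  have hτ0 : 0 ≤ τ := le_csInf hA fun s hs => hs.1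
  have hτt : τ ≤ t := csInf_le hAb ⟨ht, hk⟩
  have hMτ : M τ = k := by
    obtain ⟨v, hv, h⟩ := hM.eventually_right τ
    obtain ⟨s, hs, hsv⟩ := exists_lt_of_csInf_lt hA hv
    rw [← h s ⟨csInf_le hAb hs, hsv⟩, hs.2]
  have hτpos : 0 < τ := by
    rcases hτ0.eq_or_lt with h | h
    · rw [← h, hM.zero] at hMτ; omega
    · exact h
  obtain ⟨u, hu, hu0, hconstu⟩ : ∃ u < τ, 0 ≤ u ∧ ∀ s ∈ Ico u τ, M s = M u := by
    obtain ⟨u, hu, h⟩ := hM.exists_left τ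
    refine ⟨max u 0, max_lt hu hτpos, le_max_right _ _, fun s hs => ?_⟩
    rw [h s ⟨(le_max_left _ _).trans hs.1, hs.2⟩, h _ ⟨le_max_left _ _, max_lt hu hτpos⟩]
  -- The unit-jump hypothesis gives `k ≤ M u + 1`, and minimality of `τ` excludes `M u = k`.
  have hMu : M u + 1 = k := by
    obtain ⟨u', hu', h⟩ := hM.unitJump τ hτpos
    have h1 : M u' ≤ M u := by
      rw [← hconstu (max u u') ⟨le_max_left _ _, max_lt hu hu'⟩]
      exact hM.mono (le_max_right _ _)
    have h2 : M u ≤ k := hMτ ▸ hM.mono hu.le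
    have h3 : M u ≠ k := fun h => absurd (csInf_le hAb ⟨hu0, h⟩) (not_le.2 hu)
    omega
  set L := f u + ∫ s in u..τ, g s with hL
  have hLlim : Tendsto f (𝓝[<] τ) (𝓝 L) := by
    have hc : ContinuousWithinAt (fun s => f u + ∫ x in u..s, g x) (Icc u τ) τ := by
      apply ContinuousWithinAt.const_add
      exact intervalIntegral.continuousOn_primitive_interval'
        (hg' u τ hu0 hτ0) (left_mem_uIcc) |>.mono (by rw [uIcc_of_le hu.le]) τ
          (right_mem_Icc.2 hu.le)
    have hc' : Tendsto (fun s => f u + ∫ x in u..s, g x) (𝓝[<] τ) (𝓝 L) :=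
      (hc.mono_of_mem_nhdsWithin
        (s := Iio τ) (mem_of_superset (Ico_mem_nhdsLT hu) Ico_subset_Icc_self))
    refine hc'.congr' ?_
    filter_upwards [Ico_mem_nhdsLT hu] with s hs
    exact (hstep u s hu0 hs.1 (hconstu s hs)).symm
  have hleft : Function.leftLim f τ = L :=
    leftLim_eq_of_tendsto hLlim
  -- The jump subtracts `2 · L · 1`, where `L` is the left limit: the path is reflected.
  have hfτ : f τ = -L := by
    rw [hf τ hτ0, hM.jumpIntegral_eq_add f hu0 hu hconstu, hleft, hMτ, ← hMu, hL, hf u hu0,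
      ← intervalIntegral.integral_add_adjacent_intervals (hg u hu0) (hg' u τ hu0 hτ0)]
    push_cast
    ring
  -- The sign differs from its value at `u` only at the single point `τ`, a null set.
  have hI : ∫ s in u..τ, (-1 : ℝ) ^ M s * g s = (-1 : ℝ) ^ M u * ∫ s in u..τ, g s := by
    rw [← intervalIntegral.integral_const_mul]
    apply intervalIntegral.integral_congr_ae
    have : ∀ᵐ s : ℝ, s ≠ τ := by simp [ae_iff]
    filter_upwards [this] with s hsτ hs
    rw [uIoc_of_le hu.le] at hs
    rw [hconstu s ⟨hs.1.le, lt_of_le_of_ne hs.2 hsτ⟩]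
  refine hprop τ t hτ0 hτt (hk.trans hMτ.symm) ?_
  rw [hfτ, hL, ih (M u) (by omega) u hu0 rfl, hMτ, ← hMu,
    ← intervalIntegral.integral_add_adjacent_intervals (hεg 0 u le_rfl hu0) (hεg u τ hu0 hτ0), hI,
    pow_succ]
  linear_combination (∫ s in u..τ, g s) * hsq (M u)

end IsCountingPath

end HarmonicChain

namespace HarmonicChain

/-! ### Poisson processes -/

/-- `1 - e^{-r}(1 + r) ≤ 1 - (1 - r)(1 + r) = r²`. The quadratic order is what rules out double
jumps. -/
lemma poissonMeasure_two_le (r : ℝ≥0) : (poissonMeasure r) {k | 2 ≤ k} ≤ ENNReal.ofReal ((r : ℝ) ^ 2) := by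
  have hc : {k : ℕ | 2 ≤ k} = ({0, 1} : Set ℕ)ᶜ := by
    ext k; simp; omega
  have h1 : (poissonMeasure r).real {k : ℕ | 2 ≤ k} ≤ (r : ℝ) ^ 2 := by
    rw [hc, probReal_compl_eq_one_sub (by measurability), Set.insert_eq,
      measureReal_union (by simp) (by measurability), poissonMeasure_real_singleton,
      poissonMeasure_real_singleton]
    have h2 := Real.add_one_le_exp (-(r : ℝ))
    have h3 : (0 : ℝ) ≤ r := r.2
    simp only [pow_zero, Nat.factorial, pow_one]
    norm_num
    nlinarith
  rw [← ofReal_measureReal]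
  exact ENNReal.ofReal_le_ofReal h1

/-- The exponential series at `-r`. This is the origin of the friction coefficient `2γ`. -/
lemma integral_neg_one_pow_poissonMeasure (r : ℝ≥0) :
    ∫ k, (-1 : ℝ) ^ k ∂(poissonMeasure r) = Real.exp (-2 * r) := by
  rw [integral_poissonMeasure]
  have h : ∀ k : ℕ, (Real.exp (-r) * r ^ k / (k.factorial : ℝ)) • (-1 : ℝ) ^ k =
      Real.exp (-r) * ((k.factorial : ℝ)⁻¹ • (-(r : ℝ)) ^ k) := fun k => by
    rw [neg_pow (r : ℝ)]
    simp only [smul_eq_mul]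
    ring
  simp_rw [h]
  rw [tsum_mul_left, ← congrFun (NormedSpace.exp_eq_tsum ℝ (𝔸 := ℝ)) (-(r : ℝ)), ← Real.exp_eq_exp_ℝ, ← Real.exp_add]
  ring_nf

variable {Ω : Type*} [MeasurableSpace Ω] {P : Measure Ω}

namespace IsPoissonProcess

variable {N : ℝ≥0 → Ω → ℕ} (hN : IsPoissonProcess N P)
include hN

lemma measure_two_le {s t : ℝ≥0} (hst : s ≤ t) :
    P {ω | 2 ≤ N t ω - N s ω} ≤ ENNReal.ofReal (((t - s : ℝ≥0) : ℝ) ^ 2) := by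
  have h := hN.hasLaw s t hst
  refine le_trans (le_of_eq ?_) (poissonMeasure_two_le (t - s))
  rw [← h.map_eq, Measure.map_apply_of_aemeasurable h.aemeasurable (by measurability)]
  rfl

/-- Cut `[0, K]` into `K M` cells of length `1 / M`. A jump of size at least two forces an increment
of at least two over some cell, which has probability at most `K M · M⁻² = K / M`. Letting `M → ∞`
shows that the exceptional set is null. -/
lemma ae_unitJump_le (K : ℕ) :
    ∀ᵐ ω ∂P, ∀ t : ℝ≥0, 0 < t → t ≤ K → ∃ u < t, N t ω ≤ N u ω + 1 := by
  rw [ae_iff]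
  set B : Set Ω := {ω | ¬ Monotone (fun t => N t ω)} with hB
  have hB0 : P B = 0 := ae_iff.1 hN.mono
  have hle : ∀ m : ℕ, P {ω | ¬ ∀ t : ℝ≥0, 0 < t → t ≤ K → ∃ u < t, N t ω ≤ N u ω + 1} ≤
      ENNReal.ofReal (K / ((m : ℝ) + 1)) := by
    intro m
    set M : ℕ := m + 1
    set A : ℕ → Set Ω := fun k => {ω | 2 ≤ N (((k + 1 : ℕ) : ℝ≥0) / M) ω - N ((k : ℝ≥0) / M) ω}
    have hsub : {ω | ¬ ∀ t : ℝ≥0, 0 < t → t ≤ K → ∃ u < t, N t ω ≤ N u ω + 1} ⊆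
        B ∪ ⋃ k ∈ Finset.range (K * M), A k := by
      intro ω hω
      by_cases hm : Monotone (fun t => N t ω)
      · right
        simp only [mem_ofPred_eq] at hω
        push Not at hω
        obtain ⟨t, ht0, htK, ht⟩ := hω
        have hM0 : (0 : ℝ≥0) < M := by simp [M]
        -- The cell containing `t` is `((j - 1) / M, j / M]`; being open on the left, it has its
        -- left end strictly before `t`.
        set j := ⌈t * M⌉₊
        have hj0 : 0 < j := Nat.ceil_pos.2 (mul_pos ht0 hM0)
        have hjK : j ≤ K * M := by
          apply Nat.ceil_le.2
          push_cast
          gcongr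
        obtain ⟨k, hk⟩ : ∃ k, j = k + 1 := ⟨j - 1, by omega⟩
        simp only [mem_iUnion, Finset.mem_range]
        refine ⟨k, by omega, ?_⟩
        have h1 : (k : ℝ≥0) / M < t := by
          rw [div_lt_iff₀ hM0]
          exact Nat.lt_ceil.1 (by omega)
        have h2 : t ≤ ((k + 1 : ℕ) : ℝ≥0) / M := by
          rw [le_div_iff₀ hM0, ← hk]
          exact Nat.le_ceil _
        have h3 := ht _ h1
        have h4 : N t ω ≤ N (((k + 1 : ℕ) : ℝ≥0) / M) ω := hm h2
        simp only [A, mem_ofPred_eq]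
        omega
      · left; exact hm
    refine (measure_mono hsub).trans ((measure_union_le _ _).trans ?_)
    rw [hB0, zero_add]
    refine (measure_biUnion_finset_le _ _).trans ?_
    have hA : ∀ k ∈ Finset.range (K * M), P (A k) ≤ ENNReal.ofReal (1 / (M : ℝ) ^ 2) := by
      intro k _
      refine (hN.measure_two_le (by gcongr; simp)).trans (le_of_eq ?_)
      congr 1
      rw [← tsub_div]
      push_cast
      simp
    refine (Finset.sum_le_sum hA).trans ?_
    rw [Finset.sum_const, Finset.card_range, nsmul_eq_mul, ← ENNReal.ofReal_natCast,
      ← ENNReal.ofReal_mul (by positivity)]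
    apply ENNReal.ofReal_le_ofReal
    simp only [M]
    push_cast
    apply le_of_eq
    field_simp
  have hlim : Tendsto (fun m : ℕ => ENNReal.ofReal (K / ((m : ℝ) + 1))) atTop (𝓝 0) := by
    rw [← ENNReal.ofReal_zero]
    apply ENNReal.tendsto_ofReal
    simpa [div_eq_mul_inv] using tendsto_one_div_add_atTop_nhds_zero_nat.const_mul (K : ℝ)
  exact le_antisymm (ge_of_tendsto' hlim hle) (zero_le)

lemma ae_isCountingPath {γ : ℝ} (hγ : 0 < γ) :
    ∀ᵐ ω ∂P, IsCountingPath fun s : ℝ => N (γ * s).toNNReal ω := by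
  have hall : ∀ᵐ ω ∂P, ∀ K : ℕ, ∀ t : ℝ≥0, 0 < t → t ≤ K → ∃ u < t, N t ω ≤ N u ω + 1 :=
    ae_all_iff.2 hN.ae_unitJump_le
  filter_upwards [hN.zero, hN.mono, hN.rightCont, hall] with ω h0 h1 h2 h3
  refine ⟨fun s t hst => h1 (Real.toNNReal_mono (by gcongr)), fun t => ?_, by simpa using h0,
    fun t ht => ?_⟩
  · have hc : Continuous fun s : ℝ => (γ * s).toNNReal :=
      continuous_real_toNNReal.comp (continuous_const.mul continuous_id)
    refine ContinuousWithinAt.comp (f := fun s : ℝ => (γ * s).toNNReal)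
      (g := fun s => N s ω) (t := Ici (γ * t).toNNReal) (h2 _) hc.continuousWithinAt
      fun s hs => Real.toNNReal_mono ?_
    have : t ≤ s := hs
    gcongr
  · obtain ⟨K, hK⟩ := exists_nat_ge (γ * t).toNNReal
    obtain ⟨u, hu, hu2⟩ := h3 K _ (Real.toNNReal_pos.2 (by positivity)) hK
    refine ⟨u / γ, ?_, ?_⟩
    · rw [div_lt_iff₀ hγ, mul_comm]
      exact Real.lt_toNNReal_iff_coe_lt.1 hu
    · rw [mul_div_cancel₀ _ hγ.ne', Real.toNNReal_coe]
      exact hu2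

end IsPoissonProcess

end HarmonicChain

namespace HarmonicChain

/-! ### Right-continuous paths -/

/-- The `k`-th dyadic-type approximation of a time from the right. -/
noncomputable def rightApprox (k : ℕ) (s : ℝ) : ℕ := ⌊((k : ℝ) + 1) * s⌋₊

/-- The approximating times lie to the right of `s`, so right continuity is enough. For each `k`
they take countably many values, which makes the approximations jointly measurable. -/
lemma tendsto_rightApprox {f : ℝ → ℝ} {s : ℝ} (hs : 0 ≤ s) (hf : ContinuousWithinAt f (Ici s) s) :
    Tendsto (fun k : ℕ => f (((rightApprox k s : ℝ) + 1) / ((k : ℝ) + 1))) atTop (𝓝 (f s)) := by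
  have hk : ∀ k : ℕ, (0 : ℝ) < (k : ℝ) + 1 := fun k => by positivity
  have h1 : ∀ k : ℕ, s ≤ ((rightApprox k s : ℝ) + 1) / ((k : ℝ) + 1) := fun k => by
    rw [le_div_iff₀ (hk k), mul_comm]
    exact (Nat.lt_floor_add_one _).le
  have h2 : ∀ k : ℕ, ((rightApprox k s : ℝ) + 1) / ((k : ℝ) + 1) ≤ s + 1 / ((k : ℝ) + 1) :=
    fun k => by
      rw [add_div, add_le_add_iff_right, div_le_iff₀ (hk k), mul_comm]
      exact Nat.floor_le (mul_nonneg (hk k).le hs)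
  have h3 : Tendsto (fun k : ℕ => ((rightApprox k s : ℝ) + 1) / ((k : ℝ) + 1)) atTop (𝓝 s) := by
    refine tendsto_of_tendsto_of_tendsto_of_le_of_le tendsto_const_nhds ?_ h1 h2
    simpa using tendsto_one_div_add_atTop_nhds_zero_nat.const_add s
  exact hf.tendsto.comp (tendsto_nhdsWithin_iff.2 ⟨h3, Eventually.of_forall h1⟩)

/-- A process with measurable marginals and right-continuous paths is jointly measurable. -/
lemma aestronglyMeasurable_of_rightCont {Ω : Type*} [MeasurableSpace Ω] {P : Measure Ω} [SFinite P]
    {X : ℝ → Ω → ℝ} (hX : ∀ t, 0 ≤ t → Measurable (X t))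
    (hc : ∀ᵐ ω ∂P, ∀ t, 0 ≤ t → ContinuousWithinAt (fun s => X s ω) (Ici t) t) :
    AEStronglyMeasurable (fun q : ℝ × Ω => X q.1 q.2) ((volume.restrict (Ici 0)).prod P) := by
  refine aestronglyMeasurable_of_tendsto_ae atTop
    (f := fun k (q : ℝ × Ω) => X (((rightApprox k q.1 : ℝ) + 1) / ((k : ℝ) + 1)) q.2) ?_ ?_
  · intro k
    apply Measurable.aestronglyMeasurable
    have h : Measurable fun q : ℕ × Ω => X (((q.1 : ℝ) + 1) / ((k : ℝ) + 1)) q.2 :=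
      measurable_from_prod_countable_right fun j =>
        hX (((j : ℝ) + 1) / ((k : ℝ) + 1)) (by positivity)
    refine h.comp (f := fun q : ℝ × Ω => (rightApprox k q.1, q.2)) ?_
    exact (Nat.measurable_floor.comp (measurable_fst.const_mul _)).prodMk measurable_snd
  · have h1 := Measure.quasiMeasurePreserving_snd (μ := volume.restrict (Ici (0 : ℝ))) (ν := P)
      |>.ae hc
    have h2 := Measure.quasiMeasurePreserving_fst (μ := volume.restrict (Ici (0 : ℝ))) (ν := P)
      |>.ae (ae_restrict_mem measurableSet_Ici)
    filter_upwards [h1, h2] with q hq1 hq2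
    exact tendsto_rightApprox hq2 (hq1 _ hq2)

lemma aestronglyMeasurable_path {f : ℝ → ℝ}
    (hf : ∀ t, 0 ≤ t → ContinuousWithinAt f (Ici t) t) :
    AEStronglyMeasurable f (volume.restrict (Ici 0)) := by
  refine aestronglyMeasurable_of_tendsto_ae atTop
    (f := fun k (s : ℝ) => f (((rightApprox k s : ℝ) + 1) / ((k : ℝ) + 1))) (fun k => ?_) ?_
  · have h : Measurable fun j : ℕ => f (((j : ℝ) + 1) / ((k : ℝ) + 1)) := measurable_from_nat
    exact (h.comp (Nat.measurable_floor.comp (measurable_id.const_mul _))).aestronglyMeasurable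
  · filter_upwards [ae_restrict_mem measurableSet_Ici] with s hs
    exact tendsto_rightApprox hs (hf s hs)

namespace IsCadlag

variable {f : ℝ → ℝ} (hf : IsCadlag f)
include hf

/-- Right continuity and the left limit bound the path near each time; compactness makes the bound
global on `[0, T]`. -/
lemma exists_bound (T : ℝ) : ∃ C, ∀ t ∈ Icc 0 T, |f t| ≤ C := by
  refine isCompact_Icc.induction_on (p := fun s => ∃ C, ∀ t ∈ s, |f t| ≤ C)
    ⟨0, by simp⟩ (fun s t hst ⟨C, hC⟩ => ⟨C, fun x hx => hC x (hst hx)⟩)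
    (fun s t ⟨C, hC⟩ ⟨D, hD⟩ => ⟨max C D, fun x hx => hx.elim
      (fun h => (hC x h).trans (le_max_left _ _)) fun h => (hD x h).trans (le_max_right _ _)⟩) ?_
  intro t ht
  have hright : ∃ C, ∀ᶠ s in 𝓝[≥] t, |f s| ≤ C :=
    ⟨|f t| + 1, (hf.1 t ht.1).abs.tendsto.eventually_le_const (by simp)⟩
  obtain ⟨C, hC⟩ := hright
  rcases ht.1.eq_or_lt with rfl | h0
  · refine ⟨{s | |f s| ≤ C}, ?_, C, fun s hs => hs⟩
    exact nhdsWithin_mono _ Icc_subset_Ici_self hC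
  · obtain ⟨l, hl⟩ := hf.2 t h0
    have hleft : ∀ᶠ s in 𝓝[<] t, |f s| ≤ |l| + 1 :=
      hl.abs.eventually_le_const (by simp)
    refine ⟨{s | |f s| ≤ max C (|l| + 1)}, mem_nhdsWithin_of_mem_nhds ?_, _, fun s hs => hs⟩
    rw [← nhdsLT_sup_nhdsGE]
    exact ⟨hleft.mono fun s hs => hs.trans (le_max_right _ _),
      hC.mono fun s hs => hs.trans (le_max_left _ _)⟩

lemma intervalIntegrable {a b : ℝ} (ha : 0 ≤ a) (hb : 0 ≤ b) :
    IntervalIntegrable f volume a b := by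
  have key : ∀ a b : ℝ, 0 ≤ a → IntegrableOn f (Ioc a b) := by
    intro a b ha
    obtain ⟨C, hC⟩ := hf.exists_bound b
    refine Integrable.of_bound (C := C) ((aestronglyMeasurable_path hf.1).mono_measure
        (Measure.restrict_mono (s := Ioc a b) (fun x hx => ha.trans hx.1.le) le_rfl)) ?_
    filter_upwards [ae_restrict_mem measurableSet_Ioc] with x hx
    exact hC x ⟨ha.trans hx.1.le, hx.2⟩
  exact ⟨key a b ha, key b a hb⟩

end IsCadlag

/-- Grönwall's inequality in integral form, for a right-continuous function. -/
lemma gronwall_integral {u a : ℝ → ℝ} {C T : ℝ} (hC : 0 ≤ C) (hT : 0 ≤ T)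
    (hu : IntervalIntegrable u volume 0 T)
    (huc : ∀ t ∈ Ico 0 T, ContinuousWithinAt u (Ici t) t)
    (hac : Continuous a) (ha0 : ∀ t, 0 ≤ a t)
    (h : ∀ t ∈ Icc 0 T, u t ≤ a t + C * ∫ s in (0 : ℝ)..t, u s) :
    u T ≤ a T + C * Real.exp (C * T) * ∫ s in (0 : ℝ)..T, a s := by
  have hsub : ∀ t ∈ Icc 0 T, IntervalIntegrable u volume 0 t := fun t ht =>
    hu.mono_set (by rw [uIcc_of_le ht.1, uIcc_of_le hT]; exact Icc_subset_Icc_right ht.2)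
  have hV : ContinuousOn (fun t => ∫ s in (0 : ℝ)..t, u s) (Icc 0 T) := by
    have := intervalIntegral.continuousOn_primitive_interval' hu left_mem_uIcc
    rwa [uIcc_of_le hT] at this
  have hVd : ∀ t ∈ Ico 0 T, HasDerivWithinAt (fun t => ∫ s in (0 : ℝ)..t, u s) (u t) (Ici t) t := by
    intro t ht
    apply intervalIntegral.integral_hasDerivWithinAt_right (hsub t ⟨ht.1, ht.2.le⟩) (s := Ici t)
      (t := Ioi t)
    · refine AEStronglyMeasurable.stronglyMeasurableAtFilter_of_mem
        (s := Ioc 0 T) hu.1.aestronglyMeasurable ?_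
      exact mem_of_superset (Ioc_mem_nhdsGT ht.2) (Ioc_subset_Ioc_left ht.1)
    · exact (huc t ht).mono Ioi_subset_Ici_self
  -- The function `e^{-Ct} ∫₀ᵗ u` has right derivative `e^{-Ct}(u - C ∫ u) ≤ a`. Only a right
  -- derivative is available, since `u` is merely right-continuous.
  have key := image_le_of_deriv_right_le_deriv_boundary
    (f := fun t => Real.exp (-(C * t)) * ∫ s in (0 : ℝ)..t, u s)
    (f' := fun t => Real.exp (-(C * t)) * (-C) * (∫ s in (0 : ℝ)..t, u s)
      + Real.exp (-(C * t)) * u t) (a := 0) (b := T)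
    (B := fun t => ∫ s in (0 : ℝ)..t, a s) (B' := a) ?_ ?_ (by simp) ?_ ?_ ?_
    (right_mem_Icc.2 hT)
  · have h1 := h T (right_mem_Icc.2 hT)
    have h2 : ∫ s in (0 : ℝ)..T, u s ≤ Real.exp (C * T) * ∫ s in (0 : ℝ)..T, a s := by
      have := mul_le_mul_of_nonneg_left key (Real.exp_pos (C * T)).le
      rwa [← mul_assoc, ← Real.exp_add, add_neg_cancel, Real.exp_zero, one_mul] at this
    have h3 := mul_le_mul_of_nonneg_left h2 hC
    linarith
  · exact (by fun_prop : Continuous fun t => Real.exp (-(C * t))).continuousOn.mul hV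
  · intro t ht
    have he : HasDerivAt (fun t : ℝ => Real.exp (-(C * t))) (Real.exp (-(C * t)) * (-C)) t := by
      simpa using ((hasDerivAt_id t).const_mul C).neg.exp
    exact he.hasDerivWithinAt.mul (hVd t ht)
  · exact (intervalIntegral.continuous_primitive (fun a b => hac.intervalIntegrable a b) 0).continuousOn
  · exact fun t _ => (hac.integral_hasStrictDerivAt 0 t).hasDerivAt.hasDerivWithinAt
  · intro t ht
    have h1 := h t ⟨ht.1, ht.2.le⟩
    have h2 : Real.exp (-(C * t)) ≤ 1 := Real.exp_le_one_iff.2 (by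
      have := mul_nonneg hC ht.1; linarith)
    calc _ = Real.exp (-(C * t)) * (u t - C * ∫ s in (0 : ℝ)..t, u s) := by ring
      _ ≤ Real.exp (-(C * t)) * a t := by gcongr; linarith
      _ ≤ 1 * a t := by gcongr; exact ha0 t
      _ = a t := one_mul _

end HarmonicChain

namespace HarmonicChain

/-! ### The pathwise dynamics -/

/-- The equations satisfied by almost every path of the chain. -/
structure IsChainPath (n : ℕ) (γ κ : ℝ) (F : ℝ → ℝ) (M : ℕ → ℝ → ℕ) (w : ℝ → ℝ)
    (r p : ℕ → ℝ → ℝ) : Prop where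
  count : ∀ x ∈ Finset.Icc 1 n, IsCountingPath (M x)
  cont_w : Continuous w
  cadlag : ∀ x ≤ n, IsCadlag (p x)
  r_left : ∀ t, r 0 t = 0
  r_right : ∀ t, r (n + 1) t = 0
  eq_r : ∀ x ∈ Finset.Icc 1 n, ∀ t, 0 ≤ t →
    r x t = r x 0 + ∫ s in (0 : ℝ)..t, (p x s - p (x - 1) s)
  eq_p_zero : ∀ t, 0 ≤ t →
    p 0 t = p 0 0 + (∫ s in (0 : ℝ)..t, (r 1 s - 2 * γ * p 0 s)) + κ * w t
  eq_p : ∀ x ∈ Finset.Icc 1 n, ∀ t, 0 ≤ t →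
    p x t = p x 0 + (∫ s in (0 : ℝ)..t, (r (x + 1) s - r x s + if x = n then F s else 0))
      - 2 * jumpIntegral (p x) (M x) t

namespace IsChainPath

variable {n : ℕ} {γ κ : ℝ} {F : ℝ → ℝ} {M : ℕ → ℝ → ℕ} {w : ℝ → ℝ} {r p : ℕ → ℝ → ℝ}
  (h : IsChainPath n γ κ F M w r p)

include h

lemma integrable_p {x : ℕ} (hx : x ≤ n) {a b : ℝ} (ha : 0 ≤ a) (hb : 0 ≤ b) :
    IntervalIntegrable (p x) volume a b :=
  (h.cadlag x hx).intervalIntegrable ha hb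

lemma continuousOn_r {x : ℕ} (hx : x ≤ n + 1) : ContinuousOn (r x) (Ici 0) := by
  rcases Nat.eq_zero_or_pos x with rfl | h0
  · exact continuousOn_const.congr fun t _ => h.r_left t
  rcases hx.eq_or_lt with rfl | h1
  · exact continuousOn_const.congr fun t _ => h.r_right t
  have hx' : x ∈ Finset.Icc 1 n := Finset.mem_Icc.2 ⟨h0, by omega⟩
  refine ContinuousOn.congr (f := fun t => r x 0 + ∫ s in (0 : ℝ)..t, (p x s - p (x - 1) s)) ?_
    fun t ht => h.eq_r x hx' t ht
  apply continuousOn_const.add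
  intro t ht
  have ht' : (0 : ℝ) ≤ t := ht
  have hint : IntervalIntegrable (fun s => p x s - p (x - 1) s) volume 0 (t + 1) :=
    (h.integrable_p (by omega) le_rfl (by linarith)).sub
      (h.integrable_p (by omega) le_rfl (by linarith))
  have hc := intervalIntegral.continuousOn_primitive_interval' hint left_mem_uIcc
  rw [uIcc_of_le (by linarith)] at hc
  refine (hc t ⟨ht', by linarith⟩).mono_of_mem_nhdsWithin ?_
  rw [← Ici_inter_Iic]
  exact inter_mem_nhdsWithin _ (Iic_mem_nhds (by linarith))

lemma integrable_r {x : ℕ} (hx : x ≤ n + 1) {a b : ℝ} (ha : 0 ≤ a) (hb : 0 ≤ b) :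
    IntervalIntegrable (r x) volume a b := by
  apply ContinuousOn.intervalIntegrable
  exact (h.continuousOn_r hx).mono fun s hs => (le_min ha hb).trans hs.1

lemma integrable_drift (hF : Continuous F) {x : ℕ} (hx : x ≤ n) {a b : ℝ} (ha : 0 ≤ a)
    (hb : 0 ≤ b) : IntervalIntegrable
      (fun s => r (x + 1) s - r x s + if x = n then F s else 0) volume a b := by
  refine ((h.integrable_r (by omega) ha hb).sub (h.integrable_r (by omega) ha hb)).add ?_
  split_ifs
  · exact hF.intervalIntegrable _ _
  · exact intervalIntegrable_const

lemma p_eq_sign_mul (hF : Continuous F) {x : ℕ} (hx : x ∈ Finset.Icc 1 n) {t : ℝ} (ht : 0 ≤ t) :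
    p x t = (-1 : ℝ) ^ M x t * (p x 0 + ∫ s in (0 : ℝ)..t,
      (-1 : ℝ) ^ M x s * (r (x + 1) s - r x s + if x = n then F s else 0)) :=
  (h.count x hx).eq_sign_mul
    (fun _ ht => h.integrable_drift hF (Finset.mem_Icc.1 hx).2 le_rfl ht) (h.eq_p x hx) ht

end IsChainPath

/-- The `ℓ¹` size of a configuration. -/
def sizeL1 (n : ℕ) (r p : ℕ → ℝ → ℝ) (t : ℝ) : ℝ :=
  ∑ x ∈ Finset.range (n + 1), (|r x t| + |p x t|)

lemma abs_r_le_sizeL1 {n x : ℕ} {r p : ℕ → ℝ → ℝ} (hr : ∀ t, r (n + 1) t = 0) (hx : x ≤ n + 1)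
    (t : ℝ) : |r x t| ≤ sizeL1 n r p t := by
  rcases hx.eq_or_lt with rfl | h1
  · rw [hr, abs_zero]; exact Finset.sum_nonneg fun x _ => by positivity
  refine le_trans ?_ (Finset.single_le_sum (f := fun x => |r x t| + |p x t|)
    (fun x _ => by positivity) (Finset.mem_range.2 h1))
  simp

lemma abs_p_le_sizeL1 {n x : ℕ} {r p : ℕ → ℝ → ℝ} (hx : x ≤ n) (t : ℝ) :
    |p x t| ≤ sizeL1 n r p t := by
  refine le_trans ?_ (Finset.single_le_sum (f := fun x => |r x t| + |p x t|)
    (fun x _ => by positivity) (Finset.mem_range.2 (Nat.lt_succ_of_le hx)))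
  simp

namespace IsChainPath

variable {n : ℕ} {γ κ : ℝ} {F : ℝ → ℝ} {M : ℕ → ℝ → ℕ} {w : ℝ → ℝ} {r p : ℕ → ℝ → ℝ}
  (h : IsChainPath n γ κ F M w r p)

include h

lemma sizeL1_rightCont {t : ℝ} (ht : 0 ≤ t) : ContinuousWithinAt (sizeL1 n r p) (Ici t) t := by
  unfold sizeL1
  apply tendsto_finsetSum
  intro x hx
  have hx' : x ≤ n := Nat.lt_succ_iff.1 (Finset.mem_range.1 hx)
  exact (((h.continuousOn_r (by omega)) t ht).mono (Ici_subset_Ici.2 ht)).abs.add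
    ((h.cadlag x hx').1 t ht).abs

lemma integrable_sizeL1 {a b : ℝ} (ha : 0 ≤ a) (hb : 0 ≤ b) :
    IntervalIntegrable (sizeL1 n r p) volume a b := by
  have : sizeL1 n r p = ∑ x ∈ Finset.range (n + 1), fun t => |r x t| + |p x t| := by
    ext t; simp [sizeL1]
  rw [this]
  refine IntervalIntegrable.sum _ fun x hx => ?_
  have hx' : x ≤ n := Nat.lt_succ_iff.1 (Finset.mem_range.1 hx)
  exact (h.integrable_r (by omega) ha hb).abs.add (h.integrable_p hx' ha hb).abs

/-- By `p_eq_sign_mul` the flips do not affect absolute values, so every coordinate is bounded by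
its initial value, the noise and the integral of its drift. The rate `2 + 2γ` covers all the
equations at once. -/
lemma coord_bound (hγ : 0 ≤ γ) (hκ : 0 ≤ κ) (hn : 1 ≤ n) (hF : Continuous F) {B : ℝ}
    (hB : ∀ t, |F t| ≤ B) {x : ℕ} (hx : x ≤ n) {t : ℝ} (ht : 0 ≤ t) :
    |r x t| ≤ |r x 0| + (κ * |w t| + ∫ s in (0 : ℝ)..t, ((2 + 2 * γ) * sizeL1 n r p s + B)) ∧
    |p x t| ≤ |p x 0| + (κ * |w t| + ∫ s in (0 : ℝ)..t, ((2 + 2 * γ) * sizeL1 n r p s + B)) := by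
  have hB0 : 0 ≤ B := (abs_nonneg _).trans (hB 0)
  have hZ0 : ∀ s, 0 ≤ sizeL1 n r p s := fun s => Finset.sum_nonneg fun x _ => by positivity
  have hR : ∀ x ≤ n + 1, ∀ s, |r x s| ≤ sizeL1 n r p s := fun x hx s =>
    abs_r_le_sizeL1 h.r_right hx s
  have hP : ∀ x ≤ n, ∀ s, |p x s| ≤ sizeL1 n r p s := fun x hx s => abs_p_le_sizeL1 hx s
  have hint : IntervalIntegrable (fun s => (2 + 2 * γ) * sizeL1 n r p s + B) volume 0 t :=
    ((h.integrable_sizeL1 le_rfl ht).const_mul _).add intervalIntegrable_const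
  have hbd : ∀ g : ℝ → ℝ, (∀ s, |g s| ≤ (2 + 2 * γ) * sizeL1 n r p s + B) →
      |∫ s in (0 : ℝ)..t, g s| ≤ ∫ s in (0 : ℝ)..t, ((2 + 2 * γ) * sizeL1 n r p s + B) :=
    fun g hg => by
      rw [← Real.norm_eq_abs]
      exact intervalIntegral.norm_integral_le_of_norm_le ht
        (Eventually.of_forall fun s _ => hg s) hint
  have hI0 : 0 ≤ ∫ s in (0 : ℝ)..t, ((2 + 2 * γ) * sizeL1 n r p s + B) :=
    intervalIntegral.integral_nonneg ht fun s _ => by have := hZ0 s; positivity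
  have hw0 : 0 ≤ κ * |w t| := by positivity
  have hdr : ∀ y ≤ n, ∀ s, |r (y + 1) s - r y s + if y = n then F s else 0| ≤
      (2 + 2 * γ) * sizeL1 n r p s + B := by
    intro y hy s
    have h1 := abs_le.1 (hR (y + 1) (by omega) s)
    have h2 := abs_le.1 (hR y (by omega) s)
    have h3 := abs_le.1 (hB s)
    have h4 := mul_nonneg hγ (hZ0 s)
    split_ifs <;> rw [abs_le] <;> constructor <;> nlinarith
  constructor
  · rcases Nat.eq_zero_or_pos x with rfl | h0
    · rw [h.r_left, h.r_left, abs_zero]; linarith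
    rw [h.eq_r x (Finset.mem_Icc.2 ⟨h0, hx⟩) t ht]
    refine (abs_add_le _ _).trans ?_
    have := hbd (fun s => p x s - p (x - 1) s) fun s => by
      have h1 := abs_le.1 (hP x hx s)
      have h2 := abs_le.1 (hP (x - 1) (by omega) s)
      have h4 := mul_nonneg hγ (hZ0 s)
      rw [abs_le]; constructor <;> nlinarith
    linarith
  · rcases Nat.eq_zero_or_pos x with rfl | h0
    · rw [h.eq_p_zero t ht]
      refine (abs_add_le _ _).trans ?_
      rw [abs_mul, abs_of_nonneg hκ]
      have h5 := abs_add_le (p 0 0) (∫ s in (0 : ℝ)..t, (r 1 s - 2 * γ * p 0 s))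
      have := hbd (fun s => r 1 s - 2 * γ * p 0 s) fun s => by
        have h1 := abs_le.1 (hR 1 (by omega) s)
        have h2 := abs_le.1 (hP 0 (by omega) s)
        have h4 := hZ0 s
        rw [abs_le]; constructor <;> nlinarith [mul_le_mul_of_nonneg_left h2.1 hγ,
          mul_le_mul_of_nonneg_left h2.2 hγ]
      linarith
    · have hx' := Finset.mem_Icc.2 ⟨h0, hx⟩
      rw [h.p_eq_sign_mul hF hx' ht, abs_mul, abs_pow, abs_neg, abs_one, one_pow, one_mul]
      refine (abs_add_le _ _).trans ?_
      have := hbd (fun s => (-1 : ℝ) ^ M x s * (r (x + 1) s - r x s + if x = n then F s else 0))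
        fun s => by
          rw [abs_mul, abs_pow, abs_neg, abs_one, one_pow, one_mul]
          exact hdr x hx s
      linarith

/-- A priori bound for the size of the configuration up to time `T`. -/
lemma sizeL1_le (hγ : 0 ≤ γ) (hκ : 0 ≤ κ) (hn : 1 ≤ n) (hF : Continuous F) {B : ℝ}
    (hB : ∀ t, |F t| ≤ B) {t T : ℝ} (ht : 0 ≤ t) (htT : t ≤ T) {m K : ℝ} (hm : m = 2 * (n + 1))
    (hK : K = m * (2 + 2 * γ)) :
    sizeL1 n r p t ≤ m * κ * |w t| + (sizeL1 n r p 0 + m * B * T + K * Real.exp (K * T) *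
      (T * (sizeL1 n r p 0 + m * B * T) + m * κ * ∫ s in (0 : ℝ)..T, |w s|)) := by
  have hB0 : 0 ≤ B := (abs_nonneg _).trans (hB 0)
  have hm0 : 0 ≤ m := by rw [hm]; positivity
  have hK0 : 0 ≤ K := by rw [hK]; positivity
  have hZ0 : 0 ≤ sizeL1 n r p 0 := Finset.sum_nonneg fun x _ => by positivity
  have hT0 : 0 ≤ T := ht.trans htT
  set a : ℝ → ℝ := fun s => m * κ * |w s| + (sizeL1 n r p 0 + m * B * T) with ha
  have hac : Continuous a := by have := h.cont_w; fun_prop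
  have ha0 : ∀ s, 0 ≤ a s := fun s => by positivity
  -- The factor `m = 2 (n + 1)` counts the coordinates. The noise is kept inside `a`, so the final
  -- bound is affine in `|w t|` and in `∫ |w|`, hence integrable over the probability space.
  have hg := gronwall_integral (u := sizeL1 n r p) (a := a) (C := K) hK0 ht
    (h.integrable_sizeL1 le_rfl ht) (fun s hs => h.sizeL1_rightCont hs.1) hac ha0 ?_
  · refine hg.trans ?_
    have h1 : ∫ s in (0 : ℝ)..t, a s ≤ ∫ s in (0 : ℝ)..T, a s :=
      intervalIntegral.integral_mono_interval le_rfl ht htT (Eventually.of_forall ha0)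
        (hac.intervalIntegrable _ _)
    have h2 : ∫ s in (0 : ℝ)..T, a s = T * (sizeL1 n r p 0 + m * B * T)
        + m * κ * ∫ s in (0 : ℝ)..T, |w s| := by
      have hi : IntervalIntegrable (fun s => m * κ * |w s|) volume 0 T :=
        (h.cont_w.abs.const_mul (m * κ)).intervalIntegrable _ _
      simp only [ha]
      rw [intervalIntegral.integral_add hi intervalIntegrable_const,
        intervalIntegral.integral_const_mul, intervalIntegral.integral_const]
      simp; ring
    have h3 : K * Real.exp (K * t) * ∫ s in (0 : ℝ)..t, a s ≤
        K * Real.exp (K * T) * ∫ s in (0 : ℝ)..T, a s := by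
      have : 0 ≤ ∫ s in (0 : ℝ)..t, a s := intervalIntegral.integral_nonneg ht fun s _ => ha0 s
      gcongr
    rw [h2] at h3
    simp only [ha]
    linarith
  · intro s hs
    have hsum : sizeL1 n r p s ≤ ∑ x ∈ Finset.range (n + 1), ((|r x 0| + |p x 0|) +
        2 * (κ * |w s| + ∫ v in (0 : ℝ)..s, ((2 + 2 * γ) * sizeL1 n r p v + B))) := by
      apply Finset.sum_le_sum
      intro x hx
      have := h.coord_bound hγ hκ hn hF hB (Nat.lt_succ_iff.1 (Finset.mem_range.1 hx)) hs.1
      linarith [this.1, this.2]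
    rw [Finset.sum_add_distrib, Finset.sum_const, Finset.card_range, nsmul_eq_mul,
      intervalIntegral.integral_add ((h.integrable_sizeL1 le_rfl hs.1).const_mul _)
        intervalIntegrable_const, intervalIntegral.integral_const_mul,
        intervalIntegral.integral_const] at hsum
    have hsT : m * B * s ≤ m * B * T := by
      have := hs.2.trans htT
      gcongr
    simp only [ha, hK]
    have e : ∑ x ∈ Finset.range (n + 1), (|r x 0| + |p x 0|) = sizeL1 n r p 0 := rfl
    rw [e] at hsum
    have hm' : ((n + 1 : ℕ) : ℝ) = m / 2 := by rw [hm]; push_cast; ring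
    rw [hm'] at hsum
    simp only [smul_eq_mul, sub_zero] at hsum
    linarith

end IsChainPath

end HarmonicChain

namespace HarmonicChain

/-! ### Primitives on the half-line -/

lemma continuousOn_primitive_Ici {g : ℝ → ℝ} (hg : ∀ t, 0 ≤ t → IntervalIntegrable g volume 0 t) :
    ContinuousOn (fun t => ∫ s in (0 : ℝ)..t, g s) (Ici 0) := by
  intro t ht
  have ht' : (0 : ℝ) ≤ t := ht
  have hc := intervalIntegral.continuousOn_primitive_interval' (hg (t + 1) (by linarith))
    left_mem_uIcc
  rw [uIcc_of_le (by linarith)] at hc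
  refine (hc t ⟨ht', by linarith⟩).mono_of_mem_nhdsWithin ?_
  rw [← Ici_inter_Iic]
  exact inter_mem_nhdsWithin _ (Iic_mem_nhds (by linarith))

lemma intervalIntegrable_of_continuousOn_Ici {E : Type*} [NormedAddCommGroup E] {g : ℝ → E}
    (hg : ContinuousOn g (Ici 0)) {a b : ℝ} (ha : 0 ≤ a) (hb : 0 ≤ b) :
    IntervalIntegrable g volume a b :=
  ContinuousOn.intervalIntegrable (hg.mono fun _ hs => (le_min ha hb).trans hs.1)

lemma hasDerivAt_primitive_Ici {g : ℝ → ℝ} (hg : ContinuousOn g (Ici 0)) {t : ℝ} (ht : 0 < t) :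
    HasDerivAt (fun t => ∫ s in (0 : ℝ)..t, g s) (g t) t :=
  intervalIntegral.integral_hasDerivAt_right
    (intervalIntegrable_of_continuousOn_Ici hg le_rfl ht.le)
    ((hg.mono Ioi_subset_Ici_self).stronglyMeasurableAtFilter isOpen_Ioi t ht)
    (hg.continuousAt (Ici_mem_nhds ht))

/-! ### Averages of processes -/

/-- A process which is integrable at each time, and jointly integrable on bounded time intervals. -/
structure IsAverageable {Ω : Type*} [MeasurableSpace Ω] (P : Measure Ω) (X : ℝ → Ω → ℝ) :
    Prop where
  integrable : ∀ t, 0 ≤ t → Integrable (X t) P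
  integrable_prod : ∀ t, 0 ≤ t →
    Integrable (fun q : ℝ × Ω => X q.1 q.2) ((volume.restrict (Ioc 0 t)).prod P)

namespace IsAverageable

variable {Ω : Type*} [MeasurableSpace Ω] {P : Measure Ω} {X Y : ℝ → Ω → ℝ}

lemma add (hX : IsAverageable P X) (hY : IsAverageable P Y) :
    IsAverageable P (fun t ω => X t ω + Y t ω) :=
  ⟨fun t ht => (hX.integrable t ht).add (hY.integrable t ht),
    fun t ht => (hX.integrable_prod t ht).add (hY.integrable_prod t ht)⟩

lemma sub (hX : IsAverageable P X) (hY : IsAverageable P Y) :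
    IsAverageable P (fun t ω => X t ω - Y t ω) :=
  ⟨fun t ht => (hX.integrable t ht).sub (hY.integrable t ht),
    fun t ht => (hX.integrable_prod t ht).sub (hY.integrable_prod t ht)⟩

lemma const_mul (hX : IsAverageable P X) (c : ℝ) : IsAverageable P (fun t ω => c * X t ω) :=
  ⟨fun t ht => (hX.integrable t ht).const_mul c,
    fun t ht => (hX.integrable_prod t ht).const_mul c⟩

lemma of_continuous [IsFiniteMeasure P] {F : ℝ → ℝ} (hF : Continuous F) :
    IsAverageable P (fun t _ => F t) :=
  ⟨fun _ _ => integrable_const _, fun t _ =>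
    ((hF.integrableOn_Icc (a := 0) (b := t)).mono_set Ioc_subset_Icc_self).comp_fst P⟩

variable [SFinite P]

lemma intervalIntegrable_mean (hX : IsAverageable P X) {t : ℝ} (ht : 0 ≤ t) :
    IntervalIntegrable (fun s => ∫ ω, X s ω ∂P) volume 0 t :=
  (intervalIntegrable_iff_integrableOn_Ioc_of_le ht).2 (hX.integrable_prod t ht).integral_prod_left

lemma mean_integral (hX : IsAverageable P X) {t : ℝ} (ht : 0 ≤ t) :
    ∫ ω, (∫ s in (0 : ℝ)..t, X s ω) ∂P = ∫ s in (0 : ℝ)..t, ∫ ω, X s ω ∂P := by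
  simp only [intervalIntegral.integral_of_le ht]
  exact integral_integral_swap (hX.integrable_prod t ht).swap

lemma integrable_integral (hX : IsAverageable P X) {t : ℝ} (ht : 0 ≤ t) :
    Integrable (fun ω => ∫ s in (0 : ℝ)..t, X s ω) P := by
  simp only [intervalIntegral.integral_of_le ht]
  exact (hX.integrable_prod t ht).integral_prod_right

/-- For the chain, `Y` is the Wiener process and `G` collects the initial size and the time integral
of `|w|`. Right continuity gives joint measurability, so that domination yields the hypotheses of
Fubini. -/
lemma of_bound (hX : ∀ t, 0 ≤ t → Measurable (X t))
    (hXc : ∀ᵐ ω ∂P, ∀ t, 0 ≤ t → ContinuousWithinAt (fun s => X s ω) (Ici t) t)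
    (hY : IsAverageable P Y)
    (hG : ∀ T, 0 ≤ T → ∃ G : Ω → ℝ, Integrable G P ∧ ∃ K : ℝ,
      ∀ᵐ ω ∂P, ∀ t, 0 ≤ t → t ≤ T → |X t ω| ≤ K * |Y t ω| + G ω) :
    IsAverageable P X := by
  refine ⟨fun t ht => ?_, fun t ht => ?_⟩
  · obtain ⟨G, hG1, K, h⟩ := hG t ht
    refine (((hY.integrable t ht).abs.const_mul K).add hG1).mono'
      (hX t ht).aestronglyMeasurable ?_
    filter_upwards [h] with ω hω using hω t ht le_rfl
  · obtain ⟨G, hG1, K, h⟩ := hG t ht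
    have hG2 : Integrable (fun q : ℝ × Ω => G q.2) ((volume.restrict (Ioc 0 t)).prod P) :=
      hG1.comp_snd _
    refine (((hY.integrable_prod t ht).abs.const_mul K).add hG2).mono' ?_ ?_
    · exact (aestronglyMeasurable_of_rightCont hX hXc).mono_measure
        (Measure.prod_mono (Measure.restrict_mono (fun x hx => hx.1.le) le_rfl) le_rfl)
    · have h1 := Measure.quasiMeasurePreserving_snd (μ := volume.restrict (Ioc (0 : ℝ) t)) (ν := P)
        |>.ae h
      have h2 := Measure.quasiMeasurePreserving_fst (μ := volume.restrict (Ioc (0 : ℝ) t)) (ν := P)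
        |>.ae (ae_restrict_mem measurableSet_Ioc)
      filter_upwards [h1, h2] with q hq1 hq2
      exact hq1 q.1 hq2.1.le hq2.2

end IsAverageable

/-- From `|w| ≤ 1 + w²` and variance `t`. Any bound locally bounded in time would do. -/
lemma IsBrownianReal.integral_abs_le {Ω : Type*} [MeasurableSpace Ω] {P : Measure Ω}
    [IsProbabilityMeasure P] {w : ℝ≥0 → Ω → ℝ} (hw : IsBrownianReal w P) (t : ℝ≥0) :
    ∫ ω, |w t ω| ∂P ≤ 1 + t := by
  have hlaw := hw.hasLaw_eval t
  have hL2 : MemLp (w t) 2 P := by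
    have h1 : MemLp id 2 (gaussianReal 0 t) := memLp_id_gaussianReal 2
    rw [← hlaw.map_eq] at h1
    exact (memLp_map_measure_iff (by fun_prop) hlaw.aemeasurable).1 h1
  have hsq : ∫ ω, (w t ω) ^ 2 ∂P = t := by
    have := hw.covariance_eval t t
    rw [covariance_self hlaw.aemeasurable, variance_eq_sub hL2, hw.integral_eval] at this
    simpa using this
  calc ∫ ω, |w t ω| ∂P ≤ ∫ ω, (1 + (w t ω) ^ 2) ∂P := by
        refine integral_mono (hw.integrable_eval t).abs
          ((integrable_const _).add hL2.integrable_sq) fun ω => ?_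
        have : |w t ω| ^ 2 = (w t ω) ^ 2 := sq_abs _
        simp only
        nlinarith [sq_nonneg (|w t ω| - 1), abs_nonneg (w t ω)]
    _ = 1 + t := by
        rw [integral_add (integrable_const _) hL2.integrable_sq, hsq]
        simp

lemma IsBrownianReal.isAverageable {Ω : Type*} [MeasurableSpace Ω] {P : Measure Ω}
    [IsProbabilityMeasure P] {w : ℝ≥0 → Ω → ℝ} (hw : IsBrownianReal w P)
    (hm : ∀ t, Measurable (w t)) : IsAverageable P (fun t => w t.toNNReal) := by
  refine ⟨fun t _ => hw.integrable_eval _, fun t ht => ?_⟩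
  have hae : AEStronglyMeasurable (fun q : ℝ × Ω => w q.1.toNNReal q.2)
      ((volume.restrict (Ioc 0 t)).prod P) := by
    refine (aestronglyMeasurable_of_rightCont (X := fun t => w t.toNNReal) (fun t _ => hm _)
      ?_).mono_measure
        (Measure.prod_mono (Measure.restrict_mono (fun x hx => hx.1.le) le_rfl) le_rfl)
    filter_upwards [hw.cont] with ω hω s _
    exact (hω.comp continuous_real_toNNReal).continuousWithinAt
  rw [integrable_prod_iff hae]
  refine ⟨Eventually.of_forall fun s => hw.integrable_eval s.toNNReal, ?_⟩
  refine Integrable.of_bound (C := 1 + t) hae.norm.integral_prod_right' ?_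
  filter_upwards [ae_restrict_mem measurableSet_Ioc] with s hs
  rw [Real.norm_of_nonneg (integral_nonneg fun _ => norm_nonneg _)]
  refine (IsBrownianReal.integral_abs_le hw _).trans ?_
  rw [Real.coe_toNNReal _ hs.1.le]
  linarith [hs.2]

end HarmonicChain

namespace HarmonicChain

/-! ### The averaged dynamics -/

/-- The linear system solved by the averages of the chain: stretches `R 1, …, R n` with the
conventions `R 0 = 0`, `R (n + 1) = F`, and momenta `Q 0, …, Q n`. -/
structure IsMeanChain (n : ℕ) (γ : ℝ) (F : ℝ → ℝ) (R Q : ℕ → ℝ → ℝ) : Prop where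
  cont_r : ∀ x ≤ n + 1, ContinuousOn (R x) (Ici 0)
  cont_p : ∀ x ≤ n, ContinuousOn (Q x) (Ici 0)
  r_left : ∀ t, R 0 t = 0
  r_right : ∀ t, R (n + 1) t = F t
  deriv_r : ∀ x < n, ∀ t, 0 < t → HasDerivAt (R (x + 1)) (Q (x + 1) t - Q x t) t
  deriv_p : ∀ x ≤ n, ∀ t, 0 < t → HasDerivAt (Q x) (R (x + 1) t - R x t - 2 * γ * Q x t) t

namespace IsChainNoise

variable {Ω : Type*} [mΩ : MeasurableSpace Ω] {n : ℕ} {γ : ℝ} {P : Measure Ω}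
  {ℱ : Filtration ℝ≥0 mΩ} {N : ℕ → ℝ≥0 → Ω → ℕ} {w : ℝ≥0 → Ω → ℝ}
  (h : IsChainNoise n γ P ℱ N w)

include h

lemma measurable_poisson (hγ : 0 < γ) {x : ℕ} (hx : x ∈ Finset.Icc 1 n) (t : ℝ≥0) :
    Measurable (N x t) := by
  have := (h.adapted_poisson x hx (t / γ.toNNReal)).mono (ℱ.le _) le_rfl
  rwa [mul_div_cancel₀ _ (Real.toNNReal_pos.2 hγ).ne'] at this

lemma indep_increment {x : ℕ} (hx : x ∈ Finset.Icc 1 n) (s t : ℝ≥0) {g : Ω → ℝ}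
    (hg : Measurable[ℱ s] g) :
    IndepFun (fun ω => (N x (γ.toNNReal * (s + t)) ω : ℝ) - N x (γ.toNNReal * s) ω) g P := by
  have h1 := h.indep_past s
  refine indep_of_indep_of_le_left (indep_of_indep_of_le_right h1 hg.comap_le) ?_
  set big := fun ω =>
        ((fun (x : Finset.Icc 1 n) (t : ℝ≥0) =>
            (N x (γ.toNNReal * (s + t)) ω : ℝ) - N x (γ.toNNReal * s) ω),
          (fun t : ℝ≥0 => w (s + t) ω - w s ω))
  have hev : Measurable fun q : (Finset.Icc 1 n → ℝ≥0 → ℝ) × (ℝ≥0 → ℝ) => q.1 ⟨x, hx⟩ t := by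
    fun_prop
  have : (fun ω => (N x (γ.toNNReal * (s + t)) ω : ℝ) - N x (γ.toNNReal * s) ω) =
      (fun q : (Finset.Icc 1 n → ℝ≥0 → ℝ) × (ℝ≥0 → ℝ) => q.1 ⟨x, hx⟩ t) ∘ big := rfl
  rw [this, ← MeasurableSpace.comap_comp]
  exact MeasurableSpace.comap_mono hev.comap_le

/-- The average of a past quantity times the sign of a future Poisson increment. -/
lemma integral_sign_mul (hγ : 0 < γ) {x : ℕ} (hx : x ∈ Finset.Icc 1 n) {s t : ℝ} (hs : 0 ≤ s)
    (hst : s ≤ t) {g : Ω → ℝ} (hg : Measurable[ℱ s.toNNReal] g) :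
    ∫ ω, (-1 : ℝ) ^ N x (γ * t).toNNReal ω * ((-1 : ℝ) ^ N x (γ * s).toNNReal ω * g ω) ∂P
      = Real.exp (-2 * γ * (t - s)) * ∫ ω, g ω ∂P := by
  set a := (γ * s).toNNReal with ha
  set b := (γ * t).toNNReal with hb
  have hab : a ≤ b := Real.toNNReal_mono (by gcongr)
  have ea : γ.toNNReal * s.toNNReal = a := (Real.toNNReal_mul hγ.le).symm
  have eb : γ.toNNReal * (s.toNNReal + (t - s).toNNReal) = b := by
    rw [← Real.toNNReal_add hs (by linarith), add_sub_cancel]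
    exact (Real.toNNReal_mul hγ.le).symm
  -- Writing the sign as a cosine makes it a measurable function of the real-valued increment, the
  -- quantity whose independence of the past is known.
  have hsign : ∀ k : ℕ, Real.cos (k * Real.pi) = (-1) ^ k := Real.cos_nat_mul_pi
  have hind : IndepFun (fun ω => Real.cos (((N x b ω : ℝ) - N x a ω) * Real.pi)) g P := by
    have := h.indep_increment hx s.toNNReal (t - s).toNNReal hg
    rw [ea, eb] at this
    exact this.comp (φ := fun y => Real.cos (y * Real.pi)) (ψ := id) (by fun_prop) measurable_id
  have hcos : ∀ ω, Real.cos (((N x b ω : ℝ) - N x a ω) * Real.pi) =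
      (-1 : ℝ) ^ N x b ω * (-1 : ℝ) ^ N x a ω := fun ω => by
    rw [sub_mul, Real.cos_sub, Real.cos_nat_mul_pi, Real.cos_nat_mul_pi, Real.sin_nat_mul_pi]
    ring
  have hmeas : Measurable fun ω => Real.cos (((N x b ω : ℝ) - N x a ω) * Real.pi) := by
    have h1 : Measurable fun ω => (N x a ω : ℝ) :=
      measurable_from_nat.comp (h.measurable_poisson hγ hx a)
    have h2 : Measurable fun ω => (N x b ω : ℝ) :=
      measurable_from_nat.comp (h.measurable_poisson hγ hx b)
    fun_prop
  calc _ = ∫ ω, Real.cos (((N x b ω : ℝ) - N x a ω) * Real.pi) * g ω ∂P := by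
        simp only [hcos, mul_assoc]
    _ = (∫ ω, Real.cos (((N x b ω : ℝ) - N x a ω) * Real.pi) ∂P) * ∫ ω, g ω ∂P :=
        hind.integral_fun_mul_eq_mul_integral hmeas.aestronglyMeasurable
          (hg.mono (ℱ.le _) le_rfl).aestronglyMeasurable
    _ = _ := by
        congr 1
        -- The Poisson law is stated for the truncated difference in `ℕ`, which is the true one on
        -- monotone paths.
        have h1 : ∫ ω, Real.cos (((N x b ω : ℝ) - N x a ω) * Real.pi) ∂P =
            ∫ ω, (-1 : ℝ) ^ (N x b ω - N x a ω) ∂P := by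
          apply integral_congr_ae
          filter_upwards [(h.poisson x hx).mono] with ω hω
          rw [← hsign, Nat.cast_sub (hω hab)]
        rw [h1]
        have h2 := ((h.poisson x hx).hasLaw a b hab).integral_comp
          (f := fun k : ℕ => (-1 : ℝ) ^ k) (by measurability)
        rw [show (∫ ω, (-1 : ℝ) ^ (N x b ω - N x a ω) ∂P) =
          P[(fun k : ℕ => (-1 : ℝ) ^ k) ∘ fun ω => N x b ω - N x a ω] from rfl, h2,
          integral_neg_one_pow_poissonMeasure, NNReal.coe_sub hab]
        congr 1
        rw [ha, hb, Real.coe_toNNReal _ (mul_nonneg hγ.le hs),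
          Real.coe_toNNReal _ (mul_nonneg hγ.le (hs.trans hst))]
        ring

end IsChainNoise

namespace IsChainProcess

variable {Ω : Type*} [mΩ : MeasurableSpace Ω] {n : ℕ} {γ T : ℝ} {F : ℝ → ℝ} {P : Measure Ω}
  {ℱ : Filtration ℝ≥0 mΩ} {N : ℕ → ℝ≥0 → Ω → ℕ} {w : ℝ≥0 → Ω → ℝ} {r p : ℕ → ℝ → Ω → ℝ}
  (h : IsChainProcess n γ T F P ℱ N w r p)

include h

lemma ae_isChainPath (hγ : 0 < γ) : ∀ᵐ ω ∂P, IsChainPath n γ (√(4 * γ * T)) F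
    (fun x s => N x (γ * s).toNNReal ω) (fun s => w s.toNNReal ω)
    (fun x s => r x s ω) (fun x s => p x s ω) := by
  have h1 : ∀ᵐ ω ∂P, ∀ x ∈ Finset.Icc 1 n, IsCountingPath fun s : ℝ => N x (γ * s).toNNReal ω :=
    (Finset.eventually_all _).2 fun x hx => (h.noise.poisson x hx).ae_isCountingPath hγ
  have h2 : ∀ᵐ ω ∂P, ∀ x ∈ Finset.range (n + 1), IsCadlag (fun t => p x t ω) :=
    (Finset.eventually_all _).2 fun x hx =>
      h.cadlag_p x (Nat.lt_succ_iff.1 (Finset.mem_range.1 hx))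
  have h3 := (Finset.eventually_all _).2 h.eq_r
  have h4 := (Finset.eventually_all _).2 h.eq_p
  filter_upwards [h1, h2, h3, h4, h.eq_p_zero, h.noise.wiener.cont] with ω g1 g2 g3 g4 g5 g6
  exact ⟨g1, g6.comp continuous_real_toNNReal,
    fun x hx => g2 x (Finset.mem_range.2 (Nat.lt_succ_of_le hx)), fun t => h.r_left t ω,
    fun t => h.r_right t ω, g3, g5, g4⟩

lemma measurable_r {x : ℕ} (hx : x ≤ n + 1) {t : ℝ} (ht : 0 ≤ t) :
    Measurable[ℱ t.toNNReal] (r x t) := by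
  rcases hx.eq_or_lt with rfl | h1
  · rw [show r (n + 1) t = fun _ => 0 from funext (h.r_right t)]
    exact measurable_const
  · have := h.adapted_r x (by omega) t.toNNReal
    rwa [Real.coe_toNNReal t ht] at this

lemma measurable_p {x : ℕ} (hx : x ≤ n) {t : ℝ} (ht : 0 ≤ t) :
    Measurable[ℱ t.toNNReal] (p x t) := by
  have := h.adapted_p x hx t.toNNReal
  rwa [Real.coe_toNNReal t ht] at this

variable (hγ : 0 < γ) (hn : 1 ≤ n) (hF : Continuous F) {B : ℝ} (hB : ∀ t, |F t| ≤ B)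
  (hr : ∀ x ≤ n, Integrable (r x 0) P) (hp : ∀ x ≤ n, Integrable (p x 0) P)

include hγ hn hF hB hr hp

lemma sizeL1_majorant {t : ℝ} (ht : 0 ≤ t) : ∃ G : Ω → ℝ, Integrable G P ∧ ∃ K : ℝ,
    ∀ᵐ ω ∂P, ∀ s, 0 ≤ s → s ≤ t →
      sizeL1 n (fun x s => r x s ω) (fun x s => p x s ω) s ≤ K * |w s.toNNReal ω| + G ω := by
  have := h.prob
  have hw := IsBrownianReal.isAverageable h.noise.wiener fun t =>
    (h.noise.adapted_wiener t).mono (ℱ.le _) le_rfl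
  have hw1 : Integrable (fun ω => ∫ s in (0 : ℝ)..t, |w s.toNNReal ω|) P := by
    simp only [intervalIntegral.integral_of_le ht]
    exact (hw.integrable_prod t ht).abs.integral_prod_right
  have hZ : Integrable (fun ω => sizeL1 n (fun x s => r x s ω) (fun x s => p x s ω) 0) P :=
    integrable_finsetSum _ fun x hx =>
      (hr x (Nat.lt_succ_iff.1 (Finset.mem_range.1 hx))).abs.add
        (hp x (Nat.lt_succ_iff.1 (Finset.mem_range.1 hx))).abs
  refine ⟨_, ?_, _, (h.ae_isChainPath hγ).mono fun ω hω s hs hst =>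
    hω.sizeL1_le hγ.le (Real.sqrt_nonneg _) hn hF hB hs hst rfl rfl⟩
  have hZ' := fun c : ℝ => hZ.add (integrable_const c)
  exact (hZ' _).add ((((hZ' _).const_mul _).add (hw1.const_mul _)).const_mul _)

lemma isAverageable_r {x : ℕ} (hx : x ≤ n + 1) : IsAverageable P (r x) := by
  have := h.prob
  refine IsAverageable.of_bound (fun t ht => (h.measurable_r hx ht).mono (ℱ.le _) le_rfl) ?_
    (IsBrownianReal.isAverageable h.noise.wiener fun t =>
      (h.noise.adapted_wiener t).mono (ℱ.le _) le_rfl) fun t ht => ?_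
  · filter_upwards [h.ae_isChainPath hγ] with ω hω t ht
    exact (hω.continuousOn_r hx t ht).mono (Ici_subset_Ici.2 ht)
  · obtain ⟨G, hG, K, hK⟩ := h.sizeL1_majorant hγ hn hF hB hr hp ht
    refine ⟨G, hG, K, hK.mono fun ω hω s hs hst => ?_⟩
    exact (abs_r_le_sizeL1 (r := fun x s => r x s ω) (p := fun x s => p x s ω)
      (fun t => h.r_right t ω) hx s).trans (hω s hs hst)

lemma isAverageable_p {x : ℕ} (hx : x ≤ n) : IsAverageable P (p x) := by
  have := h.prob
  refine IsAverageable.of_bound (fun t ht => (h.measurable_p hx ht).mono (ℱ.le _) le_rfl) ?_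
    (IsBrownianReal.isAverageable h.noise.wiener fun t =>
      (h.noise.adapted_wiener t).mono (ℱ.le _) le_rfl) fun t ht => ?_
  · filter_upwards [h.cadlag_p x hx] with ω hω t ht
    exact hω.1 t ht
  · obtain ⟨G, hG, K, hK⟩ := h.sizeL1_majorant hγ hn hF hB hr hp ht
    refine ⟨G, hG, K, hK.mono fun ω hω s hs hst => ?_⟩
    exact (abs_p_le_sizeL1 (r := fun x s => r x s ω) (p := fun x s => p x s ω) hx s).trans
      (hω s hs hst)

lemma mean_r {x : ℕ} (hx : x < n) {t : ℝ} (ht : 0 ≤ t) :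
    ∫ ω, r (x + 1) t ω ∂P = ∫ ω, r (x + 1) 0 ω ∂P +
      ∫ s in (0 : ℝ)..t, ((∫ ω, p (x + 1) s ω ∂P) - ∫ ω, p x s ω ∂P) := by
  have := h.prob
  have hp1 := h.isAverageable_p hγ hn hF hB hr hp (x := x + 1) (by omega)
  have hp0 := h.isAverageable_p hγ hn hF hB hr hp (x := x) (by omega)
  have hd := hp1.sub hp0
  have e : ∫ ω, r (x + 1) t ω ∂P = ∫ ω, (r (x + 1) 0 ω +
      ∫ s in (0 : ℝ)..t, (p (x + 1) s ω - p x s ω)) ∂P := by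
    apply integral_congr_ae
    filter_upwards [h.eq_r (x + 1) (Finset.mem_Icc.2 ⟨by omega, by omega⟩)] with ω hω
    exact hω t ht
  rw [e, integral_add (hr _ (by omega)) (hd.integrable_integral ht), hd.mean_integral ht]
  congr 1
  apply intervalIntegral.integral_congr
  intro s hs
  rw [uIcc_of_le ht] at hs
  exact integral_sub (hp1.integrable s hs.1) (hp0.integrable s hs.1)

lemma mean_p_zero {t : ℝ} (ht : 0 ≤ t) :
    ∫ ω, p 0 t ω ∂P = ∫ ω, p 0 0 ω ∂P +
      ∫ s in (0 : ℝ)..t, ((∫ ω, r 1 s ω ∂P) - 2 * γ * ∫ ω, p 0 s ω ∂P) := by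
  have := h.prob
  have hr1 := h.isAverageable_r hγ hn hF hB hr hp (x := 1) (by omega)
  have hp0 := (h.isAverageable_p hγ hn hF hB hr hp (x := 0) (by omega)).const_mul (2 * γ)
  have hd := hr1.sub hp0
  have e : ∫ ω, p 0 t ω ∂P = ∫ ω, (p 0 0 ω + (∫ s in (0 : ℝ)..t, (r 1 s ω - 2 * γ * p 0 s ω))
      + √(4 * γ * T) * w t.toNNReal ω) ∂P := by
    apply integral_congr_ae
    filter_upwards [h.eq_p_zero] with ω hω
    exact hω t ht
  have hw := h.noise.wiener
  have hI : Integrable (fun ω => p 0 0 ω + ∫ s in (0 : ℝ)..t, (r 1 s ω - 2 * γ * p 0 s ω)) P :=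
    (hp _ (by omega)).add (hd.integrable_integral ht)
  rw [e, integral_add hI ((hw.integrable_eval _).const_mul _), integral_const_mul, hw.integral_eval, mul_zero,
    add_zero, integral_add (hp _ (by omega)) (hd.integrable_integral ht), hd.mean_integral ht]
  congr 1
  apply intervalIntegral.integral_congr
  intro s hs
  rw [uIcc_of_le ht] at hs
  simp only
  rw [integral_sub (hr1.integrable s hs.1) (hp0.integrable s hs.1), integral_const_mul]

/-- The drift at time `s` is known at time `s`, so the product of the signs at `t` and `s` averages
out to the factor `exp (-2γ(t - s))`. Fubini exchanges the mean and the time integral. -/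
lemma mean_p {x : ℕ} (hx : x ∈ Finset.Icc 1 n) {t : ℝ} (ht : 0 ≤ t) :
    ∫ ω, p x t ω ∂P = Real.exp (-2 * γ * t) * (∫ ω, p x 0 ω ∂P +
      ∫ s in (0 : ℝ)..t, Real.exp (2 * γ * s) *
        ((∫ ω, r (x + 1) s ω ∂P) - (∫ ω, r x s ω ∂P) + if x = n then F s else 0)) := by
  have := h.prob
  have hxn := (Finset.mem_Icc.1 hx).2
  set g : ℝ → Ω → ℝ := fun s ω => r (x + 1) s ω - r x s ω + if x = n then F s else 0 with hg
  have hgm : ∀ s, 0 ≤ s → Measurable[ℱ s.toNNReal] (g s) := fun s hs =>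
    ((h.measurable_r (by omega) hs).sub (h.measurable_r (by omega) hs)).add measurable_const
  have hFx : Continuous fun s => if x = n then F s else 0 := by
    split_ifs <;> fun_prop
  have hr1 := h.isAverageable_r hγ hn hF hB hr hp (x := x + 1) (by omega)
  have hr0 := h.isAverageable_r hγ hn hF hB hr hp (x := x) (by omega)
  have hga : IsAverageable P g := (hr1.sub hr0).add (IsAverageable.of_continuous hFx)
  have hNm : ∀ s : ℝ, Measurable fun ω => (-1 : ℝ) ^ N x (γ * s).toNNReal ω := fun s =>
    (measurable_from_nat (f := fun k : ℕ => (-1 : ℝ) ^ k)).comp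
      (h.noise.measurable_poisson hγ hx _)
  have hεc : ∀ᵐ ω ∂P, ∀ s, 0 ≤ s →
      ContinuousWithinAt (fun s : ℝ => (-1 : ℝ) ^ N x (γ * s).toNNReal ω) (Ici s) s := by
    filter_upwards [h.ae_isChainPath hγ] with ω hω s _
    exact (continuous_of_discreteTopology (f := fun k : ℕ => (-1 : ℝ) ^ k)).continuousAt
      |>.comp_continuousWithinAt ((hω.count x hx).rightCont s)
  have hεj : AEStronglyMeasurable
      (fun q : ℝ × Ω => (-1 : ℝ) ^ N x (γ * q.1).toNNReal q.2)
      ((volume.restrict (Ici 0)).prod P) :=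
    aestronglyMeasurable_of_rightCont (X := fun s ω => (-1 : ℝ) ^ N x (γ * s).toNNReal ω)
      (fun s _ => hNm s) hεc
  have hεb : ∀ k : ℕ, ‖(-1 : ℝ) ^ k‖ ≤ 1 := fun k => by simp
  -- The sign at the final time `t` is moved under the time integral with `t` fixed, so that at each
  -- `s` both signs appear together.
  set G : ℝ → Ω → ℝ := fun s ω => (-1 : ℝ) ^ N x (γ * t).toNNReal ω *
    ((-1 : ℝ) ^ N x (γ * s).toNNReal ω * g s ω) with hG
  have hGa : IsAverageable P G := by
    refine ⟨fun s hs => ?_, fun s hs => ?_⟩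
    · exact ((hga.integrable s hs).bdd_mul (hNm s).aestronglyMeasurable
        (Eventually.of_forall fun _ => hεb _)).bdd_mul (hNm t).aestronglyMeasurable
        (Eventually.of_forall fun _ => hεb _)
    · refine ((hga.integrable_prod s hs).bdd_mul (hεj.mono_measure
        (Measure.prod_mono (Measure.restrict_mono (fun x hx => hx.1.le) le_rfl) le_rfl))
        (Eventually.of_forall fun _ => hεb _)).bdd_mul (c := 1)
        (f := fun q : ℝ × Ω => (-1 : ℝ) ^ N x (γ * t).toNNReal q.2)
        ((hNm t).comp measurable_snd).aestronglyMeasurable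
        (Eventually.of_forall fun _ => hεb _)
  have e : ∫ ω, p x t ω ∂P = ∫ ω, ((-1 : ℝ) ^ N x (γ * t).toNNReal ω *
      ((-1 : ℝ) ^ N x (γ * 0).toNNReal ω * p x 0 ω) + ∫ s in (0 : ℝ)..t, G s ω) ∂P := by
    apply integral_congr_ae
    filter_upwards [h.ae_isChainPath hγ] with ω hω
    have hz : N x (γ * 0).toNNReal ω = 0 := (hω.count x hx).zero
    rw [hω.p_eq_sign_mul hF hx ht, hz, pow_zero, one_mul]
    simp only [hG, hg]
    rw [intervalIntegral.integral_const_mul, mul_add]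
  have hp0 : Integrable (fun ω => (-1 : ℝ) ^ N x (γ * t).toNNReal ω *
      ((-1 : ℝ) ^ N x (γ * 0).toNNReal ω * p x 0 ω)) P :=
    ((hp x hxn).bdd_mul (hNm 0).aestronglyMeasurable
        (Eventually.of_forall fun _ => hεb _)).bdd_mul (hNm t).aestronglyMeasurable
        (Eventually.of_forall fun _ => hεb _)
  rw [e, integral_add hp0 (hGa.integrable_integral ht), hGa.mean_integral ht,
    h.noise.integral_sign_mul hγ hx le_rfl ht (h.measurable_p hxn le_rfl), sub_zero, mul_add,
    ← intervalIntegral.integral_const_mul]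
  congr 1
  apply intervalIntegral.integral_congr
  intro s hs
  rw [uIcc_of_le ht] at hs
  simp only
  rw [h.noise.integral_sign_mul hγ hx hs.1 hs.2 (hgm s hs.1), ← mul_assoc, ← Real.exp_add]
  congr 1
  · congr 1; ring
  · simp only [hg]
    rw [integral_add ((hr1.sub hr0).integrable s hs.1) (integrable_const _),
      integral_sub (hr1.integrable s hs.1) (hr0.integrable s hs.1)]
    simp

/-- The averages of the chain solve the mean dynamics. -/
theorem isMeanChain : IsMeanChain n γ F
    (fun x t => if x = n + 1 then F t else ∫ ω, r x t ω ∂P) (fun x t => ∫ ω, p x t ω ∂P) := by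
  have := h.prob
  have hpa : ∀ x ≤ n, IsAverageable P (p x) := fun x hx => h.isAverageable_p hγ hn hF hB hr hp hx
  have hra : ∀ x ≤ n + 1, IsAverageable P (r x) := fun x hx =>
    h.isAverageable_r hγ hn hF hB hr hp hx
  have hcr' : ∀ x ≤ n + 1, ContinuousOn (fun t => ∫ ω, r x t ω ∂P) (Ici 0) := by
    intro x hx
    rcases Nat.eq_zero_or_pos x with rfl | h0
    · simp only [h.r_left, integral_zero]; exact continuousOn_const
    rcases hx.eq_or_lt with rfl | h1
    · simp only [h.r_right, integral_zero]; exact continuousOn_const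
    obtain ⟨y, rfl⟩ : ∃ y, x = y + 1 := ⟨x - 1, by omega⟩
    refine ContinuousOn.congr (continuousOn_const.add (continuousOn_primitive_Ici fun t ht =>
      ((hpa (y + 1) (by omega)).intervalIntegrable_mean ht).sub
        ((hpa y (by omega)).intervalIntegrable_mean ht)))
      fun t ht => h.mean_r hγ hn hF hB hr hp (by omega) ht
  have hcr : ∀ x ≤ n + 1, ContinuousOn (fun t => if x = n + 1 then F t else ∫ ω, r x t ω ∂P)
      (Ici 0) := by
    intro x hx
    split_ifs
    · exact hF.continuousOn
    · exact hcr' x hx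
  have hdrift : ∀ x ∈ Finset.Icc 1 n, ContinuousOn (fun s => Real.exp (2 * γ * s) *
      ((∫ ω, r (x + 1) s ω ∂P) - (∫ ω, r x s ω ∂P) + if x = n then F s else 0)) (Ici 0) := by
    intro x hx
    have hxn := (Finset.mem_Icc.1 hx).2
    have h1 := hcr' (x + 1) (by omega)
    have h2 := hcr' x (by omega)
    have hFx : Continuous fun s => if x = n then F s else 0 := by
      split_ifs <;> fun_prop
    exact (by fun_prop : Continuous fun s : ℝ => Real.exp (2 * γ * s)).continuousOn.mul
      ((h1.sub h2).add hFx.continuousOn)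
  have hcp : ∀ x ≤ n, ContinuousOn (fun t => ∫ ω, p x t ω ∂P) (Ici 0) := by
    intro x hx
    rcases Nat.eq_zero_or_pos x with rfl | h0
    · refine ContinuousOn.congr (continuousOn_const.add (continuousOn_primitive_Ici fun t ht =>
        ((hra 1 (by omega)).intervalIntegrable_mean ht).sub
          (((hpa 0 (by omega)).intervalIntegrable_mean ht).const_mul (2 * γ))))
        fun t ht => h.mean_p_zero hγ hn hF hB hr hp ht
    · have hx' := Finset.mem_Icc.2 ⟨h0, hx⟩
      refine ContinuousOn.congr ((by fun_prop : Continuous fun s : ℝ =>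
        Real.exp (-2 * γ * s)).continuousOn.mul (continuousOn_const.add
        (continuousOn_primitive_Ici fun t ht =>
          intervalIntegrable_of_continuousOn_Ici (hdrift x hx') le_rfl ht)))
        fun t ht => h.mean_p hγ hn hF hB hr hp hx' ht
  refine ⟨hcr, hcp, fun t => by simp [h.r_left], fun t => by simp, fun x hx t ht => ?_,
    fun x hx t ht => ?_⟩
  · have hd := (hasDerivAt_primitive_Ici ((hcp (x + 1) (by omega)).sub (hcp x (by omega)))
      ht).const_add (∫ ω, r (x + 1) 0 ω ∂P)
    refine hd.congr_of_eventuallyEq ?_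
    filter_upwards [Ioi_mem_nhds ht] with s hs
    simp only [show x + 1 ≠ n + 1 by omega, if_false]
    exact h.mean_r hγ hn hF hB hr hp hx hs.le
  · rcases Nat.eq_zero_or_pos x with rfl | h0
    · have hd := (hasDerivAt_primitive_Ici ((hcr' 1 (by omega)).sub
        ((hcp 0 (by omega)).const_mul (2 * γ))) ht).const_add (∫ ω, p 0 0 ω ∂P)
      have e := hd.congr_of_eventuallyEq (f₁ := fun t => ∫ ω, p 0 t ω ∂P) (by
        filter_upwards [Ioi_mem_nhds ht] with s hs
        exact h.mean_p_zero hγ hn hF hB hr hp hs.le)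
      convert! e using 1
      simp [h.r_left, show n ≠ 0 by omega]
    · have hx' := Finset.mem_Icc.2 ⟨h0, hx⟩
      have he : HasDerivAt (fun s : ℝ => Real.exp (-2 * γ * s))
          (Real.exp (-2 * γ * t) * (-2 * γ)) t := by
        simpa using ((hasDerivAt_id t).const_mul (-2 * γ)).exp
      have hd := he.mul ((hasDerivAt_primitive_Ici (hdrift x hx') ht).const_add
        (∫ ω, p x 0 ω ∂P))
      have e := hd.congr_of_eventuallyEq (f₁ := fun t => ∫ ω, p x t ω ∂P) (by
        filter_upwards [Ioi_mem_nhds ht] with s hs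
        exact h.mean_p hγ hn hF hB hr hp hx' hs.le)
      convert! e using 1
      have hee : Real.exp (-2 * γ * t) * Real.exp (2 * γ * t) = 1 := by
        rw [← Real.exp_add]; simp
      simp only [h.mean_p hγ hn hF hB hr hp hx' ht.le]
      -- At the last atom the convention changes from `r (n + 1) = 0` with a force term to `R (n +
      -- 1) = F` without one.
      by_cases hxn : x = n
      · subst hxn
        simp only [if_true, h.r_right, integral_zero, show x ≠ x + 1 by omega, if_false]
        linear_combination (-(F t - ∫ ω, r x t ω ∂P)) * hee
      · simp only [hxn, if_false, show x + 1 ≠ n + 1 by omega, show x ≠ n + 1 by omega]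
        linear_combination (-((∫ ω, r (x + 1) t ω ∂P) - ∫ ω, r x t ω ∂P)) * hee

end IsChainProcess

end HarmonicChain

/-! ### Conservation laws and energy bounds for the averaged chain. -/

namespace HarmonicChain

/-! ### Identities and bounds for the averaged chain -/

lemma integral_eq_sub_of_hasDerivAt_Ici {E : Type*} [NormedAddCommGroup E] [NormedSpace ℝ E]
    [CompleteSpace E] {f f' : ℝ → E} (hf : ContinuousOn f (Ici 0))
    (hf' : ContinuousOn f' (Ici 0)) (hd : ∀ t, 0 < t → HasDerivAt f (f' t) t) {t : ℝ}
    (ht : 0 ≤ t) : ∫ s in (0 : ℝ)..t, f' s = f t - f 0 :=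
  intervalIntegral.integral_eq_sub_of_hasDerivAt_of_le ht (hf.mono Icc_subset_Ici_self)
    (fun s hs => hd s hs.1) (intervalIntegrable_of_continuousOn_Ici hf' le_rfl ht)

/-- Twice the energy of a configuration. -/
def energy (n : ℕ) (R Q : ℕ → ℝ → ℝ) (t : ℝ) : ℝ :=
  ∑ x ∈ Finset.range (n + 1), ((R x t) ^ 2 + (Q x t) ^ 2)

namespace IsMeanChain

variable {n : ℕ} {γ : ℝ} {F : ℝ → ℝ} {R Q : ℕ → ℝ → ℝ} (h : IsMeanChain n γ F R Q)

include h

lemma continuousOn_force : ContinuousOn F (Ici 0) := by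
  rw [show F = R (n + 1) from (funext h.r_right).symm]
  exact h.cont_r _ le_rfl

lemma integrable_p {x : ℕ} (hx : x ≤ n) {a b : ℝ} (ha : 0 ≤ a) (hb : 0 ≤ b) :
    IntervalIntegrable (Q x) volume a b :=
  intervalIntegrable_of_continuousOn_Ici (h.cont_p x hx) ha hb

lemma integrable_force {a b : ℝ} (ha : 0 ≤ a) (hb : 0 ≤ b) :
    IntervalIntegrable F volume a b :=
  intervalIntegrable_of_continuousOn_Ici h.continuousOn_force ha hb

/-- The current through the right end, in terms of the first moment of the stretches. -/
lemma integral_p_last (hγ : 0 < γ) {t : ℝ} (ht : 0 ≤ t) :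
    ((n : ℝ) + 1) * ∫ s in (0 : ℝ)..t, Q n s =
      (∑ x ∈ Finset.range (n + 1), (x : ℝ) * (R x t - R x 0)) +
      1 / (2 * γ) * ((∫ s in (0 : ℝ)..t, F s)
        - ∑ x ∈ Finset.range (n + 1), (Q x t - Q x 0)) := by
  have key := integral_eq_sub_of_hasDerivAt_Ici
    -- Summation by parts turns the derivative of the first moment into `(n + 1) Q_n - ∑ Q_x`. The
    -- total momentum has derivative `F - 2γ ∑ Q_x`; subtracting `1 / (2γ)` of it removes `∑ Q_x`.
    (f := fun t => (∑ x ∈ Finset.range n, ((x : ℝ) + 1) * R (x + 1) t)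
      - 1 / (2 * γ) * ∑ x ∈ Finset.range (n + 1), Q x t)
    (f' := fun t => ((n : ℝ) + 1) * Q n t - 1 / (2 * γ) * F t) ?_ ?_ ?_ ht
  · rw [intervalIntegral.integral_sub ((h.integrable_p le_rfl le_rfl ht).const_mul _)
      ((h.integrable_force le_rfl ht).const_mul _), intervalIntegral.integral_const_mul,
      intervalIntegral.integral_const_mul] at key
    rw [Finset.sum_range_succ' (fun x => (x : ℝ) * (R x t - R x 0))]
    simp only [mul_sub, Finset.sum_sub_distrib]
    push_cast
    linear_combination key
  · refine ContinuousOn.sub (continuousOn_finsetSum _ fun x hx => ?_)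
      (ContinuousOn.const_mul (continuousOn_finsetSum _ fun x hx => ?_) _)
    · exact (h.cont_r _ (by have := Finset.mem_range.1 hx; omega)).const_mul _
    · exact h.cont_p _ (by have := Finset.mem_range.1 hx; omega)
  · exact ((h.cont_p n le_rfl).const_mul _).sub (h.continuousOn_force.const_mul _)
  · intro t ht
    have h1 : HasDerivAt (fun t => ∑ x ∈ Finset.range n, ((x : ℝ) + 1) * R (x + 1) t)
        (∑ x ∈ Finset.range n, ((x : ℝ) + 1) * (Q (x + 1) t - Q x t)) t :=
      HasDerivAt.fun_sum fun x hx => (h.deriv_r x (Finset.mem_range.1 hx) t ht).const_mul _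
    have h2 : HasDerivAt (fun t => ∑ x ∈ Finset.range (n + 1), Q x t)
        (∑ x ∈ Finset.range (n + 1), (R (x + 1) t - R x t - 2 * γ * Q x t)) t :=
      HasDerivAt.fun_sum fun x hx => h.deriv_p x (by have := Finset.mem_range.1 hx; omega) t ht
    refine (h1.sub (h2.const_mul (1 / (2 * γ)))).congr_deriv ?_
    have e1 : ∀ m : ℕ, ∑ x ∈ Finset.range m, ((x : ℝ) + 1) * (Q (x + 1) t - Q x t) =
        ((m : ℝ) + 1) * Q m t - ∑ x ∈ Finset.range (m + 1), Q x t := by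
      intro m
      induction m with
      | zero => simp
      | succ m ih =>
        rw [Finset.sum_range_succ, ih, Finset.sum_range_succ (fun x => Q x t) (m + 1)]
        push_cast; ring
    rw [e1, Finset.sum_sub_distrib, Finset.sum_range_sub (fun x => R x t), h.r_left, h.r_right,
      ← Finset.mul_sum]
    field_simp
    ring

/-- The exchange between neighbours telescopes; what survives is the friction and the boundary term
`R (n + 1) Q_n = F Q_n`. -/
lemma energy_identity {t : ℝ} (ht : 0 ≤ t) :
    energy n R Q t + 4 * γ * (∫ s in (0 : ℝ)..t, ∑ x ∈ Finset.range (n + 1), (Q x s) ^ 2) =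
      energy n R Q 0 + 2 * ∫ s in (0 : ℝ)..t, F s * Q n s := by
  have hQ2 : ContinuousOn (fun s => ∑ x ∈ Finset.range (n + 1), (Q x s) ^ 2) (Ici 0) :=
    continuousOn_finsetSum _ fun x hx =>
      (h.cont_p _ (by have := Finset.mem_range.1 hx; omega)).pow 2
  have hFQ : ContinuousOn (fun s => F s * Q n s) (Ici 0) :=
    h.continuousOn_force.mul (h.cont_p n le_rfl)
  have key := integral_eq_sub_of_hasDerivAt_Ici
    (f := fun t => (∑ x ∈ Finset.range n, (R (x + 1) t) ^ 2)
      + ∑ x ∈ Finset.range (n + 1), (Q x t) ^ 2)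
    (f' := fun t => 2 * (F t * Q n t) - 4 * γ * ∑ x ∈ Finset.range (n + 1), (Q x t) ^ 2)
    ?_ ?_ ?_ ht
  · rw [intervalIntegral.integral_sub
      ((intervalIntegrable_of_continuousOn_Ici hFQ le_rfl ht).const_mul _)
      ((intervalIntegrable_of_continuousOn_Ici hQ2 le_rfl ht).const_mul _),
      intervalIntegral.integral_const_mul, intervalIntegral.integral_const_mul] at key
    have e : ∀ t, energy n R Q t = (∑ x ∈ Finset.range n, (R (x + 1) t) ^ 2)
      + ∑ x ∈ Finset.range (n + 1), (Q x t) ^ 2 := fun t => by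
        rw [energy, Finset.sum_add_distrib, Finset.sum_range_succ' (fun x => (R x t) ^ 2),
          h.r_left]
        ring
    rw [e, e]
    linear_combination -key
  · refine ContinuousOn.add (continuousOn_finsetSum _ fun x hx => ?_) hQ2
    exact (h.cont_r _ (by have := Finset.mem_range.1 hx; omega)).pow 2
  · exact (hFQ.const_mul _).sub (hQ2.const_mul _)
  · intro t ht
    have h1 : HasDerivAt (fun t => ∑ x ∈ Finset.range n, (R (x + 1) t) ^ 2)
        (∑ x ∈ Finset.range n, 2 * (R (x + 1) t * (Q (x + 1) t - Q x t))) t :=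
      HasDerivAt.fun_sum fun x hx => by
        convert! (h.deriv_r x (Finset.mem_range.1 hx) t ht).pow 2 using 1
        push_cast; ring
    have h2 : HasDerivAt (fun t => ∑ x ∈ Finset.range (n + 1), (Q x t) ^ 2)
        (∑ x ∈ Finset.range (n + 1), 2 * (Q x t * (R (x + 1) t - R x t - 2 * γ * Q x t))) t :=
      HasDerivAt.fun_sum fun x hx => by
        convert! (h.deriv_p x (by have := Finset.mem_range.1 hx; omega) t ht).pow 2 using 1
        push_cast; ring
    refine (h1.add h2).congr_deriv ?_
    have e1 : ∀ m : ℕ, (∑ x ∈ Finset.range m, 2 * (R (x + 1) t * (Q (x + 1) t - Q x t))) +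
        ∑ x ∈ Finset.range (m + 1), 2 * (Q x t * (R (x + 1) t - R x t - 2 * γ * Q x t)) =
        2 * (R (m + 1) t * Q m t) - 4 * γ * ∑ x ∈ Finset.range (m + 1), (Q x t) ^ 2 := by
      intro m
      induction m with
      | zero => simp [h.r_left]; ring
      | succ m ih =>
        rw [Finset.sum_range_succ, Finset.sum_range_succ _ (m + 1),
          Finset.sum_range_succ (fun x => (Q x t) ^ 2) (m + 1)]
        linear_combination ih
    rw [e1, h.r_right]

/-- The energy of the averaged chain stays of order `n` on the diffusive time scale. -/
lemma energy_le (hγ : 0 < γ) (hn : 1 ≤ n) {Fbar A H c τ : ℝ} {f : ℝ → ℝ}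
    (hF : ∀ t, F t = Fbar + c * f t) (hc : c ^ 2 * n = 1) (hf : ∀ t, |f t| ≤ A)
    (hH : energy n R Q 0 ≤ H * n) {t : ℝ} (ht : 0 ≤ t) (htτ : t ≤ n ^ 2 * τ) :
    energy n R Q t / 2 + 2 * γ * (∫ s in (0 : ℝ)..t, (Q n s) ^ 2) ≤
      (3 / 2 * H + 4 * (2 * Fbar ^ 2 + Fbar ^ 2 / (2 * γ ^ 2)) +
        |Fbar| * (|Fbar| + A) * τ / γ + A ^ 2 * τ / (2 * γ)) * n := by
  have hn' : (1 : ℝ) ≤ n := by exact_mod_cast hn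
  have hn0 : (0 : ℝ) < n := by linarith
  have hA0 : 0 ≤ A := (abs_nonneg _).trans (hf 0)
  have hτ0 : 0 ≤ τ := by
    by_contra hneg
    push Not at hneg
    have : (n : ℝ) ^ 2 * τ < 0 := mul_neg_of_pos_of_neg (by positivity) hneg
    linarith
  have hc1 : |c| ≤ 1 := by
    have : c ^ 2 ≤ 1 := by nlinarith [sq_nonneg c]
    exact abs_le_one_iff_mul_self_le_one.2 (by nlinarith)
  have hFb : ∀ s, |F s| ≤ |Fbar| + A := fun s => by
    rw [hF]
    refine (abs_add_le _ _).trans ?_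
    rw [abs_mul]
    have := mul_le_mul hc1 (hf s) (abs_nonneg _) zero_le_one
    linarith
  have hen := h.energy_identity ht
  have hcur := h.integral_p_last hγ ht
  have hint := h.integrable_p le_rfl le_rfl ht
  have hint2 : IntervalIntegrable (fun s => (Q n s) ^ 2) volume 0 t :=
    intervalIntegrable_of_continuousOn_Ici ((h.cont_p n le_rfl).pow 2) le_rfl ht
  have hFQ : IntervalIntegrable (fun s => F s * Q n s) volume 0 t :=
    intervalIntegrable_of_continuousOn_Ici (h.continuousOn_force.mul (h.cont_p n le_rfl)) le_rfl ht
  -- dissipation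
  have hdis : ∫ s in (0 : ℝ)..t, (Q n s) ^ 2 ≤
      ∫ s in (0 : ℝ)..t, ∑ x ∈ Finset.range (n + 1), (Q x s) ^ 2 := by
    refine intervalIntegral.integral_mono_on ht hint2 ?_ fun s _ =>
      Finset.single_le_sum (f := fun x => (Q x s) ^ 2) (fun x _ => sq_nonneg _)
        (Finset.self_mem_range_succ n)
    exact intervalIntegrable_of_continuousOn_Ici (continuousOn_finsetSum _ fun x hx =>
      (h.cont_p _ (by have := Finset.mem_range.1 hx; omega)).pow 2) le_rfl ht
  -- work of the force
  have hwork : 2 * ∫ s in (0 : ℝ)..t, F s * Q n s ≤ 2 * Fbar * (∫ s in (0 : ℝ)..t, Q n s) +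
      2 * γ * (∫ s in (0 : ℝ)..t, (Q n s) ^ 2) + A ^ 2 * τ / (2 * γ) * n := by
    have hm : ∫ s in (0 : ℝ)..t, 2 * (F s * Q n s) ≤ ∫ s in (0 : ℝ)..t,
        ((2 * Fbar * Q n s + 2 * γ * (Q n s) ^ 2) + A ^ 2 * c ^ 2 / (2 * γ)) := by
      refine intervalIntegral.integral_mono_on ht (hFQ.const_mul _)
        (((hint.const_mul _).add (hint2.const_mul _)).add intervalIntegrable_const) fun s _ => ?_
      rw [hF]
      have h1 : (f s) ^ 2 ≤ A ^ 2 := sq_le_sq' (by linarith [abs_le.1 (hf s)]) (abs_le.1 (hf s)).2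
      have h2 : (f s) ^ 2 * c ^ 2 / (2 * γ) ≤ A ^ 2 * c ^ 2 / (2 * γ) := by gcongr
      have h3 : 2 * (c * f s * Q n s) ≤ 2 * γ * (Q n s) ^ 2 + (f s) ^ 2 * c ^ 2 / (2 * γ) := by
        have e : 2 * γ * (Q n s) ^ 2 + (f s) ^ 2 * c ^ 2 / (2 * γ) - 2 * (c * f s * Q n s) =
            1 / (2 * γ) * (2 * γ * Q n s - c * f s) ^ 2 := by field_simp; ring
        have : 0 ≤ 1 / (2 * γ) * (2 * γ * Q n s - c * f s) ^ 2 := by positivity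
        linarith
      linarith
    rw [intervalIntegral.integral_const_mul, intervalIntegral.integral_add
      ((hint.const_mul _).add (hint2.const_mul _)) intervalIntegrable_const,
      intervalIntegral.integral_add (hint.const_mul _) (hint2.const_mul _),
      intervalIntegral.integral_const_mul, intervalIntegral.integral_const_mul,
      intervalIntegral.integral_const, smul_eq_mul, sub_zero] at hm
    have h4 : t * (A ^ 2 * c ^ 2 / (2 * γ)) ≤ A ^ 2 * τ / (2 * γ) * n := by
      calc t * (A ^ 2 * c ^ 2 / (2 * γ)) ≤ (n ^ 2 * τ) * (A ^ 2 * c ^ 2 / (2 * γ)) := by gcongr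
        _ = A ^ 2 * τ / (2 * γ) * n * (c ^ 2 * n) := by ring
        _ = _ := by rw [hc, mul_one]
    linarith
  -- the mean current
  have hsite : ∀ s (x : ℕ), x ≤ n → ∀ e : ℝ, |e| = 1 →
      2 * Fbar * (e * ((x : ℝ) * R x s - 1 / (2 * γ) * Q x s)) ≤
        (n + 1) * (((R x s) ^ 2 + (Q x s) ^ 2) / 2 + (2 * Fbar ^ 2 + Fbar ^ 2 / (2 * γ ^ 2))) := by
    intro s x hx e he
    have he2 : e ^ 2 = 1 := by rw [← sq_abs, he, one_pow]
    have hx' : (x : ℝ) ≤ n := by exact_mod_cast hx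
    have hx0 : (0 : ℝ) ≤ x := by positivity
    have h1 : 2 * Fbar * (e * ((x : ℝ) * R x s)) ≤
        (n + 1) * ((R x s) ^ 2 / 2 + 2 * Fbar ^ 2) := by
      have : 2 * Fbar * (e * ((x : ℝ) * R x s)) ≤ x * ((R x s) ^ 2 / 2 + 2 * Fbar ^ 2) := by
        have e1 : (R x s - 2 * e * Fbar) ^ 2 = R x s ^ 2 - 4 * e * Fbar * R x s + 4 * Fbar ^ 2 := by
          linear_combination 4 * Fbar ^ 2 * he2
        have e2 := mul_nonneg hx0 (sq_nonneg (R x s - 2 * e * Fbar))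
        rw [e1] at e2
        linarith
      refine this.trans ?_
      gcongr
      linarith
    have h2 : 2 * Fbar * (e * (- (1 / (2 * γ) * Q x s))) ≤
        (n + 1) * ((Q x s) ^ 2 / 2 + Fbar ^ 2 / (2 * γ ^ 2)) := by
      have e1 : (Q x s) ^ 2 / 2 + Fbar ^ 2 / (2 * γ ^ 2) -
          2 * Fbar * (e * (- (1 / (2 * γ) * Q x s))) = (Q x s + e * Fbar / γ) ^ 2 / 2 := by
        field_simp
        linear_combination (-Fbar ^ 2) * he2
      have e2 : 0 ≤ (Q x s + e * Fbar / γ) ^ 2 / 2 := by positivity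
      have e3 : (0 : ℝ) ≤ (Q x s) ^ 2 / 2 + Fbar ^ 2 / (2 * γ ^ 2) := by positivity
      nlinarith
    linarith
  have hsum : ∀ s, ∀ e : ℝ, |e| = 1 → 2 * Fbar * (e * ∑ x ∈ Finset.range (n + 1),
      ((x : ℝ) * R x s - 1 / (2 * γ) * Q x s)) ≤
        (n + 1) * (energy n R Q s / 2 + (n + 1) * (2 * Fbar ^ 2 + Fbar ^ 2 / (2 * γ ^ 2))) := by
    intro s e he
    rw [Finset.mul_sum, Finset.mul_sum]
    refine (Finset.sum_le_sum fun x hx =>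
      hsite s x (Nat.lt_succ_iff.1 (Finset.mem_range.1 hx)) e he).trans (le_of_eq ?_)
    rw [← Finset.mul_sum, Finset.sum_add_distrib, Finset.sum_const, Finset.card_range,
      nsmul_eq_mul, energy, Finset.sum_div]
    push_cast; ring
  have hFint : 2 * Fbar * (1 / (2 * γ) * ∫ s in (0 : ℝ)..t, F s) ≤
      (n + 1) * (|Fbar| * (|Fbar| + A) * τ / γ * n) := by
    have h1 : |∫ s in (0 : ℝ)..t, F s| ≤ (|Fbar| + A) * (n ^ 2 * τ) := by
      have := intervalIntegral.norm_integral_le_of_norm_le_const (a := 0) (b := t) (f := F)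
        (C := |Fbar| + A) fun s _ => hFb s
      rw [sub_zero, abs_of_nonneg ht, Real.norm_eq_abs] at this
      exact this.trans (by gcongr)
    calc 2 * Fbar * (1 / (2 * γ) * ∫ s in (0 : ℝ)..t, F s)
        = 1 / γ * (Fbar * ∫ s in (0 : ℝ)..t, F s) := by field_simp
      _ ≤ 1 / γ * (|Fbar| * ((|Fbar| + A) * (n ^ 2 * τ))) := by
          refine mul_le_mul_of_nonneg_left ((le_abs_self _).trans ?_) (by positivity)
          rw [abs_mul]
          gcongr
      _ = n * (|Fbar| * (|Fbar| + A) * τ / γ * n) := by ring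
      _ ≤ _ := by gcongr; linarith
  -- The moment identity carries a factor `n + 1` in front of the current, which cancels the weights
  -- `x ≤ n` of the moment.
  have hcur2 : 2 * Fbar * ∫ s in (0 : ℝ)..t, Q n s ≤ energy n R Q t / 2 + energy n R Q 0 / 2 +
      2 * (n + 1) * (2 * Fbar ^ 2 + Fbar ^ 2 / (2 * γ ^ 2)) +
      |Fbar| * (|Fbar| + A) * τ / γ * n := by
    have hpos : (0 : ℝ) < n + 1 := by linarith
    refine le_of_mul_le_mul_left ?_ hpos
    have s1 := hsum t 1 (by simp)
    have s2 := hsum 0 (-1) (by simp)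
    have e1 : ((n : ℝ) + 1) * (2 * Fbar * ∫ s in (0 : ℝ)..t, Q n s) =
        2 * Fbar * (1 * ∑ x ∈ Finset.range (n + 1), ((x : ℝ) * R x t - 1 / (2 * γ) * Q x t)) +
        2 * Fbar * (-1 * ∑ x ∈ Finset.range (n + 1), ((x : ℝ) * R x 0 - 1 / (2 * γ) * Q x 0)) +
        2 * Fbar * (1 / (2 * γ) * ∫ s in (0 : ℝ)..t, F s) := by
      rw [show ((n : ℝ) + 1) * (2 * Fbar * ∫ s in (0 : ℝ)..t, Q n s) =
        2 * Fbar * (((n : ℝ) + 1) * ∫ s in (0 : ℝ)..t, Q n s) by ring, hcur]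
      simp only [mul_sub, Finset.sum_sub_distrib, ← Finset.mul_sum]
      ring
    rw [e1]
    linarith
  have hB : 2 * ((n : ℝ) + 1) * (2 * Fbar ^ 2 + Fbar ^ 2 / (2 * γ ^ 2)) ≤
      4 * n * (2 * Fbar ^ 2 + Fbar ^ 2 / (2 * γ ^ 2)) :=
    mul_le_mul_of_nonneg_right (by linarith) (by positivity)
  have hdis' := mul_le_mul_of_nonneg_left hdis (by positivity : (0 : ℝ) ≤ 4 * γ)
  linarith

end IsMeanChain

end HarmonicChain

/-! ### Bounds uniform in the length of the chain, and its adjoint modes. -/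

namespace HarmonicChain

/-! ### Families of averaged chains -/

/-- A family of averaged chains, one for each `n ≥ 1`, with forces `F̄ + n^{-1/2} f` and initial
energies of order `n`. -/
structure IsMeanChainFamily (γ Fbar A H : ℝ) (f : ℝ → ℝ) (R Q : ℕ → ℕ → ℝ → ℝ) : Prop where
  pos : 0 < γ
  chain : ∀ n, 1 ≤ n → IsMeanChain n γ (fun t => Fbar + 1 / √(n : ℝ) * f t) (R n) (Q n)
  cont : Continuous f
  bound : ∀ t, |f t| ≤ A
  energy_zero : ∀ n : ℕ, 1 ≤ n → energy n (R n) (Q n) 0 ≤ H * n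

lemma sum_abs_le_energy (n : ℕ) (R Q : ℕ → ℝ → ℝ) (t : ℝ) :
    ∑ x ∈ Finset.range (n + 1), (|R x t| + |Q x t|) ≤ (n + 1) + energy n R Q t / 2 := by
  have h : ∀ x ∈ Finset.range (n + 1), |R x t| + |Q x t| ≤ 1 + ((R x t) ^ 2 + (Q x t) ^ 2) / 2 := by
    intro x _
    nlinarith [sq_nonneg (|R x t| - 1), sq_nonneg (|Q x t| - 1), sq_abs (R x t), sq_abs (Q x t)]
  refine (Finset.sum_le_sum h).trans (le_of_eq ?_)
  rw [Finset.sum_add_distrib, energy, Finset.sum_div]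
  simp

namespace IsMeanChainFamily

variable {γ Fbar A H : ℝ} {f : ℝ → ℝ} {R Q : ℕ → ℕ → ℝ → ℝ}
  (h : IsMeanChainFamily γ Fbar A H f R Q)

include h

lemma exists_bound {τ : ℝ} (hτ : 0 ≤ τ) : ∃ C, 0 ≤ C ∧ ∀ n : ℕ, 1 ≤ n → ∀ t, 0 ≤ t →
    t ≤ n ^ 2 * τ → energy n (R n) (Q n) t ≤ C * n ∧ ∫ s in (0 : ℝ)..t, (Q n n s) ^ 2 ≤ C * n := by
  have hγ := h.pos
  set D := 3 / 2 * H + 4 * (2 * Fbar ^ 2 + Fbar ^ 2 / (2 * γ ^ 2)) +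
        |Fbar| * (|Fbar| + A) * τ / γ + A ^ 2 * τ / (2 * γ)
  have key : ∀ n : ℕ, 1 ≤ n → ∀ t, 0 ≤ t → t ≤ n ^ 2 * τ →
      energy n (R n) (Q n) t / 2 + 2 * γ * (∫ s in (0 : ℝ)..t, (Q n n s) ^ 2) ≤ D * n := by
    intro n hn t ht htτ
    refine (h.chain n hn).energy_le hγ hn (fun _ => rfl) ?_ h.bound (h.energy_zero n hn) ht htτ
    have : (0 : ℝ) < n := by exact_mod_cast hn
    rw [div_pow, Real.sq_sqrt this.le]
    field_simp
  have hE : ∀ n t, 0 ≤ energy n (R n) (Q n) t := fun n t =>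
    Finset.sum_nonneg fun x _ => by positivity
  have hI : ∀ n t, 0 ≤ t → 0 ≤ ∫ s in (0 : ℝ)..t, (Q n n s) ^ 2 := fun n t ht =>
    intervalIntegral.integral_nonneg ht fun s _ => sq_nonneg _
  -- No sign is assumed for `H`; the estimate itself, at `n = 1` and time `0`, bounds `D` below by a
  -- nonnegative quantity.
  have hD : 0 ≤ D := by
    have h1 := key 1 le_rfl 0 le_rfl (by simpa using hτ)
    have h2 := hE 1 0
    simp at h1
    linarith
  refine ⟨max (2 * D) (D / (2 * γ)), le_max_of_le_left (by positivity), fun n hn t ht htτ => ?_⟩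
  have hk := key n hn t ht htτ
  have h1 := hE n t
  have h2 := hI n t ht
  constructor
  · refine le_trans ?_ (mul_le_mul_of_nonneg_right (le_max_left _ _) (Nat.cast_nonneg n))
    have : 0 ≤ 2 * γ * ∫ s in (0 : ℝ)..t, (Q n n s) ^ 2 := by positivity
    linarith
  · refine le_trans ?_ (mul_le_mul_of_nonneg_right (le_max_right _ _) (Nat.cast_nonneg n))
    rw [div_mul_eq_mul_div, le_div_iff₀ (by positivity)]
    linarith

end IsMeanChainFamily

/-! ### Resonance with a harmonic -/

/-- Coefficients of a solution of the adjoint equations at frequency `ω`. -/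
structure IsAdjointMode (γ ω : ℝ) (U V : ℕ → ℂ) : Prop where
  zero : U 0 = 0
  left : ∀ x, V (x + 1) - V x = Complex.I * ω * U (x + 1)
  right : ∀ x, U (x + 1) - U x = (Complex.I * ω - 2 * γ) * V x

/-- The pairing of a configuration with a pair of coefficient sequences. -/
noncomputable def pairing (n : ℕ) (U V : ℕ → ℂ) (R Q : ℕ → ℝ → ℝ) (t : ℝ) : ℂ :=
  (∑ x ∈ Finset.range n, U (x + 1) * (R (x + 1) t : ℂ)) +
    ∑ x ∈ Finset.range (n + 1), V x * (Q x t : ℂ)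

/-- The adjoint relations are those for which the derivative of `e^{iωs}` times the pairing
telescopes. The left end contributes nothing, because `U 0 = 0` and `R 0 = 0`; the driven end
contributes `U (n+1) Q_n + V n F`. -/
lemma IsMeanChain.resonance {n : ℕ} {γ ω : ℝ} {F : ℝ → ℝ} {R Q : ℕ → ℝ → ℝ}
    (h : IsMeanChain n γ F R Q) {U V : ℕ → ℂ} (hUV : IsAdjointMode γ ω U V) {t : ℝ} (ht : 0 ≤ t) :
    U (n + 1) * (∫ s in (0 : ℝ)..t, Complex.exp (Complex.I * ω * s) * (Q n s : ℂ)) +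
      V n * (∫ s in (0 : ℝ)..t, Complex.exp (Complex.I * ω * s) * (F s : ℂ)) =
      Complex.exp (Complex.I * ω * t) * pairing n U V R Q t - pairing n U V R Q 0 := by
  have hexp : Continuous fun s : ℝ => Complex.exp (Complex.I * ω * s) := by fun_prop
  have hQ : ContinuousOn (fun s : ℝ => Complex.exp (Complex.I * ω * s) * (Q n s : ℂ)) (Ici 0) :=
    hexp.continuousOn.mul (Complex.continuous_ofReal.comp_continuousOn (h.cont_p n le_rfl))
  have hF : ContinuousOn (fun s : ℝ => Complex.exp (Complex.I * ω * s) * (F s : ℂ)) (Ici 0) :=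
    hexp.continuousOn.mul (Complex.continuous_ofReal.comp_continuousOn h.continuousOn_force)
  have key := integral_eq_sub_of_hasDerivAt_Ici
    (f := fun t : ℝ => Complex.exp (Complex.I * ω * t) * pairing n U V R Q t)
    (f' := fun s : ℝ => U (n + 1) * (Complex.exp (Complex.I * ω * s) * (Q n s : ℂ)) +
      V n * (Complex.exp (Complex.I * ω * s) * (F s : ℂ))) ?_ ?_ ?_ ht
  · rw [intervalIntegral.integral_add
      ((intervalIntegrable_of_continuousOn_Ici hQ le_rfl ht).const_mul _)
      ((intervalIntegrable_of_continuousOn_Ici hF le_rfl ht).const_mul _),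
      intervalIntegral.integral_const_mul, intervalIntegral.integral_const_mul] at key
    simpa using key
  · refine hexp.continuousOn.mul (ContinuousOn.add (continuousOn_finsetSum _ fun x hx => ?_)
      (continuousOn_finsetSum _ fun x hx => ?_))
    · exact continuousOn_const.mul (Complex.continuous_ofReal.comp_continuousOn
        (h.cont_r _ (by have := Finset.mem_range.1 hx; omega)))
    · exact continuousOn_const.mul (Complex.continuous_ofReal.comp_continuousOn
        (h.cont_p _ (by have := Finset.mem_range.1 hx; omega)))
  · exact (continuousOn_const.mul hQ).add (continuousOn_const.mul hF)
  · intro t ht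
    have h1 : HasDerivAt (fun t => ∑ x ∈ Finset.range n, U (x + 1) * (R (x + 1) t : ℂ))
        (∑ x ∈ Finset.range n, U (x + 1) * ((Q (x + 1) t - Q x t : ℝ) : ℂ)) t :=
      HasDerivAt.fun_sum fun x hx =>
        ((h.deriv_r x (Finset.mem_range.1 hx) t ht).ofReal_comp).const_mul _
    have h2 : HasDerivAt (fun t => ∑ x ∈ Finset.range (n + 1), V x * (Q x t : ℂ))
        (∑ x ∈ Finset.range (n + 1), V x * ((R (x + 1) t - R x t - 2 * γ * Q x t : ℝ) : ℂ)) t :=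
      HasDerivAt.fun_sum fun x hx =>
        ((h.deriv_p x (by have := Finset.mem_range.1 hx; omega) t ht).ofReal_comp).const_mul _
    have h3 : HasDerivAt (fun t : ℝ => Complex.exp (Complex.I * ω * t))
        (Complex.exp (Complex.I * ω * t) * (Complex.I * ω)) t := by
      have := (((hasDerivAt_id t).ofReal_comp).const_mul (Complex.I * ω)).cexp
      simpa using this
    refine (h3.mul (h1.add h2)).congr_deriv ?_
    have e1 : ∀ m : ℕ, Complex.I * ω * ((∑ x ∈ Finset.range m, U (x + 1) * (R (x + 1) t : ℂ)) +
        ∑ x ∈ Finset.range (m + 1), V x * (Q x t : ℂ)) +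
        ((∑ x ∈ Finset.range m, U (x + 1) * ((Q (x + 1) t - Q x t : ℝ) : ℂ)) +
        ∑ x ∈ Finset.range (m + 1), V x * ((R (x + 1) t - R x t - 2 * γ * Q x t : ℝ) : ℂ)) =
        U (m + 1) * Q m t + V m * R (m + 1) t := by
      intro m
      induction m with
      | zero =>
        have := hUV.right 0
        rw [hUV.zero] at this
        simp only [Finset.sum_range_zero, zero_add, Finset.sum_range_one, h.r_left]
        push_cast
        linear_combination (-(Q 0 t : ℂ)) * this
      | succ m ih =>
        rw [Finset.sum_range_succ, Finset.sum_range_succ _ (m + 1),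
          Finset.sum_range_succ (fun x => U (x + 1) * ((Q (x + 1) t - Q x t : ℝ) : ℂ)) m,
          Finset.sum_range_succ (fun x => V x * ((R (x + 1) t - R x t - 2 * γ * Q x t : ℝ) : ℂ))
            (m + 1)]
        have l := hUV.left m
        have r := hUV.right (m + 1)
        push_cast at ih ⊢
        linear_combination ih - (R (m + 1) t : ℂ) * l - (Q (m + 1) t : ℂ) * r
    have := e1 n
    rw [h.r_right] at this
    simp only [Pi.add_apply]
    linear_combination (Complex.exp (Complex.I * ω * t)) * this

/-- The growth factor of the adjoint mode at frequency `ω`. -/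
structure IsGrowthFactor (γ ω : ℝ) (η : ℂ) : Prop where
  one_lt : 1 < ‖η‖
  eq : (η - 1) ^ 2 = η * (Complex.I * ω * (Complex.I * ω - 2 * γ))

/-- The quadratic is invariant under `η ↦ η⁻¹`, so it suffices to exclude `‖η‖ = 1`. There `η + η⁻¹
- 2` would be real, while it equals a number of imaginary part `-2γω ≠ 0`: friction forces
exponential growth or decay. -/
lemma exists_isGrowthFactor {γ ω : ℝ} (hγ : 0 < γ) (hω : ω ≠ 0) : ∃ η, IsGrowthFactor γ ω η := by
  set c : ℂ := Complex.I * ω * (Complex.I * ω - 2 * γ) with hc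
  obtain ⟨z, hz⟩ := IsAlgClosed.exists_pow_nat_eq ((2 + c) ^ 2 - 4) (n := 2) two_pos
  set η : ℂ := (2 + c + z) / 2 with hη
  have heq : (η - 1) ^ 2 = η * c := by
    rw [hη]; linear_combination hz / 4
  have h0 : η ≠ 0 := fun h => by rw [h] at heq; norm_num at heq
  rcases lt_trichotomy 1 ‖η‖ with h1 | h1 | h1
  · exact ⟨η, h1, heq⟩
  · exfalso
    have him : c.im = -2 * γ * ω := by
      rw [hc]; simp [Complex.mul_im]; ring
    have hinv : η⁻¹ = (starRingEnd ℂ) η := by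
      rw [Complex.inv_def, Complex.normSq_eq_norm_sq, ← h1]; simp
    have hc2 : c = η + η⁻¹ - 2 := by
      field_simp
      linear_combination -heq
    rw [hc2, hinv] at him
    simp at him
    exact him.elim (fun h => hγ.ne' h) hω
  · refine ⟨η⁻¹, ?_, ?_⟩
    · rw [norm_inv]; exact (one_lt_inv₀ (norm_pos_iff.2 h0)).2 h1
    · rw [← hc]; field_simp; linear_combination heq

namespace IsGrowthFactor

variable {γ ω : ℝ} {η : ℂ} (hη : IsGrowthFactor γ ω η)

include hη

lemma ne_zero : η ≠ 0 := norm_pos_iff.1 (one_pos.trans hη.one_lt)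

lemma sub_one_ne_zero : η - 1 ≠ 0 := fun h => by
  have := hη.one_lt
  rw [sub_eq_zero.1 h, norm_one] at this
  exact lt_irrefl _ this

/-- A combination of the two exponentials `η^x` and `η^{-x}`, chosen so that `U` is odd and vanishes
at `0`. -/
lemma isAdjointMode (hω : ω ≠ 0) : IsAdjointMode γ ω
    (fun x => (η - 1) * (η ^ x - (η⁻¹) ^ x) / (Complex.I * ω))
    (fun x => η ^ (x + 1) + (η⁻¹) ^ x) := by
  have h0 := hη.ne_zero
  have hω' : (ω : ℂ) ≠ 0 := by exact_mod_cast hω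
  have hinv : η * η⁻¹ = 1 := mul_inv_cancel₀ h0
  refine ⟨by simp, fun x => ?_, fun x => ?_⟩
  · rw [mul_div_cancel₀ _ (mul_ne_zero Complex.I_ne_zero hω')]
    linear_combination (η⁻¹) ^ x * hinv
  · rw [← sub_div, div_eq_iff (mul_ne_zero Complex.I_ne_zero hω')]
    have e : (η - 1) ^ 2 * η⁻¹ = Complex.I * ω * (Complex.I * ω - 2 * γ) := by
      rw [hη.eq]; field_simp
    linear_combination (η ^ (x + 1) + (η⁻¹) ^ x) * e +
      ((-(η - 1)^2 * η ^ x) + (η⁻¹) ^ x * (1 - η)) * hinv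

end IsGrowthFactor

end HarmonicChain

/-! ### Response of the driven end to a single frequency. -/

namespace HarmonicChain

/-! ### The linear response to a harmonic -/

lemma norm_exp_I_mul (ω s : ℝ) : ‖Complex.exp (Complex.I * ω * s)‖ = 1 := by
  rw [mul_assoc, mul_comm, ← Complex.ofReal_mul, Complex.norm_exp_ofReal_mul_I]

lemma norm_integral_exp_le {ω : ℝ} (hω : ω ≠ 0) (t : ℝ) :
    ‖∫ s in (0 : ℝ)..t, Complex.exp (Complex.I * ω * s)‖ ≤ 2 / |ω| := by
  have hne : Complex.I * (ω : ℂ) ≠ 0 := mul_ne_zero Complex.I_ne_zero (by exact_mod_cast hω)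
  rw [integral_exp_mul_complex hne, norm_div, norm_mul, Complex.norm_I, one_mul,
    Complex.norm_real, Real.norm_eq_abs]
  gcongr
  refine (norm_sub_le _ _).trans ?_
  rw [norm_exp_I_mul, norm_exp_I_mul]
  norm_num

lemma norm_pairing_le {n : ℕ} {U V : ℕ → ℂ} {K : ℝ} (hU : ∀ x ≤ n, ‖U x‖ ≤ K)
    (hV : ∀ x ≤ n, ‖V x‖ ≤ K) (R Q : ℕ → ℝ → ℝ) (t : ℝ) :
    ‖pairing n U V R Q t‖ ≤ K * ∑ x ∈ Finset.range (n + 1), (|R x t| + |Q x t|) := by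
  have hK : 0 ≤ K := (norm_nonneg _).trans (hU 0 (Nat.zero_le n))
  rw [Finset.sum_add_distrib, mul_add]
  refine (norm_add_le _ _).trans (add_le_add ?_ ?_)
  · rw [Finset.sum_range_succ', mul_add, Finset.mul_sum]
    refine (norm_sum_le _ _).trans (le_trans (Finset.sum_le_sum fun x hx => ?_)
      (le_add_of_nonneg_right (by positivity)))
    rw [norm_mul, Complex.norm_real, Real.norm_eq_abs]
    exact mul_le_mul_of_nonneg_right (hU _ (by have := Finset.mem_range.1 hx; omega))
      (abs_nonneg _)
  · rw [Finset.mul_sum]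
    refine (norm_sum_le _ _).trans (Finset.sum_le_sum fun x hx => ?_)
    rw [norm_mul, Complex.norm_real, Real.norm_eq_abs]
    exact mul_le_mul_of_nonneg_right (hV _ (by have := Finset.mem_range.1 hx; omega))
      (abs_nonneg _)

namespace IsGrowthFactor

variable {γ ω : ℝ} {η : ℂ} (hη : IsGrowthFactor γ ω η)

include hη

lemma norm_inv_pow_le (x : ℕ) : ‖(η⁻¹) ^ x‖ ≤ 1 := by
  rw [norm_pow, norm_inv]
  exact pow_le_one₀ (by positivity) (inv_le_one_of_one_le₀ hη.one_lt.le)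

lemma norm_right_le {n x : ℕ} (hx : x ≤ n) :
    ‖η ^ (x + 1) + (η⁻¹) ^ x‖ ≤ 2 * ‖η‖ * ‖η‖ ^ n := by
  have h1 := hη.norm_inv_pow_le x
  have h2 : ‖η‖ ^ (x + 1) ≤ ‖η‖ ^ (n + 1) := pow_le_pow_right₀ hη.one_lt.le (by omega)
  have h3 : 1 ≤ ‖η‖ ^ (n + 1) := one_le_pow₀ hη.one_lt.le
  refine (norm_add_le _ _).trans ?_
  rw [norm_pow]
  calc ‖η‖ ^ (x + 1) + ‖(η⁻¹) ^ x‖ ≤ 2 * ‖η‖ ^ (n + 1) := by linarith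
    _ = _ := by ring

lemma norm_left_le {n x : ℕ} (hx : x ≤ n) :
    ‖(η - 1) * (η ^ x - (η⁻¹) ^ x) / (Complex.I * ω)‖ ≤ 2 * (‖η‖ + 1) / |ω| * ‖η‖ ^ n := by
  have h1 := hη.norm_inv_pow_le x
  have h2 : ‖η‖ ^ x ≤ ‖η‖ ^ n := pow_le_pow_right₀ hη.one_lt.le hx
  have h3 : 1 ≤ ‖η‖ ^ n := one_le_pow₀ hη.one_lt.le
  have h4 : ‖η ^ x - (η⁻¹) ^ x‖ ≤ 2 * ‖η‖ ^ n := by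
    refine (norm_sub_le _ _).trans ?_
    rw [norm_pow]
    linarith
  have h5 : ‖η - 1‖ ≤ ‖η‖ + 1 := by simpa using norm_sub_le η 1
  rw [norm_div, norm_mul, norm_mul, Complex.norm_I, one_mul, Complex.norm_real, Real.norm_eq_abs]
  calc ‖η - 1‖ * ‖η ^ x - (η⁻¹) ^ x‖ / |ω| ≤ (‖η‖ + 1) * (2 * ‖η‖ ^ n) / |ω| := by gcongr
    _ = _ := by ring

/-- The growing exponential dominates at the driven end. This lower bound has the order `‖η‖ ^ n` of
the upper bounds for all the coefficients, so division by `U (n + 1)` leaves bounded weights. -/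
lemma le_norm_left (n : ℕ) : (‖η‖ - 1) ^ 2 / |ω| * ‖η‖ ^ n ≤
    ‖(η - 1) * (η ^ (n + 1) - (η⁻¹) ^ (n + 1)) / (Complex.I * ω)‖ := by
  have h1 := hη.norm_inv_pow_le (n + 1)
  have h3 : 1 ≤ ‖η‖ ^ n := one_le_pow₀ hη.one_lt.le
  have h4 : (‖η‖ - 1) * ‖η‖ ^ n ≤ ‖η ^ (n + 1) - (η⁻¹) ^ (n + 1)‖ := by
    refine le_trans ?_ (norm_sub_norm_le _ _)
    rw [norm_pow, pow_succ]
    linarith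
  have h5 : ‖η‖ - 1 ≤ ‖η - 1‖ := by simpa using norm_sub_norm_le η 1
  have h6 := sub_pos.2 hη.one_lt
  rw [norm_div, norm_mul, norm_mul, Complex.norm_I, one_mul, Complex.norm_real, Real.norm_eq_abs]
  calc _ = (‖η‖ - 1) * ((‖η‖ - 1) * ‖η‖ ^ n) / |ω| := by ring
    _ ≤ _ := by gcongr

/-- The response coefficients converge as the chain gets longer. -/
lemma tendsto_response (hω : ω ≠ 0) :
    Tendsto (fun n : ℕ => (η ^ (n + 1) + (η⁻¹) ^ n) /
      ((η - 1) * (η ^ (n + 1) - (η⁻¹) ^ (n + 1)) / (Complex.I * ω))) atTop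
      (𝓝 (Complex.I * ω / (η - 1))) := by
  have h0 := hη.ne_zero
  have h1 := hη.sub_one_ne_zero
  have hω' : Complex.I * (ω : ℂ) ≠ 0 := mul_ne_zero Complex.I_ne_zero (by exact_mod_cast hω)
  set z := η⁻¹ with hz
  have hz0 : z ≠ 0 := inv_ne_zero h0
  have hz1 : ‖z‖ < 1 := by rw [hz, norm_inv]; exact inv_lt_one_of_one_lt₀ hη.one_lt
  have hlim : Tendsto (fun n : ℕ => Complex.I * ω / (η - 1) *
      ((1 + z ^ n * z ^ (n + 1)) / (1 - z ^ (n + 1) * z ^ (n + 1)))) atTop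
      (𝓝 (Complex.I * ω / (η - 1) * ((1 + 0 * 0) / (1 - 0 * 0)))) := by
    have t0 := tendsto_pow_atTop_nhds_zero_of_norm_lt_one hz1
    have t1 := (tendsto_add_atTop_iff_nat 1).2 t0
    exact ((tendsto_const_nhds.add (t0.mul t1)).div (tendsto_const_nhds.sub (t1.mul t1))
      (by norm_num)).const_mul _
  norm_num at hlim
  refine hlim.congr fun n => ?_
  have hηz : η ^ (n + 1) * z ^ (n + 1) = 1 := by
    rw [← mul_pow, hz, mul_inv_cancel₀ h0, one_pow]
  have hzn : z ^ (n + 1) ≠ 0 := pow_ne_zero _ hz0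
  have e1 : η ^ (n + 1) + z ^ n = (1 + z ^ n * z ^ (n + 1)) / z ^ (n + 1) := by
    rw [eq_div_iff hzn]; linear_combination hηz
  have e2 : η ^ (n + 1) - z ^ (n + 1) = (1 - z ^ (n + 1) * z ^ (n + 1)) / z ^ (n + 1) := by
    rw [eq_div_iff hzn]; linear_combination hηz
  have hne : (1 - z ^ (n + 1) * z ^ (n + 1)) ≠ 0 := by
    intro h
    have : ‖z ^ (n + 1) * z ^ (n + 1)‖ < 1 := by
      rw [← pow_add, norm_pow]
      exact pow_lt_one₀ (norm_nonneg _) hz1 (by omega)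
    rw [← sub_eq_zero.1 h, norm_one] at this
    exact lt_irrefl _ this
  rw [e1, e2]
  field_simp

end IsGrowthFactor

namespace IsMeanChainFamily

variable {γ Fbar A H : ℝ} {f : ℝ → ℝ} {R Q : ℕ → ℕ → ℝ → ℝ}
  (h : IsMeanChainFamily γ Fbar A H f R Q)

include h

/-- By `|Q| ≤ (√n / 2) Q² + 1 / (2√n)` and `∫ Q² ≤ C n`, the integral over `[0, n² t]` is at most
`(C + t) / 2 · n√n`. Uniformity in `ω` is what dominates the later sum over harmonics. -/
lemma exists_norm_harmonic_le {t : ℝ} (ht : 0 ≤ t) : ∃ C, ∀ n : ℕ, 1 ≤ n → ∀ ω : ℝ,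
    ‖(1 / ((n : ℂ) * (√(n : ℝ) : ℝ))) * ∫ s in (0 : ℝ)..(n ^ 2 * t),
      Complex.exp (Complex.I * ω * s) * (Q n n s : ℂ)‖ ≤ C := by
  obtain ⟨C, hC, hb⟩ := h.exists_bound ht
  refine ⟨(C + t) / 2, fun n hn ω => ?_⟩
  have hn0 : (0 : ℝ) < n := by exact_mod_cast hn
  have hsq : √(n : ℝ) * √(n : ℝ) = n := Real.mul_self_sqrt hn0.le
  have hs0 : 0 < √(n : ℝ) := Real.sqrt_pos.2 hn0
  have hT : 0 ≤ (n : ℝ) ^ 2 * t := by positivity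
  have hch := h.chain n hn
  have hQ2 : IntervalIntegrable (fun s => (Q n n s) ^ 2) volume 0 ((n : ℝ) ^ 2 * t) :=
    intervalIntegrable_of_continuousOn_Ici ((hch.cont_p n le_rfl).pow 2) le_rfl hT
  have h1 : ‖∫ s in (0 : ℝ)..(n ^ 2 * t), Complex.exp (Complex.I * ω * s) * (Q n n s : ℂ)‖ ≤
      ∫ s in (0 : ℝ)..(n ^ 2 * t), (√(n : ℝ) / 2 * (Q n n s) ^ 2 + 1 / (2 * √(n : ℝ))) := by
    refine intervalIntegral.norm_integral_le_of_norm_le hT (Eventually.of_forall fun s _ => ?_)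
      ((hQ2.const_mul _).add intervalIntegrable_const)
    rw [norm_mul, norm_exp_I_mul, one_mul, Complex.norm_real, Real.norm_eq_abs]
    have e : √(n : ℝ) / 2 * (Q n n s) ^ 2 + 1 / (2 * √(n : ℝ)) - |Q n n s| =
        1 / (2 * √(n : ℝ)) * (√(n : ℝ) * |Q n n s| - 1) ^ 2 := by
      rw [← sq_abs (Q n n s)]
      field_simp
      ring
    have : 0 ≤ 1 / (2 * √(n : ℝ)) * (√(n : ℝ) * |Q n n s| - 1) ^ 2 := by positivity
    linarith
  rw [intervalIntegral.integral_add (hQ2.const_mul _) intervalIntegrable_const,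
    intervalIntegral.integral_const_mul, intervalIntegral.integral_const, smul_eq_mul,
    sub_zero] at h1
  have h2 := (hb n hn _ hT le_rfl).2
  have h3 : √(n : ℝ) / 2 * (∫ s in (0 : ℝ)..(n ^ 2 * t), (Q n n s) ^ 2) +
      n ^ 2 * t * (1 / (2 * √(n : ℝ))) ≤ (C + t) / 2 * (n * √(n : ℝ)) := by
    have e1 : √(n : ℝ) / 2 * (∫ s in (0 : ℝ)..(n ^ 2 * t), (Q n n s) ^ 2) ≤
      √(n : ℝ) / 2 * (C * n) := by gcongr
    have e2 : (n : ℝ) ^ 2 * t * (1 / (2 * √(n : ℝ))) = t / 2 * (n * √(n : ℝ)) := by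
      field_simp
      rw [Real.sq_sqrt hn0.le]
      ring
    linarith
  rw [norm_mul, norm_div, norm_one, norm_mul, Complex.norm_natCast, Complex.norm_real,
    Real.norm_of_nonneg hs0.le, div_mul_eq_mul_div, one_mul, div_le_iff₀ (by positivity)]
  exact h1.trans h3

/-- The response of the last momentum at frequency `ω`. -/
theorem tendsto_harmonic {ω : ℝ} (hω : ω ≠ 0) {η m : ℂ} (hη : IsGrowthFactor γ ω η)
    (hm : Tendsto (fun T : ℝ => (1 / (T : ℂ)) * ∫ s in (0 : ℝ)..T,
      Complex.exp (Complex.I * ω * s) * (f s : ℂ)) atTop (𝓝 m)) {t : ℝ} (ht : 0 < t) :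
    Tendsto (fun n : ℕ => (1 / ((n : ℂ) * (√(n : ℝ) : ℝ))) * ∫ s in (0 : ℝ)..(n ^ 2 * t),
      Complex.exp (Complex.I * ω * s) * (Q n n s : ℂ)) atTop
      (𝓝 (-(Complex.I * ω / (η - 1)) * (t * m))) := by
  obtain ⟨C, hC, hb⟩ := h.exists_bound ht.le
  have hUV := hη.isAdjointMode hω
  set U : ℕ → ℂ := fun x => (η - 1) * (η ^ x - (η⁻¹) ^ x) / (Complex.I * ω) with hU
  set V : ℕ → ℂ := fun x => η ^ (x + 1) + (η⁻¹) ^ x with hV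
  have hω0 : 0 < |ω| := abs_pos.2 hω
  have hρ := hη.one_lt
  have hρ1 := sub_pos.2 hρ
  set D := max (2 * ‖η‖) (2 * (‖η‖ + 1) / |ω|) / ((‖η‖ - 1) ^ 2 / |ω|) * (2 + C / 2) with hD
  have hUpos : ∀ n : ℕ, 0 < ‖U (n + 1)‖ := fun n =>
    lt_of_lt_of_le (by positivity) (hη.le_norm_left n)
  -- The normalised coefficients are bounded in `n`, and the `ℓ¹` size of the configuration is
  -- `O(n)` by the energy bound.
  have hpair : ∀ n : ℕ, 1 ≤ n → ∀ s, 0 ≤ s → s ≤ n ^ 2 * t →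
      ‖pairing n U V (R n) (Q n) s / U (n + 1)‖ ≤ D * n := by
    intro n hn s hs hst
    have hn1 : (1 : ℝ) ≤ n := by exact_mod_cast hn
    rw [norm_div, div_le_iff₀ (hUpos n)]
    refine (norm_pairing_le (K := max (2 * ‖η‖) (2 * (‖η‖ + 1) / |ω|) * ‖η‖ ^ n)
      (fun x hx => (hη.norm_left_le hx).trans (by gcongr; exact le_max_right _ _))
      (fun x hx => (hη.norm_right_le hx).trans (by gcongr; exact le_max_left _ _)) _ _ _).trans ?_
    have h1 : ∑ x ∈ Finset.range (n + 1), (|R n x s| + |Q n x s|) ≤ (2 + C / 2) * n := by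
      have := sum_abs_le_energy n (R n) (Q n) s
      have := (hb n hn s hs hst).1
      linarith
    calc _ ≤ max (2 * ‖η‖) (2 * (‖η‖ + 1) / |ω|) * ‖η‖ ^ n * ((2 + C / 2) * n) := by gcongr
      _ = D * n * ((‖η‖ - 1) ^ 2 / |ω| * ‖η‖ ^ n) := by
          rw [hD]; field_simp
      _ ≤ _ := by
          have := hη.le_norm_left n
          have hD0 : 0 ≤ D * n := by positivity
          gcongr
  have hbd : Tendsto (fun n : ℕ => (1 / ((n : ℂ) * (√(n : ℝ) : ℝ))) *
      (Complex.exp (Complex.I * ω * (n ^ 2 * t : ℝ)) * pairing n U V (R n) (Q n) (n ^ 2 * t) -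
        pairing n U V (R n) (Q n) 0) / U (n + 1)) atTop (𝓝 0) := by
    have hlim : Tendsto (fun n : ℕ => 2 * D * (1 / √(n : ℝ))) atTop (𝓝 0) := by
      have : Tendsto (fun n : ℕ => √(n : ℝ)) atTop atTop :=
        Real.tendsto_sqrt_atTop.comp tendsto_natCast_atTop_atTop
      simpa using (this.inv_tendsto_atTop).const_mul (2 * D)
    refine squeeze_zero_norm' ?_ hlim
    filter_upwards [eventually_ge_atTop 1] with n hn
    have hn0 : (0 : ℝ) < n := by exact_mod_cast hn
    have hs0 : 0 < √(n : ℝ) := Real.sqrt_pos.2 hn0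
    have p1 := hpair n hn (n ^ 2 * t) (by positivity) le_rfl
    have p2 := hpair n hn 0 le_rfl (by positivity)
    rw [mul_div_assoc, sub_div, mul_div_assoc, norm_mul, norm_div, norm_one, norm_mul,
      Complex.norm_natCast, Complex.norm_real, Real.norm_of_nonneg hs0.le]
    have p3 : ‖Complex.exp (Complex.I * ω * (n ^ 2 * t : ℝ)) *
        (pairing n U V (R n) (Q n) (n ^ 2 * t) / U (n + 1)) -
        pairing n U V (R n) (Q n) 0 / U (n + 1)‖ ≤ 2 * D * n := by
      refine (norm_sub_le _ _).trans ?_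
      rw [norm_mul, norm_exp_I_mul, one_mul]
      linarith
    calc _ ≤ 1 / (n * √(n : ℝ)) * (2 * D * n) := by gcongr
      _ = _ := by field_simp
  -- The constant `F̄` integrates to a bounded quantity because `ω ≠ 0`. The oscillation carries
  -- `n^{-3/2} n^{-1/2} = n⁻²`, which turns its integral over `[0, n² t]` into `t` times a time
  -- average.
  have hforce : Tendsto (fun n : ℕ => (1 / ((n : ℂ) * (√(n : ℝ) : ℝ))) *
      ∫ s in (0 : ℝ)..(n ^ 2 * t), Complex.exp (Complex.I * ω * s) *
        ((Fbar + 1 / √(n : ℝ) * f s : ℝ) : ℂ)) atTop (𝓝 (0 + t * m)) := by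
    have hexp : Continuous fun s : ℝ => Complex.exp (Complex.I * ω * s) := by fun_prop
    have hfc : Continuous fun s : ℝ => (f s : ℂ) := Complex.continuous_ofReal.comp h.cont
    have hT : Tendsto (fun n : ℕ => (n : ℝ) ^ 2 * t) atTop atTop :=
      ((tendsto_pow_atTop two_ne_zero).comp tendsto_natCast_atTop_atTop).atTop_mul_const ht
    have h1 : Tendsto (fun n : ℕ => (1 / ((n : ℂ) * (√(n : ℝ) : ℝ))) * (Fbar *
        ∫ s in (0 : ℝ)..(n ^ 2 * t), Complex.exp (Complex.I * ω * s))) atTop (𝓝 0) := by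
      have hlim : Tendsto (fun n : ℕ => 1 / (n : ℝ) * (|Fbar| * (2 / |ω|))) atTop (𝓝 0) := by
        simpa using (tendsto_one_div_atTop_nhds_zero_nat (𝕜 := ℝ)).mul_const (|Fbar| * (2 / |ω|))
      refine squeeze_zero_norm' ?_ hlim
      filter_upwards [eventually_ge_atTop 1] with n hn
      have hn1 : (1 : ℝ) ≤ n := by exact_mod_cast hn
      have hs1 : 1 ≤ √(n : ℝ) := Real.one_le_sqrt.2 hn1
      have := norm_integral_exp_le hω (n ^ 2 * t)
      rw [norm_mul, norm_mul, norm_div, norm_one, norm_mul, Complex.norm_natCast,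
        Complex.norm_real, Complex.norm_real, Real.norm_of_nonneg (by linarith : 0 ≤ √(n : ℝ)),
        Real.norm_eq_abs]
      gcongr
      nlinarith
    refine (h1.add ((hm.comp hT).const_mul (t : ℂ))).congr' ?_
    filter_upwards [eventually_ge_atTop 1] with n hn
    have hn0 : (0 : ℝ) < n := by exact_mod_cast hn
    have hs0 : 0 < √(n : ℝ) := Real.sqrt_pos.2 hn0
    have hi1 : IntervalIntegrable (fun s : ℝ => Complex.exp (Complex.I * ω * s)) volume 0
      (n ^ 2 * t) := hexp.intervalIntegrable _ _
    have hi2 : IntervalIntegrable (fun s : ℝ => Complex.exp (Complex.I * ω * s) * (f s : ℂ))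
      volume 0 (n ^ 2 * t) := (hexp.mul hfc).intervalIntegrable _ _
    have e : ∀ s : ℝ, Complex.exp (Complex.I * ω * s) * ((Fbar + 1 / √(n : ℝ) * f s : ℝ) : ℂ) =
        Fbar * Complex.exp (Complex.I * ω * s) +
          1 / ((√(n : ℝ) : ℝ) : ℂ) * (Complex.exp (Complex.I * ω * s) * (f s : ℂ)) := fun s => by
      push_cast; ring
    simp only [e, Function.comp_apply]
    rw [intervalIntegral.integral_add (hi1.const_mul _) (hi2.const_mul _),
      intervalIntegral.integral_const_mul, intervalIntegral.integral_const_mul, mul_add]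
    congr 1
    have hsq : ((√(n : ℝ) : ℝ) : ℂ) * ((√(n : ℝ) : ℝ) : ℂ) = (n : ℂ) := by
      rw [← Complex.ofReal_mul, Real.mul_self_sqrt hn0.le]; simp
    have hsc : ((√(n : ℝ) : ℝ) : ℂ) ≠ 0 := by exact_mod_cast hs0.ne'
    have hnc : (n : ℂ) ≠ 0 := by exact_mod_cast hn0.ne'
    have htc : (t : ℂ) ≠ 0 := by exact_mod_cast ht.ne'
    push_cast
    rw [← mul_assoc, ← mul_assoc]
    congr 1
    rw [div_mul_div_comm, one_mul, mul_assoc, hsq]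
    field_simp
  have hall := hbd.sub ((hη.tendsto_response hω).mul hforce)
  refine (hall.congr' ?_).trans (le_of_eq ?_)
  · filter_upwards [eventually_ge_atTop 1] with n hn
    have hne : U (n + 1) ≠ 0 := norm_pos_iff.1 (hUpos n)
    have key := (h.chain n hn).resonance hUV (t := n ^ 2 * t) (by positivity)
    have e : ∫ s in (0 : ℝ)..(n ^ 2 * t), Complex.exp (Complex.I * ω * s) * (Q n n s : ℂ) =
        (Complex.exp (Complex.I * ω * (n ^ 2 * t : ℝ)) * pairing n U V (R n) (Q n) (n ^ 2 * t) -
        pairing n U V (R n) (Q n) 0) / U (n + 1) - V n / U (n + 1) *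
        ∫ s in (0 : ℝ)..(n ^ 2 * t), Complex.exp (Complex.I * ω * s) *
        ((Fbar + 1 / √(n : ℝ) * f s : ℝ) : ℂ) := by
      rw [← key]
      field_simp
      ring
    rw [e]
    simp only [hU, hV]
    ring
  · congr 1; ring

end IsMeanChainFamily

end HarmonicChain

/-! ### Discrete sine modes and their diffusive limit. -/

namespace HarmonicChain

/-! ### Sine modes of the stretches -/

/-- The `j`-th discrete sine coefficient of the stretches. -/
noncomputable def sineMode (n j : ℕ) (R : ℕ → ℝ → ℝ) (t : ℝ) : ℝ :=
  1 / ((n : ℝ) + 1) * ∑ x ∈ Finset.range (n + 1), Real.sin (Real.pi * j / (n + 1) * x) * R x t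

/-- The `j`-th discrete cosine coefficient of the momenta. -/
noncomputable def cosineMode (n j : ℕ) (Q : ℕ → ℝ → ℝ) (t : ℝ) : ℝ :=
  1 / ((n : ℝ) + 1) * ∑ x ∈ Finset.range (n + 1),
    Real.cos (Real.pi * j / (n + 1) * (x + 1 / 2)) * Q x t

/-- The square root of the `j`-th eigenvalue of the discrete Laplacian. -/
noncomputable def modeFreq (n j : ℕ) : ℝ := 2 * Real.sin (Real.pi * j / (n + 1) / 2)

lemma abs_modeFreq_le (n j : ℕ) : |modeFreq n j| ≤ Real.pi * j / (n + 1) := by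
  rw [modeFreq, abs_mul, abs_two]
  have h := Real.abs_sin_le_abs (x := Real.pi * j / (n + 1) / 2)
  have h0 : |Real.pi * j / ((n : ℝ) + 1) / 2| = Real.pi * j / (n + 1) / 2 :=
    abs_of_nonneg (by positivity)
  linarith

lemma sin_eq_mul_sinc (x : ℝ) : Real.sin x = x * Real.sinc x := by
  rcases eq_or_ne x 0 with rfl | hx
  · simp
  · rw [Real.sinc_of_ne_zero hx]; field_simp

lemma tendsto_mode_angle (j : ℕ) :
    Tendsto (fun n : ℕ => Real.pi * j / ((n : ℝ) + 1) / 2) atTop (𝓝 0) := by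
  have := (tendsto_one_div_add_atTop_nhds_zero_nat (𝕜 := ℝ)).const_mul (Real.pi * j / 2)
  rw [mul_zero] at this
  exact this.congr fun n => by ring

lemma tendsto_mul_modeFreq (j : ℕ) :
    Tendsto (fun n : ℕ => ((n : ℝ) + 1) * modeFreq n j) atTop (𝓝 (Real.pi * j)) := by
  have h := ((Real.continuous_sinc.tendsto 0).comp (tendsto_mode_angle j)).const_mul (Real.pi * j)
  rw [Real.sinc_zero, mul_one] at h
  refine h.congr fun n => ?_
  rw [modeFreq, sin_eq_mul_sinc]
  simp only [Function.comp_apply]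
  field_simp

/-- The coefficient of the boundary force in the equation of the `j`-th mode. -/
noncomputable def modeForce (n j : ℕ) : ℝ :=
  1 / ((n : ℝ) + 1) * Real.cos (Real.pi * j / (n + 1) * (n + 1 / 2))

lemma modeForce_eq (n j : ℕ) : modeForce n j =
    1 / ((n : ℝ) + 1) * ((-1) ^ j * Real.cos (Real.pi * j / (n + 1) / 2)) := by
  have e : Real.pi * j / ((n : ℝ) + 1) * (n + 1 / 2) =
      j * Real.pi - Real.pi * j / (n + 1) / 2 := by
    have : (n : ℝ) + 1 ≠ 0 := by positivity
    field_simp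
    ring
  rw [modeForce, e, Real.cos_sub, Real.cos_nat_mul_pi, Real.sin_nat_mul_pi]
  ring

lemma abs_modeForce_le (n j : ℕ) : |modeForce n j| ≤ 1 / ((n : ℝ) + 1) := by
  rw [modeForce, abs_mul, abs_of_nonneg (by positivity : (0 : ℝ) ≤ 1 / ((n : ℝ) + 1))]
  exact mul_le_of_le_one_right (by positivity) (Real.abs_cos_le_one _)

lemma tendsto_modeForce_div (j : ℕ) (hj : 0 < j) :
    Tendsto (fun n : ℕ => modeForce n j / modeFreq n j) atTop (𝓝 ((-1) ^ j / (Real.pi * j))) := by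
  have hj' : Real.pi * j ≠ 0 := by positivity
  have h1 := ((Real.continuous_cos.tendsto 0).comp (tendsto_mode_angle j)).const_mul ((-1 : ℝ) ^ j)
  rw [Real.cos_zero, mul_one] at h1
  refine (h1.div (tendsto_mul_modeFreq j) hj').congr fun n => ?_
  have : (n : ℝ) + 1 ≠ 0 := by positivity
  simp only [Function.comp_apply, Pi.div_apply]
  rw [modeForce_eq, div_mul_eq_div_div]
  ring

lemma abs_cosineMode_le (n j : ℕ) (R Q : ℕ → ℝ → ℝ) (t : ℝ) :
    |cosineMode n j Q t| ≤ 1 / ((n : ℝ) + 1) * ((n + 1) + energy n R Q t / 2) := by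
  rw [cosineMode, abs_mul, abs_of_nonneg (by positivity : (0 : ℝ) ≤ 1 / ((n : ℝ) + 1))]
  gcongr
  refine le_trans ?_ (sum_abs_le_energy n R Q t)
  refine (Finset.abs_sum_le_sum_abs _ _).trans (Finset.sum_le_sum fun x _ => ?_)
  rw [abs_mul]
  have := mul_le_of_le_one_left (abs_nonneg (Q x t))
    (Real.abs_cos_le_one (Real.pi * j / (n + 1) * (x + 1 / 2)))
  linarith [abs_nonneg (R x t)]

namespace IsMeanChain

variable {n : ℕ} {γ : ℝ} {F : ℝ → ℝ} {R Q : ℕ → ℝ → ℝ} (h : IsMeanChain n γ F R Q)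

include h

lemma continuousOn_sineMode (j : ℕ) : ContinuousOn (sineMode n j R) (Ici 0) :=
  (continuousOn_finsetSum _ fun x hx =>
    (h.cont_r x (by have := Finset.mem_range.1 hx; omega)).const_mul _).const_mul _

lemma continuousOn_cosineMode (j : ℕ) : ContinuousOn (cosineMode n j Q) (Ici 0) :=
  (continuousOn_finsetSum _ fun x hx =>
    (h.cont_p x (by have := Finset.mem_range.1 hx; omega)).const_mul _).const_mul _

/-- The half-site shift of the cosines makes discrete differences exchange `sin (θx)` and `cos (θ(x
+ 1/2))` with the factor `2 sin (θ/2)`. Since `sin (θx)` vanishes at `0` and `n + 1`, the force acts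
only through the last cosine. -/
lemma hasDerivAt_modes (j : ℕ) {t : ℝ} (ht : 0 < t) :
    HasDerivAt (sineMode n j R) (-(modeFreq n j * cosineMode n j Q t)) t ∧
    HasDerivAt (cosineMode n j Q)
      (modeFreq n j * sineMode n j R t - 2 * γ * cosineMode n j Q t + modeForce n j * F t) t := by
  set θ := Real.pi * j / ((n : ℝ) + 1) with hθ
  set s : ℕ → ℝ := fun x => Real.sin (θ * x) with hs
  set c : ℕ → ℝ := fun x => Real.cos (θ * (x + 1 / 2)) with hc
  set μ := modeFreq n j with hμ
  have hμ' : μ = 2 * Real.sin (θ / 2) := rfl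
  have hs0 : s 0 = 0 := by simp [hs]
  have hsN : s (n + 1) = 0 := by
    have : θ * ((n + 1 : ℕ) : ℝ) = j * Real.pi := by
      rw [hθ]; push_cast; field_simp
    simp only [hs, this, Real.sin_nat_mul_pi]
  have hsc : ∀ x : ℕ, s (x + 1) - s x = μ * c x := fun x => by
    simp only [hs, hc, hμ']
    push_cast
    rw [show θ * ((x : ℝ) + 1) = θ * (x + 1 / 2) + θ / 2 by ring,
      show θ * (x : ℝ) = θ * (x + 1 / 2) - θ / 2 by ring, Real.sin_add, Real.sin_sub]
    ring
  have hcs : ∀ x : ℕ, c (x + 1) - c x = -(μ * s (x + 1)) := fun x => by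
    simp only [hs, hc, hμ']
    push_cast
    rw [show θ * ((x : ℝ) + 1 + 1 / 2) = θ * (x + 1) + θ / 2 by ring,
      show θ * ((x : ℝ) + 1 / 2) = θ * (x + 1) - θ / 2 by ring, Real.cos_add, Real.cos_sub]
    ring
  have hS : sineMode n j R = fun t => 1 / ((n : ℝ) + 1) *
      ∑ x ∈ Finset.range n, s (x + 1) * R (x + 1) t := by
    ext t
    rw [sineMode, Finset.sum_range_succ', h.r_left, mul_zero, add_zero]
  have hC : cosineMode n j Q = fun t => 1 / ((n : ℝ) + 1) *
      ∑ x ∈ Finset.range (n + 1), c x * Q x t := rfl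
  constructor
  · rw [hS]
    have hd : HasDerivAt (fun t => ∑ x ∈ Finset.range n, s (x + 1) * R (x + 1) t)
        (∑ x ∈ Finset.range n, s (x + 1) * (Q (x + 1) t - Q x t)) t :=
      HasDerivAt.fun_sum fun x hx => (h.deriv_r x (Finset.mem_range.1 hx) t ht).const_mul _
    refine (hd.const_mul _).congr_deriv ?_
    have e : ∀ m : ℕ, (∑ x ∈ Finset.range m, s (x + 1) * (Q (x + 1) t - Q x t)) +
        μ * ∑ x ∈ Finset.range (m + 1), c x * Q x t = s (m + 1) * Q m t := by
      intro m
      induction m with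
      | zero =>
        have := hsc 0
        rw [hs0] at this
        simp only [Finset.sum_range_zero, zero_add, Finset.sum_range_one]
        linear_combination (-Q 0 t) * this
      | succ m ih =>
        rw [Finset.sum_range_succ, Finset.sum_range_succ _ (m + 1)]
        linear_combination ih - Q (m + 1) t * hsc (m + 1)
    have := e n
    rw [hsN] at this
    simp only [hC]
    linear_combination (1 / ((n : ℝ) + 1)) * this
  · rw [hC]
    have hd : HasDerivAt (fun t => ∑ x ∈ Finset.range (n + 1), c x * Q x t)
        (∑ x ∈ Finset.range (n + 1), c x * (R (x + 1) t - R x t - 2 * γ * Q x t)) t :=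
      HasDerivAt.fun_sum fun x hx =>
        (h.deriv_p x (by have := Finset.mem_range.1 hx; omega) t ht).const_mul _
    refine (hd.const_mul _).congr_deriv ?_
    have e : ∀ m : ℕ, (∑ x ∈ Finset.range (m + 1), c x * (R (x + 1) t - R x t - 2 * γ * Q x t)) =
        μ * (∑ x ∈ Finset.range m, s (x + 1) * R (x + 1) t) -
        2 * γ * (∑ x ∈ Finset.range (m + 1), c x * Q x t) + c m * R (m + 1) t := by
      intro m
      induction m with
      | zero =>
        simp only [Finset.sum_range_zero, zero_add, Finset.sum_range_one, h.r_left]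
        ring
      | succ m ih =>
        rw [Finset.sum_range_succ, ih, Finset.sum_range_succ (fun x => s (x + 1) * R (x + 1) t) m,
          Finset.sum_range_succ (fun x => c x * Q x t) (m + 1)]
        linear_combination (-R (m + 1) t) * hcs m
    rw [e n, h.r_right, hS]
    simp only [modeForce, hc, hθ]
    ring

/-- The variation of constants formula for the `j`-th mode. -/
lemma sineMode_formula (hγ : 0 < γ) (j : ℕ) {t : ℝ} (ht : 0 ≤ t) {ν : ℝ}
    (hν : ν = (modeFreq n j) ^ 2 / (2 * γ)) :
    sineMode n j R t - modeFreq n j / (2 * γ) * cosineMode n j Q t =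
      Real.exp (-(ν * t)) * (sineMode n j R 0 - modeFreq n j / (2 * γ) * cosineMode n j Q 0) -
      ∫ s in (0 : ℝ)..t, Real.exp (-(ν * (t - s))) *
        (ν * (modeFreq n j / (2 * γ)) * cosineMode n j Q s +
          modeFreq n j * modeForce n j / (2 * γ) * F s) := by
  set μ := modeFreq n j
  have hexp : Continuous fun s : ℝ => Real.exp (ν * s) := by fun_prop
  have key := integral_eq_sub_of_hasDerivAt_Ici
    -- The combination removes the fast momentum mode to leading order. It relaxes at rate `ν = μ² /
    -- (2γ)`, with a remaining momentum term whose coefficient `ν μ / (2γ)` is of order `n⁻³`.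
    (f := fun s => Real.exp (ν * s) * (sineMode n j R s - μ / (2 * γ) * cosineMode n j Q s))
    (f' := fun s => -(Real.exp (ν * s) * (ν * (μ / (2 * γ)) * cosineMode n j Q s +
          μ * modeForce n j / (2 * γ) * F s))) ?_ ?_ ?_ ht
  · have e : ∀ s, Real.exp (-(ν * (t - s))) = Real.exp (-(ν * t)) * Real.exp (ν * s) := fun s => by
      rw [← Real.exp_add]; ring_nf
    simp only [e, mul_assoc (Real.exp (-(ν * t)))]
    rw [intervalIntegral.integral_const_mul]
    rw [intervalIntegral.integral_neg] at key
    have e2 : Real.exp (-(ν * t)) * Real.exp (ν * t) = 1 := by rw [← Real.exp_add]; simp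
    simp only [mul_zero, Real.exp_zero, one_mul] at key
    linear_combination (-Real.exp (-(ν * t))) * key -
      (sineMode n j R t - μ / (2 * γ) * cosineMode n j Q t) * e2
  · exact hexp.continuousOn.mul ((h.continuousOn_sineMode j).sub
      ((h.continuousOn_cosineMode j).const_mul _))
  · exact (hexp.continuousOn.mul (((h.continuousOn_cosineMode j).const_mul _).add
      (h.continuousOn_force.const_mul _))).neg
  · intro s hs
    obtain ⟨h1, h2⟩ := h.hasDerivAt_modes j hs
    have h3 : HasDerivAt (fun s : ℝ => Real.exp (ν * s)) (Real.exp (ν * s) * ν) s := by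
      simpa using ((hasDerivAt_id s).const_mul ν).exp
    refine (h3.mul (h1.sub (h2.const_mul (μ / (2 * γ))))).congr_deriv ?_
    simp only [Pi.sub_apply]
    rw [hν]
    field_simp
    ring

end IsMeanChain

end HarmonicChain

namespace HarmonicChain

/-! ### The diffusive limit of the sine modes -/

lemma integral_exp_neg_mul_sub {ν : ℝ} (hν : ν ≠ 0) (t : ℝ) :
    ∫ s in (0 : ℝ)..t, Real.exp (-(ν * (t - s))) = (1 - Real.exp (-(ν * t))) / ν := by
  have h : ∀ s ∈ uIcc 0 t, HasDerivAt (fun s => Real.exp (-(ν * (t - s))) / ν)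
      (Real.exp (-(ν * (t - s)))) s := fun s _ => by
    have h1 : HasDerivAt (fun s : ℝ => -(ν * (t - s))) ν s := by
      exact (((hasDerivAt_id s).const_sub t).const_mul ν).fun_neg.congr_deriv (by ring)
    refine (h1.exp.div_const ν).congr_deriv ?_
    field_simp
  rw [intervalIntegral.integral_eq_sub_of_hasDerivAt h
    (by fun_prop : Continuous fun s => Real.exp (-(ν * (t - s)))).continuousOn.intervalIntegrable]
  simp
  ring

namespace IsMeanChainFamily

variable {γ Fbar A H : ℝ} {f : ℝ → ℝ} {R Q : ℕ → ℕ → ℝ → ℝ}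
  (h : IsMeanChainFamily γ Fbar A H f R Q)

include h

lemma exists_cosineMode_bound {τ : ℝ} (hτ : 0 ≤ τ) : ∃ B, 0 ≤ B ∧ ∀ n : ℕ, 1 ≤ n → ∀ (j : ℕ) (t : ℝ),
    0 ≤ t → t ≤ n ^ 2 * τ → |cosineMode n j (Q n) t| ≤ B := by
  obtain ⟨C, hC, hb⟩ := h.exists_bound hτ
  refine ⟨1 + C / 2, by positivity, fun n hn j t ht htτ => ?_⟩
  refine (abs_cosineMode_le n j (R n) (Q n) t).trans ?_
  have h1 := (hb n hn t ht htτ).1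
  rw [one_div_mul_eq_div, div_le_iff₀ (by positivity)]
  nlinarith

/-- The difference between a mode and the solution of its limit equation. -/
lemma exists_mode_error {t : ℝ} (ht : 0 ≤ t) (j : ℕ) : ∃ B, 0 ≤ B ∧ ∀ n : ℕ, 1 ≤ n →
    modeFreq n j ≠ 0 →
    |sineMode n j (R n) (n ^ 2 * t) -
      (Real.exp (-((modeFreq n j) ^ 2 / (2 * γ) * (n ^ 2 * t))) * sineMode n j (R n) 0 -
        Fbar * (modeForce n j / modeFreq n j) *
          (1 - Real.exp (-((modeFreq n j) ^ 2 / (2 * γ) * (n ^ 2 * t)))))| ≤ B / √(n : ℝ) := by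
  obtain ⟨B, hB, hb⟩ := h.exists_cosineMode_bound ht
  have hγ := h.pos
  have hA0 : 0 ≤ A := (abs_nonneg _).trans (h.bound 0)
  set M : ℝ := Real.pi * j with hM
  have hM0 : 0 ≤ M := by positivity
  refine ⟨M * B / γ + t * M ^ 3 * B / (4 * γ ^ 2) + t * M * A / (2 * γ), by positivity,
    fun n hn hμ0 => ?_⟩
  have hn1 : (1 : ℝ) ≤ n := by exact_mod_cast hn
  have hn0 : (0 : ℝ) < n := by linarith
  have hs0 : 0 < √(n : ℝ) := Real.sqrt_pos.2 hn0
  have hsn : √(n : ℝ) ≤ n := by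
    rw [Real.sqrt_le_left hn0.le]; nlinarith
  set T : ℝ := n ^ 2 * t with hT
  have hT0 : 0 ≤ T := by positivity
  set μ := modeFreq n j with hμ
  set κ := modeForce n j with hκ
  set ν := μ ^ 2 / (2 * γ) with hν
  have hν0 : 0 < ν := by positivity
  have hμn : |μ| ≤ M / n := by
    refine (abs_modeFreq_le n j).trans ?_
    gcongr
    linarith
  have hκn : |κ| ≤ 1 / n := by
    refine (abs_modeForce_le n j).trans ?_
    gcongr
    linarith
  have hch := h.chain n hn
  have key := hch.sineMode_formula hγ j hT0 hν
  have hbT := hb n hn j T hT0 le_rfl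
  have hb0 := hb n hn j 0 le_rfl hT0
  have hexp : Continuous fun s : ℝ => Real.exp (-(ν * (T - s))) := by fun_prop
  -- Everything in the integrand except the constant force. With `μ` and `κ` of order `1/n`, over a
  -- time `n² t` the momentum part contributes `O(1/n)` and the oscillating force `O(1/√n)`.
  set g : ℝ → ℝ := fun s => ν * (μ / (2 * γ)) * cosineMode n j (Q n) s +
      μ * κ / (2 * γ) * (1 / √(n : ℝ) * f s) with hg
  have hgc : ContinuousOn (fun s => Real.exp (-(ν * (T - s))) * g s) (Ici 0) := by
    have h1 := hch.continuousOn_cosineMode j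
    have h2 := h.cont.continuousOn (s := Ici 0)
    exact hexp.continuousOn.mul ((h1.const_mul _).add ((h2.const_mul _).const_mul _))
  -- The constant force integrates exactly: `μ κ / (2γ) · F̄ / ν = F̄ κ / μ`.
  have hsplit : ∫ s in (0 : ℝ)..T, Real.exp (-(ν * (T - s))) *
        (ν * (μ / (2 * γ)) * cosineMode n j (Q n) s +
          μ * κ / (2 * γ) * (Fbar + 1 / √(n : ℝ) * f s)) =
      Fbar * (κ / μ) * (1 - Real.exp (-(ν * T))) +
        ∫ s in (0 : ℝ)..T, Real.exp (-(ν * (T - s))) * g s := by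
    have e : ∀ s, Real.exp (-(ν * (T - s))) * (ν * (μ / (2 * γ)) * cosineMode n j (Q n) s +
          μ * κ / (2 * γ) * (Fbar + 1 / √(n : ℝ) * f s)) =
        μ * κ / (2 * γ) * Fbar * Real.exp (-(ν * (T - s))) + Real.exp (-(ν * (T - s))) * g s :=
      fun s => by simp only [hg]; ring
    simp only [e]
    rw [intervalIntegral.integral_add ((hexp.const_mul _).intervalIntegrable _ _)
      (intervalIntegrable_of_continuousOn_Ici hgc le_rfl hT0),
      intervalIntegral.integral_const_mul, integral_exp_neg_mul_sub hν0.ne']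
    congr 1
    rw [hν]
    field_simp
  have hgb : ∀ s, 0 ≤ s → s ≤ T → |g s| ≤
      (M / n) ^ 2 / (2 * γ) * (M / n / (2 * γ)) * B +
        M / n * (1 / n) / (2 * γ) * (1 / √(n : ℝ) * A) := by
    intro s hs hsT
    have p1 := hb n hn j s hs hsT
    have p2 := h.bound s
    simp only [hg]
    refine (abs_add_le _ _).trans ?_
    have e1 : |ν * (μ / (2 * γ)) * cosineMode n j (Q n) s| =
        |μ| ^ 2 / (2 * γ) * (|μ| / (2 * γ)) * |cosineMode n j (Q n) s| := by
      rw [abs_mul, abs_mul, abs_div, abs_of_pos (by positivity : 0 < 2 * γ), abs_pow, abs_div μ,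
        abs_of_pos (by positivity : 0 < 2 * γ)]
    have e2 : |μ * κ / (2 * γ) * (1 / √(n : ℝ) * f s)| =
        |μ| * |κ| / (2 * γ) * (1 / √(n : ℝ) * |f s|) := by
      rw [abs_mul, abs_div, abs_of_pos (by positivity : 0 < 2 * γ), abs_mul μ, abs_mul _ (f s),
        abs_of_pos (by positivity : 0 < 1 / √(n : ℝ))]
    rw [e1, e2]
    gcongr
  have hI : |∫ s in (0 : ℝ)..T, Real.exp (-(ν * (T - s))) * g s| ≤
      ((M / n) ^ 2 / (2 * γ) * (M / n / (2 * γ)) * B +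
        M / n * (1 / n) / (2 * γ) * (1 / √(n : ℝ) * A)) * T := by
    have := intervalIntegral.norm_integral_le_of_norm_le_const (a := 0) (b := T)
      (f := fun s => Real.exp (-(ν * (T - s))) * g s)
      (C := (M / n) ^ 2 / (2 * γ) * (M / n / (2 * γ)) * B +
        M / n * (1 / n) / (2 * γ) * (1 / √(n : ℝ) * A)) fun s hs => ?_
    · rwa [sub_zero, abs_of_nonneg hT0, Real.norm_eq_abs] at this
    · rw [uIoc_of_le hT0] at hs
      rw [Real.norm_eq_abs, abs_mul, Real.abs_exp]
      refine le_trans ?_ (hgb s hs.1.le hs.2)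
      refine mul_le_of_le_one_left (abs_nonneg _) (Real.exp_le_one_iff.2 ?_)
      have := mul_nonneg hν0.le (sub_nonneg.2 hs.2)
      linarith
  rw [hsplit] at key
  have e : sineMode n j (R n) T - (Real.exp (-(ν * T)) * sineMode n j (R n) 0 -
        Fbar * (κ / μ) * (1 - Real.exp (-(ν * T)))) =
      μ / (2 * γ) * cosineMode n j (Q n) T -
        Real.exp (-(ν * T)) * (μ / (2 * γ) * cosineMode n j (Q n) 0) -
        ∫ s in (0 : ℝ)..T, Real.exp (-(ν * (T - s))) * g s := by
    linear_combination key
  rw [e]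
  have q1 : |μ / (2 * γ) * cosineMode n j (Q n) T| ≤ M / n / (2 * γ) * B := by
    rw [abs_mul, abs_div, abs_of_pos (by positivity : 0 < 2 * γ)]
    gcongr
  have q2 : |Real.exp (-(ν * T)) * (μ / (2 * γ) * cosineMode n j (Q n) 0)| ≤
      M / n / (2 * γ) * B := by
    rw [abs_mul, abs_mul, abs_div, abs_of_pos (by positivity : 0 < 2 * γ), Real.abs_exp]
    have : Real.exp (-(ν * T)) ≤ 1 := Real.exp_le_one_iff.2 (by
      have := mul_nonneg hν0.le hT0; linarith)
    calc _ ≤ 1 * (M / n / (2 * γ) * B) := by gcongr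
      _ = _ := one_mul _
  refine (abs_sub _ _).trans ((add_le_add ((abs_sub _ _).trans (add_le_add q1 q2)) hI).trans ?_)
  have e3 : M / n / (2 * γ) * B + M / n / (2 * γ) * B +
      ((M / n) ^ 2 / (2 * γ) * (M / n / (2 * γ)) * B +
        M / n * (1 / n) / (2 * γ) * (1 / √(n : ℝ) * A)) * T =
      (M * B / γ + t * M ^ 3 * B / (4 * γ ^ 2)) / n + t * M * A / (2 * γ) / √(n : ℝ) := by
    rw [hT]
    field_simp
    ring
  rw [e3, add_div _ (t * M * A / (2 * γ))]
  gcongr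

/-- `(n + 1) μ → πj` turns the rate `ν n²` into that of the heat equation, and `κ / μ → (-1)^j /
(πj)` yields the stationary profile, while the mode error is `O(1/√n)`. -/
theorem tendsto_sineMode {j : ℕ} (hj : 0 < j) {a : ℝ}
    (ha : Tendsto (fun n => sineMode n j (R n) 0) atTop (𝓝 a)) {t : ℝ} (ht : 0 ≤ t) :
    Tendsto (fun n : ℕ => sineMode n j (R n) (n ^ 2 * t)) atTop
      (𝓝 (Real.exp (-((Real.pi * j) ^ 2 / (2 * γ) * t)) * a - Fbar * ((-1) ^ j / (Real.pi * j)) *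
        (1 - Real.exp (-((Real.pi * j) ^ 2 / (2 * γ) * t))))) := by
  obtain ⟨B, hB, hb⟩ := h.exists_mode_error ht j
  have hj' : 0 < Real.pi * j := by positivity
  have hsq : Tendsto (fun n : ℕ => (modeFreq n j) ^ 2 / (2 * γ) * (n ^ 2 * t)) atTop
      (𝓝 ((Real.pi * j) ^ 2 / (2 * γ) * t)) := by
    have h1 : Tendsto (fun n : ℕ => (n : ℝ) / ((n : ℝ) + 1)) atTop (𝓝 1) :=
      tendsto_natCast_div_add_atTop 1
    have h2 := ((((tendsto_mul_modeFreq j).mul h1).pow 2).div_const (2 * γ)).mul_const t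
    rw [mul_one] at h2
    refine h2.congr fun n => ?_
    have : (n : ℝ) + 1 ≠ 0 := by positivity
    field_simp
  have hexp := (Real.continuous_exp.tendsto _).comp hsq.neg
  have hmain := (hexp.mul ha).sub (((tendsto_modeForce_div j hj).const_mul Fbar).mul
    (hexp.const_sub 1))
  have herr : Tendsto (fun n : ℕ => sineMode n j (R n) (n ^ 2 * t) -
      (Real.exp (-((modeFreq n j) ^ 2 / (2 * γ) * (n ^ 2 * t))) * sineMode n j (R n) 0 -
        Fbar * (modeForce n j / modeFreq n j) *
          (1 - Real.exp (-((modeFreq n j) ^ 2 / (2 * γ) * (n ^ 2 * t)))))) atTop (𝓝 0) := by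
    have hlim : Tendsto (fun n : ℕ => B / √(n : ℝ)) atTop (𝓝 0) :=
      (Real.tendsto_sqrt_atTop.comp tendsto_natCast_atTop_atTop).const_div_atTop B
    refine squeeze_zero_norm' ?_ hlim
    have hne : ∀ᶠ n : ℕ in atTop, ((n : ℝ) + 1) * modeFreq n j ≠ 0 :=
      (tendsto_mul_modeFreq j).eventually_ne hj'.ne'
    filter_upwards [eventually_ge_atTop 1, hne] with n hn hμ
    exact hb n hn (right_ne_zero_of_mul hμ)
  have := herr.add hmain
  rw [zero_add] at this
  refine this.congr fun n => ?_
  simp only [Function.comp_apply]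
  ring

end IsMeanChainFamily

end HarmonicChain

/-! ### From modes to weighted averages, and the limiting current. -/

namespace HarmonicChain

/-! ### Sine series on the unit interval -/

/-- The sine coefficient `∫₀¹ sin(πju) f(u) du`. -/
noncomputable def sineCoeff (f : ℝ → ℝ) (j : ℕ) : ℝ :=
  ∫ u in (0 : ℝ)..1, Real.sin (Real.pi * j * u) * f u

@[simp] lemma sineCoeff_zero_right (f : ℝ → ℝ) : sineCoeff f 0 = 0 := by simp [sineCoeff]

lemma sineCoeff_add {f g : ℝ → ℝ} (hf : Continuous f) (hg : Continuous g) (j : ℕ) :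
    sineCoeff (fun u => f u + g u) j = sineCoeff f j + sineCoeff g j := by
  unfold sineCoeff
  rw [← intervalIntegral.integral_add (Continuous.intervalIntegrable (by fun_prop) _ _)
    (Continuous.intervalIntegrable (by fun_prop) _ _)]
  simp only [mul_add]

lemma sineCoeff_sub {f g : ℝ → ℝ} (hf : Continuous f) (hg : Continuous g) (j : ℕ) :
    sineCoeff (fun u => f u - g u) j = sineCoeff f j - sineCoeff g j := by
  unfold sineCoeff
  rw [← intervalIntegral.integral_sub (Continuous.intervalIntegrable (by fun_prop) _ _)
    (Continuous.intervalIntegrable (by fun_prop) _ _)]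
  simp only [mul_sub]

lemma sineCoeff_const_mul (c : ℝ) (f : ℝ → ℝ) (j : ℕ) :
    sineCoeff (fun u => c * f u) j = c * sineCoeff f j := by
  unfold sineCoeff
  rw [← intervalIntegral.integral_const_mul]
  congr 1
  ext u
  ring

/-- The integral of an even multiple of the odd extension. -/
lemma integral_oddExtension {f : ℝ → ℝ} (hf : Continuous f) {k : ℝ → ℝ → ℂ}
    (hk : Continuous (fun q : ℝ × ℝ => k q.1 q.2)) :
    IntervalIntegrable (fun x => k x (if 0 < x then f x else -f (-x))) volume (-1) 1 ∧
    ∫ x in (-1 : ℝ)..1, k x (if 0 < x then f x else -f (-x)) =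
      ∫ x in (0 : ℝ)..1, (k x (f x) + k (-x) (-f x)) := by
  have hk1 : Continuous fun x => k x (f x) := hk.comp (by fun_prop : Continuous fun x => (x, f x))
  have hk2 : Continuous fun x => k x (-f (-x)) :=
    hk.comp (by fun_prop : Continuous fun x => (x, -f (-x)))
  have hk3 : Continuous fun x => k (-x) (-f x) :=
    hk.comp (by fun_prop : Continuous fun x => (-x, -f x))
  have e1 : EqOn (fun x => k x (-f (-x)))
      (fun x => k x (if 0 < x then f x else -f (-x))) (uIoc (-1) 0) := fun x hx => by
    rw [uIoc_of_le (by norm_num)] at hx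
    simp [not_lt.2 hx.2]
  have e2 : EqOn (fun x => k x (f x))
      (fun x => k x (if 0 < x then f x else -f (-x))) (uIoc 0 1) := fun x hx => by
    rw [uIoc_of_le (by norm_num)] at hx
    simp [hx.1]
  have i1 := (hk2.intervalIntegrable (μ := volume) (-1) 0).congr e1
  have i2 := (hk1.intervalIntegrable (μ := volume) 0 1).congr e2
  refine ⟨i1.trans i2, ?_⟩
  rw [← intervalIntegral.integral_add_adjacent_intervals i1 i2,
    intervalIntegral.integral_add (hk1.intervalIntegrable _ _) (hk3.intervalIntegrable _ _),
    add_comm]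
  congr 1
  · exact (intervalIntegral.integral_congr_ae (ae_of_all _ fun x hx => (e2 hx))).symm
  · rw [← intervalIntegral.integral_congr_ae (ae_of_all _ fun x hx => (e1 hx))]
    have := intervalIntegral.integral_comp_neg (a := 0) (b := 1) fun x => k x (-f (-x))
    simp only [neg_neg, neg_zero] at this
    exact this.symm

/-- Parseval's identity for the sine series. -/
theorem hasSum_sq_sineCoeff {f : ℝ → ℝ} (hf : Continuous f) :
    HasSum (fun j => 2 * sineCoeff f j ^ 2) (∫ u in (0 : ℝ)..1, f u ^ 2) := by
  set g : ℝ → ℝ := fun x => if 0 < x then f x else -f (-x) with hg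
  have hlt : (-1 : ℝ) < 1 := by norm_num
  have hgm : Measurable g :=
    Measurable.ite measurableSet_Ioi hf.measurable (by fun_prop)
  obtain ⟨C, hC⟩ := (isCompact_Icc (a := (-1 : ℝ)) (b := 1)).exists_bound_of_continuousOn
    hf.continuousOn
  have hL : MemLp (fun x => (g x : ℂ)) 2 (volume.restrict (Ioc (-1 : ℝ) 1)) := by
    refine MemLp.of_bound (by fun_prop) C ((ae_restrict_iff' measurableSet_Ioc).2
      (ae_of_all _ fun x hx => ?_))
    rw [Complex.norm_real]
    simp only [hg]
    split_ifs with h0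
    · exact hC x ⟨hx.1.le, hx.2⟩
    · rw [norm_neg]
      exact hC (-x) ⟨by linarith [hx.2], by linarith [hx.1]⟩
  have key := hasSum_sq_fourierCoeffOn hlt hL
  -- For the odd extension to `(-1, 1]` only the sine part survives, so Parseval for Fourier series
  -- becomes Parseval for sines.
  have hcoef : ∀ n : ℤ, fourierCoeffOn hlt (fun x => (g x : ℂ)) n =
      -Complex.I * ((∫ u in (0 : ℝ)..1, Real.sin (Real.pi * n * u) * f u : ℝ) : ℂ) := by
    intro n
    rw [fourierCoeffOn_eq_integral]
    have h1 := (integral_oddExtension hf (k := fun x y =>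
      Complex.exp (-(Complex.I * Real.pi * n * x)) * y) (by fun_prop)).2
    have h2 : ∀ x : ℝ, fourier (-n) (x : AddCircle ((1 : ℝ) - -1)) • (g x : ℂ) =
        Complex.exp (-(Complex.I * Real.pi * n * x)) *
          ((if 0 < x then f x else -f (-x) : ℝ) : ℂ) := fun x => by
      rw [fourier_coe_apply, smul_eq_mul]
      congr 2
      push_cast
      ring
    simp only [h2, h1]
    rw [← intervalIntegral.integral_ofReal, ← intervalIntegral.integral_const_mul,
      Complex.real_smul, ← intervalIntegral.integral_const_mul]
    congr 1
    ext x
    have e : ∀ y : ℂ, Complex.exp (-(Complex.I * y)) - Complex.exp (Complex.I * y) =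
        -2 * Complex.I * Complex.sin y := fun y => by
      rw [Complex.sin]
      ring_nf
      rw [Complex.I_sq]
      ring
    have := e (Real.pi * n * x)
    push_cast
    have e2 : Complex.exp (-(Complex.I * Real.pi * n * -x)) =
      Complex.exp (Complex.I * (Real.pi * n * x)) := by congr 1; ring
    have e3 : Complex.exp (-(Complex.I * Real.pi * n * x)) =
      Complex.exp (-(Complex.I * (Real.pi * n * x))) := by congr 2; ring
    rw [e2, e3]
    linear_combination (f x / 2) * this
  have hnorm : ∫ x in (-1 : ℝ)..1, ‖(g x : ℂ)‖ ^ 2 = 2 * ∫ u in (0 : ℝ)..1, f u ^ 2 := by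
    have h1 := (integral_oddExtension hf (k := fun _ y => ((y ^ 2 : ℝ) : ℂ)) (by fun_prop)).2
    simp only [neg_sq, ← Complex.ofReal_add, intervalIntegral.integral_ofReal] at h1
    have h2 := Complex.ofReal_injective h1
    rw [← intervalIntegral.integral_const_mul]
    refine Eq.trans ?_ (h2.trans ?_)
    · simp only [Complex.norm_real, Real.norm_eq_abs, sq_abs, hg]
    · simp only [two_mul]
  rw [hnorm] at key
  simp only [hcoef, norm_mul, norm_neg, Complex.norm_I, one_mul, Complex.norm_real,
    Real.norm_eq_abs, sq_abs] at key
  -- Opposite frequencies have equal squared coefficients, whence the factor `2`; the coefficient at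
  -- `0` vanishes, so counting it twice is harmless.
  have h3 := key.nat_add_neg
  have e0 : (∫ u in (0 : ℝ)..1, Real.sin (Real.pi * (0 : ℤ) * u) * f u) = 0 := by simp
  rw [e0] at h3
  convert! h3 using 1
  · ext j
    have : ∫ u in (0 : ℝ)..1, Real.sin (Real.pi * ((-(j : ℤ) : ℤ) : ℝ) * u) * f u =
        -sineCoeff f j := by
      rw [sineCoeff, ← intervalIntegral.integral_neg]
      congr 1
      ext u
      push_cast
      rw [show Real.pi * -(j : ℝ) * u = -(Real.pi * j * u) by ring, Real.sin_neg]
      ring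
    rw [this]
    simp only [Int.cast_natCast]
    rw [← sineCoeff]
    ring
  · norm_num
    ring

/-- Polarisation of Parseval's identity. -/
theorem hasSum_mul_sineCoeff {f g : ℝ → ℝ} (hf : Continuous f) (hg : Continuous g) :
    HasSum (fun j => 2 * sineCoeff f j * sineCoeff g j) (∫ u in (0 : ℝ)..1, f u * g u) := by
  have h1 := hasSum_sq_sineCoeff (f := fun u => f u + g u) (hf.add hg)
  have h2 := hasSum_sq_sineCoeff (f := fun u => f u - g u) (hf.sub hg)
  convert! (h1.sub h2).div_const 4 using 1
  · ext j
    rw [sineCoeff_add hf hg, sineCoeff_sub hf hg]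
    ring
  · rw [← intervalIntegral.integral_sub (Continuous.intervalIntegrable (by fun_prop) _ _)
      (Continuous.intervalIntegrable (by fun_prop) _ _), ← intervalIntegral.integral_div]
    congr 1
    ext u
    ring

lemma summable_abs_mul_sineCoeff {f g : ℝ → ℝ} (hf : Continuous f) (hg : Continuous g) :
    Summable fun j => |sineCoeff f j * sineCoeff g j| := by
  have := ((hasSum_mul_sineCoeff hf hg).summable.div_const 2).abs
  refine this.congr fun j => ?_
  congr 1
  ring

/-- A continuous function is determined on `[0,1]` by its sine coefficients. -/
lemma eqOn_of_sineCoeff_eq {f g : ℝ → ℝ} (hf : Continuous f) (hg : Continuous g)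
    (h : ∀ j, sineCoeff f j = sineCoeff g j) : EqOn f g (Icc 0 1) := by
  have h1 := hasSum_sq_sineCoeff (f := fun u => f u - g u) (hf.sub hg)
  simp only [sineCoeff_sub hf hg, h, sub_self] at h1
  have h2 : ∫ u in (0 : ℝ)..1, (f u - g u) ^ 2 = 0 := by
    simpa using h1.unique (by simp)
  intro u hu
  by_contra hne
  have hc : Continuous fun u => (f u - g u) ^ 2 := by fun_prop
  have : 0 < ∫ u in (0 : ℝ)..1, (f u - g u) ^ 2 :=
    intervalIntegral.integral_pos zero_lt_one hc.continuousOn (fun _ _ => sq_nonneg _)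
      ⟨u, hu, by have := sub_ne_zero.2 hne; positivity⟩
  exact this.ne' h2

lemma integral_cos_mode {m : ℝ} (hm : m ≠ 0) (hm' : Real.sin (Real.pi * m) = 0) :
    ∫ u in (0 : ℝ)..1, Real.cos (Real.pi * m * u) = 0 := by
  have hne : Real.pi * m ≠ 0 := mul_ne_zero Real.pi_ne_zero hm
  rw [intervalIntegral.integral_comp_mul_left _ hne]
  simp [hm']

lemma integral_sin_mul_sin_of_ne {j k : ℕ} (hjk : j ≠ k) :
    ∫ u in (0 : ℝ)..1, Real.sin (Real.pi * j * u) * Real.sin (Real.pi * k * u) = 0 := by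
  have h : ∀ u : ℝ, Real.sin (Real.pi * j * u) * Real.sin (Real.pi * k * u) =
      (1 / 2) * Real.cos (Real.pi * ((j : ℝ) - k) * u) -
        (1 / 2) * Real.cos (Real.pi * ((j : ℝ) + k) * u) := fun u => by
    rw [show Real.pi * ((j : ℝ) - k) * u = Real.pi * j * u - Real.pi * k * u by ring,
      show Real.pi * ((j : ℝ) + k) * u = Real.pi * j * u + Real.pi * k * u by ring,
      Real.cos_sub, Real.cos_add]
    ring
  simp only [h]
  rw [intervalIntegral.integral_sub (Continuous.intervalIntegrable (by fun_prop) _ _)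
    (Continuous.intervalIntegrable (by fun_prop) _ _), intervalIntegral.integral_const_mul,
    intervalIntegral.integral_const_mul, integral_cos_mode, integral_cos_mode]
  · ring
  · exact_mod_cast (by omega : j + k ≠ 0)
  · rw [mul_comm]
    exact_mod_cast Real.sin_nat_mul_pi (j + k)
  · exact sub_ne_zero.2 (by exact_mod_cast hjk)
  · rw [mul_comm]
    exact_mod_cast Real.sin_int_mul_pi ((j : ℤ) - k)

lemma integral_sin_sq_mode {j : ℕ} (hj : 0 < j) :
    ∫ u in (0 : ℝ)..1, Real.sin (Real.pi * j * u) ^ 2 = 1 / 2 := by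
  have h : ∀ u : ℝ, Real.sin (Real.pi * j * u) ^ 2 =
      1 / 2 - (1 / 2) * Real.cos (Real.pi * (2 * (j : ℝ)) * u) := fun u => by
    rw [show Real.pi * (2 * (j : ℝ)) * u = 2 * (Real.pi * j * u) by ring, Real.cos_two_mul,
      Real.cos_sq']
    ring
  simp only [h]
  rw [intervalIntegral.integral_sub (by simp)
    (Continuous.intervalIntegrable (by fun_prop) _ _), intervalIntegral.integral_const_mul,
    integral_cos_mode (by positivity)]
  · simp
  · rw [mul_comm]
    exact_mod_cast Real.sin_nat_mul_pi (2 * j)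

/-- Finite sine sums approximate in mean square. -/
lemma tendsto_sineSum {f : ℝ → ℝ} (hf : Continuous f) :
    Tendsto (fun M => ∫ u in (0 : ℝ)..1,
      (f u - ∑ j ∈ Finset.range M, 2 * sineCoeff f j * Real.sin (Real.pi * j * u)) ^ 2)
      atTop (𝓝 0) := by
  -- By orthogonality each added mode removes exactly `2 c²` from the squared error, so Parseval
  -- forces the error to zero.
  have key : ∀ M, ∫ u in (0 : ℝ)..1,
      (f u - ∑ j ∈ Finset.range M, 2 * sineCoeff f j * Real.sin (Real.pi * j * u)) ^ 2 =
      (∫ u in (0 : ℝ)..1, f u ^ 2) - ∑ j ∈ Finset.range M, 2 * sineCoeff f j ^ 2 := by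
    intro M
    induction M with
    | zero => simp
    | succ M ih =>
      set S : ℝ → ℝ := fun u =>
        f u - ∑ j ∈ Finset.range M, 2 * sineCoeff f j * Real.sin (Real.pi * j * u) with hS
      have hSc : Continuous S := by fun_prop
      set c := sineCoeff f M with hc
      have hSM : ∫ u in (0 : ℝ)..1, Real.sin (Real.pi * M * u) * S u = c := by
        have h0 : ∀ u, Real.sin (Real.pi * M * u) * S u = Real.sin (Real.pi * M * u) * f u -
            ∑ j ∈ Finset.range M, 2 * sineCoeff f j *
              (Real.sin (Real.pi * M * u) * Real.sin (Real.pi * j * u)) := fun u => by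
          simp only [hS, mul_sub, Finset.mul_sum]
          congr 1
          exact Finset.sum_congr rfl fun j _ => by ring
        simp only [h0]
        rw [intervalIntegral.integral_sub (Continuous.intervalIntegrable (by fun_prop) _ _)
          (Continuous.intervalIntegrable (by fun_prop) _ _),
          intervalIntegral.integral_finsetSum fun j _ =>
            Continuous.intervalIntegrable (by fun_prop) _ _, Finset.sum_eq_zero, sub_zero, hc,
          sineCoeff]
        intro j hj
        rw [intervalIntegral.integral_const_mul,
          integral_sin_mul_sin_of_ne (Finset.mem_range.1 hj).ne', mul_zero]
      have h1 : ∀ u, (f u - ∑ j ∈ Finset.range (M + 1),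
          2 * sineCoeff f j * Real.sin (Real.pi * j * u)) ^ 2 =
          S u ^ 2 - 4 * c * (Real.sin (Real.pi * M * u) * S u) +
            4 * c ^ 2 * Real.sin (Real.pi * M * u) ^ 2 := fun u => by
        rw [Finset.sum_range_succ]
        simp only [hS]
        ring
      simp only [h1]
      rw [intervalIntegral.integral_add (Continuous.intervalIntegrable (by fun_prop) _ _)
          (Continuous.intervalIntegrable (by fun_prop) _ _),
        intervalIntegral.integral_sub (Continuous.intervalIntegrable (by fun_prop) _ _)
          (Continuous.intervalIntegrable (by fun_prop) _ _),
        intervalIntegral.integral_const_mul, intervalIntegral.integral_const_mul, hSM, ih,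
        Finset.sum_range_succ]
      rcases Nat.eq_zero_or_pos M with rfl | hM
      · simp [hc]
      · rw [integral_sin_sq_mode hM]
        ring
  simp only [key]
  have := (hasSum_sq_sineCoeff hf).tendsto_sum_nat
  have h0 := this.const_sub (∫ u in (0 : ℝ)..1, f u ^ 2)
  rwa [sub_self] at h0

end HarmonicChain

namespace HarmonicChain

/-! ### Riemann sums and the limit of the first moment -/

/-- Riemann sums of a continuous function. -/
theorem tendsto_riemannSum {g : ℝ → ℝ} (hg : Continuous g) :
    Tendsto (fun n : ℕ => 1 / ((n : ℝ) + 1) * ∑ x ∈ Finset.range (n + 1), g (x / ((n : ℝ) + 1)))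
      atTop (𝓝 (∫ u in (0 : ℝ)..1, g u)) := by
  rw [Metric.tendsto_atTop]
  intro ε hε
  have huc := isCompact_Icc.uniformContinuousOn_of_continuous (hg.continuousOn (s := Icc (0 : ℝ) 1))
  obtain ⟨δ, hδ, hd⟩ := Metric.uniformContinuousOn_iff.1 huc (ε / 2) (by positivity)
  obtain ⟨n₀, hn₀⟩ := exists_nat_one_div_lt hδ
  refine ⟨n₀, fun n hn => ?_⟩
  have hN : (0 : ℝ) < (n : ℝ) + 1 := by positivity
  have hNδ : 1 / ((n : ℝ) + 1) < δ := lt_of_le_of_lt (by gcongr) hn₀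
  have h1 : ∫ u in (0 : ℝ)..1, g u = ∑ x ∈ Finset.range (n + 1),
      ∫ u in (((x : ℕ) : ℝ) / ((n : ℝ) + 1))..(((x + 1 : ℕ) : ℝ) / ((n : ℝ) + 1)), g u := by
    rw [intervalIntegral.sum_integral_adjacent_intervals fun _ _ => hg.intervalIntegrable _ _]
    simp [hN.ne']
  have hlen : ∀ x : ℕ, ((x + 1 : ℕ) : ℝ) / ((n : ℝ) + 1) - (x : ℝ) / ((n : ℝ) + 1) =
      1 / ((n : ℝ) + 1) := fun x => by push_cast; ring
  rw [h1, Real.dist_eq, Finset.mul_sum, ← Finset.sum_sub_distrib]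
  have h2 : ∀ x ∈ Finset.range (n + 1), |1 / ((n : ℝ) + 1) * g (x / ((n : ℝ) + 1)) -
      ∫ u in (((x : ℕ) : ℝ) / ((n : ℝ) + 1))..(((x + 1 : ℕ) : ℝ) / ((n : ℝ) + 1)), g u| ≤
      ε / 2 * (1 / ((n : ℝ) + 1)) := by
    intro x hx
    have hx' : ((x + 1 : ℕ) : ℝ) ≤ (n : ℝ) + 1 := by
      exact_mod_cast Finset.mem_range.1 hx
    have hle : (x : ℝ) / ((n : ℝ) + 1) ≤ ((x + 1 : ℕ) : ℝ) / ((n : ℝ) + 1) := by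
      gcongr; simp
    have hconst : 1 / ((n : ℝ) + 1) * g (x / ((n : ℝ) + 1)) =
        ∫ u in (((x : ℕ) : ℝ) / ((n : ℝ) + 1))..(((x + 1 : ℕ) : ℝ) / ((n : ℝ) + 1)),
          g (x / ((n : ℝ) + 1)) := by
      rw [intervalIntegral.integral_const, hlen, smul_eq_mul]
    rw [hconst, ← intervalIntegral.integral_sub (by simp) (hg.intervalIntegrable _ _)]
    have := intervalIntegral.norm_integral_le_of_norm_le_const (C := ε / 2)
      (f := fun u => g (x / ((n : ℝ) + 1)) - g u) (a := (x : ℝ) / ((n : ℝ) + 1))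
      (b := ((x + 1 : ℕ) : ℝ) / ((n : ℝ) + 1)) fun u hu => ?_
    · rwa [hlen, abs_of_pos (by positivity)] at this
    · rw [uIoc_of_le hle] at hu
      have hx1 : ((x + 1 : ℕ) : ℝ) / ((n : ℝ) + 1) ≤ 1 := (div_le_one hN).2 hx'
      have hx0 : 0 ≤ (x : ℝ) / ((n : ℝ) + 1) := by positivity
      have := hd _ ⟨hx0, hle.trans hx1⟩ u ⟨hx0.trans hu.1.le, hu.2.trans hx1⟩ (by
        rw [Real.dist_eq, abs_sub_lt_iff]
        have := hlen x
        constructor <;> linarith [hu.1, hu.2])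
      exact (by simpa [Real.dist_eq] using this.le)
  refine lt_of_le_of_lt ((Finset.abs_sum_le_sum_abs _ _).trans (Finset.sum_le_sum h2)) ?_
  rw [Finset.sum_const, Finset.card_range, nsmul_eq_mul]
  have : ((n + 1 : ℕ) : ℝ) * (ε / 2 * (1 / ((n : ℝ) + 1))) = ε / 2 := by
    push_cast; field_simp
  rw [this]
  linarith

/-- The initial sine modes converge to the sine coefficients of the profile. -/
theorem tendsto_sineMode_initial {R : ℕ → ℕ → ℝ → ℝ} {r₀ : ℝ → ℝ} (hr₀ : Continuous r₀)
    (hprofile : Tendsto (fun n : ℕ => (1 / (n : ℝ)) * ∑ x ∈ Finset.Icc 1 n,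
      (R n x 0 - r₀ ((x : ℝ) / n)) ^ 2) atTop (𝓝 0)) (j : ℕ) :
    Tendsto (fun n => sineMode n j (R n) 0) atTop (𝓝 (sineCoeff r₀ j)) := by
  have hR := tendsto_riemannSum (g := fun u => Real.sin (Real.pi * j * u) * r₀ u) (by fun_prop)
  have hsq : Tendsto (fun n : ℕ => √((1 / (n : ℝ)) * ∑ x ∈ Finset.Icc 1 n,
      (R n x 0 - r₀ ((x : ℝ) / n)) ^ 2)) atTop (𝓝 0) := by
    have := (Real.continuous_sqrt.tendsto 0).comp hprofile
    rwa [Real.sqrt_zero] at this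
  have hdiff : Tendsto (fun n : ℕ => sineMode n j (R n) 0 - 1 / ((n : ℝ) + 1) *
      ∑ x ∈ Finset.range (n + 1), Real.sin (Real.pi * j * (x / ((n : ℝ) + 1))) *
        r₀ (x / ((n : ℝ) + 1))) atTop (𝓝 0) := by
    rw [Metric.tendsto_atTop]
    intro ε hε
    have huc := isCompact_Icc.uniformContinuousOn_of_continuous
      (hr₀.continuousOn (s := Icc (0 : ℝ) 1))
    obtain ⟨δ, hδ, hd⟩ := Metric.uniformContinuousOn_iff.1 huc (ε / 2) (by positivity)
    obtain ⟨n₀, hn₀⟩ := exists_nat_one_div_lt hδ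
    obtain ⟨n₁, hn₁⟩ := (Metric.tendsto_atTop.1 hsq) (ε / 2) (by positivity)
    refine ⟨n₀ + n₁ + 1, fun n hn => ?_⟩
    have hn0 : (0 : ℝ) < n := by exact_mod_cast (by omega : 0 < n)
    have hN : (0 : ℝ) < (n : ℝ) + 1 := by positivity
    have hNδ : 1 / ((n : ℝ) + 1) < δ := lt_of_le_of_lt (by
      have : (n₀ : ℝ) ≤ n := by exact_mod_cast (by omega : n₀ ≤ n)
      gcongr) hn₀
    have h1 := hn₁ n (by omega)
    rw [Real.dist_0_eq_abs, abs_of_nonneg (Real.sqrt_nonneg _)] at h1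
    have hrange : ∀ G : ℕ → ℝ, G 0 = 0 →
        ∑ x ∈ Finset.range (n + 1), G x = ∑ x ∈ Finset.Icc 1 n, G x := fun G h0 => by
      rw [Finset.range_eq_Ico, Finset.sum_eq_sum_Ico_succ_bot (by omega), h0, zero_add]
      rfl
    rw [dist_zero_right, sineMode, ← mul_sub, ← Finset.sum_sub_distrib, Real.norm_eq_abs,
      hrange _ (by simp)]
    -- The hypothesis samples the profile at `x / n`, the modes at `x / (n + 1)`. The two points
    -- differ by at most `1 / (n + 1)`, and uniform continuity absorbs the difference.
    have hterm : ∀ x ∈ Finset.Icc 1 n, |Real.sin (Real.pi * j / (n + 1) * x) * R n x 0 -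
        Real.sin (Real.pi * j * (x / ((n : ℝ) + 1))) * r₀ (x / ((n : ℝ) + 1))| ≤
        |R n x 0 - r₀ ((x : ℝ) / n)| + ε / 2 := by
      intro x hx
      rw [Finset.mem_Icc] at hx
      have hxn : (x : ℝ) ≤ n := by exact_mod_cast hx.2
      rw [show Real.pi * j * (x / ((n : ℝ) + 1)) = Real.pi * j / (n + 1) * x by ring, ← mul_sub,
        abs_mul]
      refine (mul_le_of_le_one_left (abs_nonneg _) (Real.abs_sin_le_one _)).trans ?_
      refine (abs_sub_le _ (r₀ ((x : ℝ) / n)) _).trans (add_le_add le_rfl ?_)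
      have hlt : dist ((x : ℝ) / n) (x / ((n : ℝ) + 1)) < δ := by
        rw [Real.dist_eq, abs_of_nonneg (sub_nonneg.2 (by gcongr; linarith))]
        refine lt_of_le_of_lt ?_ hNδ
        rw [div_sub_div _ _ hn0.ne' hN.ne', div_le_div_iff₀ (by positivity) hN]
        nlinarith
      have := hd _ ⟨by positivity, (div_le_one hn0).2 hxn⟩ _
        ⟨by positivity, (div_le_one hN).2 (by linarith)⟩ hlt
      exact this.le
    set D := ∑ x ∈ Finset.Icc 1 n, (R n x 0 - r₀ ((x : ℝ) / n)) ^ 2 with hD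
    have hCS : 1 / ((n : ℝ) + 1) * ∑ x ∈ Finset.Icc 1 n, |R n x 0 - r₀ ((x : ℝ) / n)| ≤
        √(1 / (n : ℝ) * D) := by
      refine Real.le_sqrt_of_sq_le ?_
      have := sq_sum_le_card_mul_sum_sq (s := Finset.Icc 1 n)
        (f := fun x : ℕ => |R n x 0 - r₀ ((x : ℝ) / n)|)
      simp only [sq_abs, Nat.card_Icc, Nat.add_sub_cancel] at this
      rw [← hD] at this
      have hD0 : 0 ≤ D := Finset.sum_nonneg fun _ _ => sq_nonneg _
      rw [mul_pow]
      calc _ ≤ (1 / ((n : ℝ) + 1)) ^ 2 * (n * D) := by gcongr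
        _ ≤ (1 / (n : ℝ)) ^ 2 * (n * D) := by gcongr; linarith
        _ = _ := by field_simp
    rw [abs_mul, abs_of_pos (by positivity)]
    calc _ ≤ 1 / ((n : ℝ) + 1) * ∑ x ∈ Finset.Icc 1 n, (|R n x 0 - r₀ ((x : ℝ) / n)| + ε / 2) := by
          gcongr
          exact (Finset.abs_sum_le_sum_abs _ _).trans (Finset.sum_le_sum hterm)
      _ = 1 / ((n : ℝ) + 1) * (∑ x ∈ Finset.Icc 1 n, |R n x 0 - r₀ ((x : ℝ) / n)|) +
          n / ((n : ℝ) + 1) * (ε / 2) := by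
          rw [Finset.sum_add_distrib, Finset.sum_const, Nat.card_Icc, Nat.add_sub_cancel,
            nsmul_eq_mul]
          ring
      _ < ε / 2 + 1 * (ε / 2) := by
          refine add_lt_add_of_lt_of_le (hCS.trans_lt h1) ?_
          gcongr
          exact (div_le_one hN).2 (by linarith)
      _ = ε := by ring
  have := hdiff.add hR
  rw [zero_add] at this
  refine this.congr fun n => by ring

namespace IsMeanChainFamily

variable {γ Fbar A H : ℝ} {f : ℝ → ℝ} {R Q : ℕ → ℕ → ℝ → ℝ}
  (h : IsMeanChainFamily γ Fbar A H f R Q)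

include h

/-- Empirical averages against a continuous weight converge as soon as the sine modes do. -/
theorem tendsto_weighted {g : ℝ → ℝ} (hg : Continuous g) {t : ℝ} (ht : 0 ≤ t) {a : ℕ → ℝ}
    (ha : ∀ j, Tendsto (fun n : ℕ => sineMode n j (R n) (n ^ 2 * t)) atTop (𝓝 (a j))) {L : ℝ}
    (hL : Tendsto (fun M => ∑ j ∈ Finset.range M, 2 * sineCoeff g j * a j) atTop (𝓝 L)) :
    Tendsto (fun n : ℕ => 1 / ((n : ℝ) + 1) *
      ∑ x ∈ Finset.range (n + 1), g (x / ((n : ℝ) + 1)) * R n x (n ^ 2 * t)) atTop (𝓝 L) := by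
  obtain ⟨C, hC, hb⟩ := h.exists_bound ht
  -- Replacing the weight by its sine partial sum costs, by Cauchy–Schwarz and the energy bound, the
  -- root of `C` times a Riemann sum of the squared remainder. One chooses `M` first, uniformly in
  -- large `n`, and then lets `n → ∞`.
  have hcs : ∀ M n : ℕ, 1 ≤ n →
      |1 / ((n : ℝ) + 1) * ∑ x ∈ Finset.range (n + 1), g (x / ((n : ℝ) + 1)) * R n x (n ^ 2 * t) -
        ∑ j ∈ Finset.range M, 2 * sineCoeff g j * sineMode n j (R n) (n ^ 2 * t)| ≤
      √(C * (1 / ((n : ℝ) + 1) * ∑ x ∈ Finset.range (n + 1), (g (x / ((n : ℝ) + 1)) -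
        ∑ j ∈ Finset.range M, 2 * sineCoeff g j *
          Real.sin (Real.pi * j * (x / ((n : ℝ) + 1)))) ^ 2)) := by
    intro M n hn
    set N : ℝ := (n : ℝ) + 1 with hN
    have hN0 : 0 < N := by positivity
    set d : ℕ → ℝ := fun x => g (x / N) -
      ∑ j ∈ Finset.range M, 2 * sineCoeff g j * Real.sin (Real.pi * j * (x / N)) with hd
    have e : 1 / N * ∑ x ∈ Finset.range (n + 1), g (x / N) * R n x (n ^ 2 * t) -
        ∑ j ∈ Finset.range M, 2 * sineCoeff g j * sineMode n j (R n) (n ^ 2 * t) =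
        1 / N * ∑ x ∈ Finset.range (n + 1), d x * R n x (n ^ 2 * t) := by
      simp only [hd, sub_mul, Finset.sum_sub_distrib, mul_sub, sineMode, Finset.sum_mul,
        Finset.mul_sum]
      congr 1
      rw [Finset.sum_comm]
      refine Finset.sum_congr rfl fun x _ => Finset.sum_congr rfl fun j _ => ?_
      rw [show Real.pi * j * (x / N) = Real.pi * j / (n + 1) * x by rw [hN]; ring]
      ring
    rw [e]
    refine Real.abs_le_sqrt ?_
    have h1 := Finset.sum_mul_sq_le_sq_mul_sq (Finset.range (n + 1)) d
      fun x => R n x (n ^ 2 * t)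
    have h2 : ∑ x ∈ Finset.range (n + 1), R n x (n ^ 2 * t) ^ 2 ≤ C * N := by
      have h3 := (hb n hn (n ^ 2 * t) (by positivity) le_rfl).1
      refine le_trans (Finset.sum_le_sum fun x _ => ?_) (h3.trans (by gcongr; linarith))
      exact le_add_of_nonneg_right (sq_nonneg _)
    have hd0 : 0 ≤ ∑ x ∈ Finset.range (n + 1), d x ^ 2 := Finset.sum_nonneg fun _ _ => sq_nonneg _
    rw [mul_pow]
    calc _ ≤ (1 / N) ^ 2 * ((∑ x ∈ Finset.range (n + 1), d x ^ 2) * (C * N)) := by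
          gcongr
          exact h1.trans (by gcongr)
      _ = C * (1 / N * ∑ x ∈ Finset.range (n + 1), d x ^ 2) := by field_simp
  rw [Metric.tendsto_atTop]
  intro ε hε
  have hsq : Tendsto (fun M => √(C * ∫ u in (0 : ℝ)..1,
      (g u - ∑ j ∈ Finset.range M, 2 * sineCoeff g j * Real.sin (Real.pi * j * u)) ^ 2))
      atTop (𝓝 0) := by
    have := (Real.continuous_sqrt.tendsto _).comp ((tendsto_sineSum hg).const_mul C)
    rwa [mul_zero, Real.sqrt_zero] at this
  obtain ⟨M, hM1, hM2⟩ := ((hsq.eventually (gt_mem_nhds (by positivity : (0 : ℝ) < ε / 3))).and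
    (Metric.tendsto_nhds.1 hL (ε / 3) (by positivity))).exists
  have hn1 := ((Real.continuous_sqrt.tendsto _).comp ((tendsto_riemannSum (g := fun u =>
    (g u - ∑ j ∈ Finset.range M, 2 * sineCoeff g j * Real.sin (Real.pi * j * u)) ^ 2)
    (by fun_prop)).const_mul C)).eventually (gt_mem_nhds hM1)
  have hn2 := Metric.tendsto_nhds.1 (tendsto_finsetSum (Finset.range M) fun j _ =>
    (ha j).const_mul (2 * sineCoeff g j)) (ε / 3) (by positivity)
  obtain ⟨n₀, hn₀⟩ := eventually_atTop.1 ((hn1.and hn2).and (eventually_ge_atTop 1))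
  refine ⟨n₀, fun n hn => ?_⟩
  obtain ⟨⟨a1, a2⟩, a3⟩ := hn₀ n hn
  have a4 := (hcs M n a3).trans_lt a1
  rw [← Real.dist_eq] at a4
  calc _ ≤ _ := dist_triangle4 _ _ _ _
    _ < ε / 3 + ε / 3 + ε / 3 := add_lt_add (add_lt_add a4 a2) hM2
    _ = ε := by ring

end IsMeanChainFamily

end HarmonicChain

namespace HarmonicChain

/-! ### The pairing of the heat flow with a test function -/

/-- The decay rate of the `j`-th sine mode. -/
noncomputable def heatRate (γ : ℝ) (j : ℕ) : ℝ := (Real.pi * j) ^ 2 / (2 * γ)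

/-- The coefficients of the sine series of `r₀ - F̄ u`. -/
noncomputable def profileCoeff (Fbar : ℝ) (r₀ : ℝ → ℝ) (j : ℕ) : ℝ :=
  2 * sineCoeff (fun u => r₀ u - Fbar * u) j

/-- The integral of `f` against the solution of the heat equation at time `t`. -/
noncomputable def heatPairing (γ Fbar : ℝ) (r₀ f : ℝ → ℝ) (t : ℝ) : ℝ :=
  Fbar * (∫ u in (0 : ℝ)..1, u * f u) +
    ∑' j, profileCoeff Fbar r₀ j * sineCoeff f j * Real.exp (-(heatRate γ j * t))

lemma heatRate_nonneg {γ : ℝ} (hγ : 0 < γ) (j : ℕ) : 0 ≤ heatRate γ j := by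
  unfold heatRate; positivity

lemma exp_neg_heatRate_le_one {γ : ℝ} (hγ : 0 < γ) (j : ℕ) {t : ℝ} (ht : 0 ≤ t) :
    Real.exp (-(heatRate γ j * t)) ≤ 1 :=
  Real.exp_le_one_iff.2 (neg_nonpos.2 (mul_nonneg (heatRate_nonneg hγ j) ht))

/-- Identifies the limit of the boundary force in each mode with the sine coefficient of the
stationary profile `F̄ u`. At `j = 0` both sides are zero by the convention for division. -/
lemma sineCoeff_id (j : ℕ) : sineCoeff (fun u => u) j = -((-1) ^ j / (Real.pi * j)) := by
  rcases Nat.eq_zero_or_pos j with rfl | hj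
  · simp
  have hne : Real.pi * j ≠ 0 := by positivity
  have h : ∀ u ∈ uIcc (0 : ℝ) 1, HasDerivAt
      (fun u : ℝ => Real.sin (Real.pi * j * u) / (Real.pi * j) ^ 2 -
        u * Real.cos (Real.pi * j * u) / (Real.pi * j))
      (Real.sin (Real.pi * j * u) * u) u := fun u _ => by
    have h0 : HasDerivAt (fun u : ℝ => Real.pi * j * u) (Real.pi * j) u := by
      simpa using (hasDerivAt_id u).const_mul (Real.pi * j)
    refine ((h0.sin.div_const _).fun_sub
      (((hasDerivAt_id' u).fun_mul h0.cos).div_const _)).congr_deriv ?_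
    field_simp
    ring
  rw [sineCoeff, intervalIntegral.integral_eq_sub_of_hasDerivAt h
    (Continuous.intervalIntegrable (by fun_prop) _ _)]
  have h1 : Real.sin (Real.pi * j) = 0 := by rw [mul_comm]; exact Real.sin_nat_mul_pi j
  have h2 : Real.cos (Real.pi * j) = (-1) ^ j := by rw [mul_comm]; exact Real.cos_nat_mul_pi j
  simp [h1, h2]

lemma profileCoeff_eq {r₀ : ℝ → ℝ} (hr₀ : Continuous r₀) (Fbar : ℝ) (j : ℕ) :
    profileCoeff Fbar r₀ j = 2 * (sineCoeff r₀ j - Fbar * sineCoeff (fun u => u) j) := by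
  rw [profileCoeff, sineCoeff_sub hr₀ (by fun_prop), sineCoeff_const_mul]

lemma summable_profileCoeff_mul {r₀ f : ℝ → ℝ} (hr₀ : Continuous r₀) (hf : Continuous f)
    (Fbar : ℝ) : Summable fun j => |profileCoeff Fbar r₀ j * sineCoeff f j| := by
  have := (summable_abs_mul_sineCoeff (f := fun u => r₀ u - Fbar * u) (by fun_prop) hf).mul_left 2
  refine this.congr fun j => ?_
  rw [profileCoeff, mul_assoc, abs_mul 2, abs_two]

lemma abs_heatPairing_term_le {γ : ℝ} (hγ : 0 < γ) (Fbar : ℝ) (r₀ f : ℝ → ℝ) (j : ℕ) {t : ℝ}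
    (ht : 0 ≤ t) :
    ‖profileCoeff Fbar r₀ j * sineCoeff f j * Real.exp (-(heatRate γ j * t))‖ ≤
      |profileCoeff Fbar r₀ j * sineCoeff f j| := by
  rw [norm_mul, Real.norm_eq_abs, Real.norm_eq_abs, Real.abs_exp]
  exact mul_le_of_le_one_right (abs_nonneg _) (exp_neg_heatRate_le_one hγ j ht)

lemma summable_heatPairing {γ : ℝ} (hγ : 0 < γ) (Fbar : ℝ) {r₀ f : ℝ → ℝ} (hr₀ : Continuous r₀)
    (hf : Continuous f) {t : ℝ} (ht : 0 ≤ t) : Summable fun j =>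
      profileCoeff Fbar r₀ j * sineCoeff f j * Real.exp (-(heatRate γ j * t)) :=
  (summable_profileCoeff_mul hr₀ hf Fbar).of_norm_bounded
    fun j => abs_heatPairing_term_le hγ Fbar r₀ f j ht

namespace IsMeanChainFamily

variable {γ Fbar A H : ℝ} {f : ℝ → ℝ} {R Q : ℕ → ℕ → ℝ → ℝ}
  (h : IsMeanChainFamily γ Fbar A H f R Q)

include h

theorem tendsto_weighted_heatPairing {r₀ : ℝ → ℝ} (hr₀ : Continuous r₀)
    (hprofile : Tendsto (fun n : ℕ => (1 / (n : ℝ)) * ∑ x ∈ Finset.Icc 1 n,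
      (R n x 0 - r₀ ((x : ℝ) / n)) ^ 2) atTop (𝓝 0)) {g : ℝ → ℝ} (hg : Continuous g) {t : ℝ}
    (ht : 0 ≤ t) :
    Tendsto (fun n : ℕ => 1 / ((n : ℝ) + 1) *
      ∑ x ∈ Finset.range (n + 1), g (x / ((n : ℝ) + 1)) * R n x (n ^ 2 * t)) atTop
      (𝓝 (heatPairing γ Fbar r₀ g t)) := by
  set a : ℕ → ℝ := fun j => Fbar * sineCoeff (fun u => u) j +
    Real.exp (-(heatRate γ j * t)) * (profileCoeff Fbar r₀ j / 2) with ha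
  refine h.tendsto_weighted hg ht (a := a) (fun j => ?_) ?_
  · rcases Nat.eq_zero_or_pos j with rfl | hj
    · simp [sineMode, ha, profileCoeff]
    · have := h.tendsto_sineMode hj (tendsto_sineMode_initial hr₀ hprofile j) ht
      convert! this using 2
      simp only [ha, profileCoeff_eq hr₀, sineCoeff_id, heatRate]
      ring
  · have h1 := ((hasSum_mul_sineCoeff (f := fun u => u) (by fun_prop) hg).mul_left Fbar).add
      (summable_heatPairing h.pos Fbar hr₀ hg ht).hasSum
    refine h1.tendsto_sum_nat.congr fun M => Finset.sum_congr rfl fun j _ => ?_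
    simp only [ha]
    ring

/-- The limit of the time integral of the averaged momentum of the last atom. -/
theorem tendsto_integral_p {r₀ : ℝ → ℝ} (hr₀ : Continuous r₀)
    (hprofile : Tendsto (fun n : ℕ => (1 / (n : ℝ)) * ∑ x ∈ Finset.Icc 1 n,
      (R n x 0 - r₀ ((x : ℝ) / n)) ^ 2) atTop (𝓝 0)) {t : ℝ} (ht : 0 ≤ t) :
    Tendsto (fun n : ℕ => 1 / (n : ℝ) * ∫ s in (0 : ℝ)..n ^ 2 * t, Q n n s) atTop
      (𝓝 (heatPairing γ Fbar r₀ (fun u => u) t - heatPairing γ Fbar r₀ (fun u => u) 0 +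
        Fbar * t / (2 * γ))) := by
  have hγ := h.pos
  obtain ⟨C, hC, hb⟩ := h.exists_bound ht
  have hA0 : 0 ≤ A := (abs_nonneg _).trans (h.bound 0)
  have m1 := h.tendsto_weighted_heatPairing hr₀ hprofile (g := fun u => u) (by fun_prop) ht
  have m0 := h.tendsto_weighted_heatPairing hr₀ hprofile (g := fun u => u) (by fun_prop) le_rfl
  have hq : Tendsto (fun n : ℕ => (n : ℝ) / ((n : ℝ) + 1)) atTop (𝓝 1) :=
    tendsto_natCast_div_add_atTop 1
  have hq' : Tendsto (fun n : ℕ => ((n : ℝ) + 1) / n) atTop (𝓝 1) := by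
    have := hq.inv₀ one_ne_zero
    rw [inv_one] at this
    exact this.congr fun n => inv_div _ _
  have hinv : Tendsto (fun n : ℕ => 1 / ((n : ℝ) + 1)) atTop (𝓝 0) :=
    tendsto_one_div_add_atTop_nhds_zero_nat
  have hsqrt : Tendsto (fun n : ℕ => A * t / √(n : ℝ)) atTop (𝓝 0) :=
    (Real.tendsto_sqrt_atTop.comp tendsto_natCast_atTop_atTop).const_div_atTop _
  have hfpart : Tendsto (fun n : ℕ => 1 / ((n : ℝ) * (n + 1)) *
      (1 / √(n : ℝ) * ∫ s in (0 : ℝ)..n ^ 2 * t, f s)) atTop (𝓝 0) := by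
    refine squeeze_zero_norm' ?_ hsqrt
    filter_upwards [eventually_ge_atTop 1] with n hn
    have hn0 : (0 : ℝ) < n := by exact_mod_cast hn
    have hs0 : 0 < √(n : ℝ) := Real.sqrt_pos.2 hn0
    have h1 := intervalIntegral.norm_integral_le_of_norm_le_const (a := 0) (b := (n : ℝ) ^ 2 * t)
      (f := f) (C := A) fun s _ => h.bound s
    rw [sub_zero, abs_of_nonneg (by positivity)] at h1
    rw [norm_mul, norm_mul, Real.norm_of_nonneg (by positivity),
      Real.norm_of_nonneg (by positivity)]
    calc _ ≤ 1 / ((n : ℝ) * n) * (1 / √(n : ℝ) * (A * (n ^ 2 * t))) := by gcongr; linarith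
      _ = _ := by field_simp
  have hQpart : Tendsto (fun n : ℕ => 1 / ((n : ℝ) * (n + 1)) *
      ∑ x ∈ Finset.range (n + 1), (Q n x (n ^ 2 * t) - Q n x 0)) atTop (𝓝 0) := by
    have hlim : Tendsto (fun n : ℕ => (4 + C) * (1 / ((n : ℝ) + 1))) atTop (𝓝 0) := by
      simpa using hinv.const_mul (4 + C)
    refine squeeze_zero_norm' ?_ hlim
    filter_upwards [eventually_ge_atTop 1] with n hn
    have hn1 : (1 : ℝ) ≤ n := by exact_mod_cast hn
    have hn0 : (0 : ℝ) < n := by linarith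
    have hsum : ∀ s, 0 ≤ s → s ≤ n ^ 2 * t → ∑ x ∈ Finset.range (n + 1), |Q n x s| ≤
        (n + 1) + C * n / 2 := fun s hs hst => by
      have h1 := sum_abs_le_energy n (R n) (Q n) s
      have h2 := (hb n hn s hs hst).1
      refine le_trans (Finset.sum_le_sum fun x _ => ?_) (h1.trans (by linarith))
      exact le_add_of_nonneg_left (abs_nonneg _)
    have h1 := hsum (n ^ 2 * t) (by positivity) le_rfl
    have h2 := hsum 0 le_rfl (by positivity)
    have h3 : |∑ x ∈ Finset.range (n + 1), (Q n x (n ^ 2 * t) - Q n x 0)| ≤ (4 + C) * n := by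
      refine (Finset.abs_sum_le_sum_abs _ _).trans ((Finset.sum_le_sum fun x _ =>
        abs_sub _ _).trans ?_)
      rw [Finset.sum_add_distrib]
      linarith
    rw [norm_mul, Real.norm_of_nonneg (by positivity), Real.norm_eq_abs]
    calc _ ≤ 1 / ((n : ℝ) * (n + 1)) * ((4 + C) * n) := by gcongr
      _ = _ := by field_simp
  -- The moment identity divided by `n (n + 1)`: the change of the first moment and the integral of
  -- `F̄` survive, while the oscillation and the total momentum vanish.
  have hlim := ((hq'.mul (m1.sub m0)).add (((hq.const_mul (Fbar * t)).add hfpart).const_mul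
    (1 / (2 * γ)))).sub (hQpart.const_mul (1 / (2 * γ)))
  have hval : 1 * (heatPairing γ Fbar r₀ (fun u => u) t - heatPairing γ Fbar r₀ (fun u => u) 0) +
      1 / (2 * γ) * (Fbar * t * 1 + 0) - 1 / (2 * γ) * 0 =
      heatPairing γ Fbar r₀ (fun u => u) t - heatPairing γ Fbar r₀ (fun u => u) 0 +
        Fbar * t / (2 * γ) := by ring
  rw [hval] at hlim
  refine hlim.congr' ?_
  filter_upwards [eventually_ge_atTop 1] with n hn
  have hn0 : (0 : ℝ) < n := by exact_mod_cast hn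
  have hN0 : (0 : ℝ) < (n : ℝ) + 1 := by positivity
  have key := (h.chain n hn).integral_p_last hγ (t := n ^ 2 * t) (by positivity)
  rw [intervalIntegral.integral_add (by simp)
    ((h.cont.intervalIntegrable _ _).const_mul _), intervalIntegral.integral_const,
    intervalIntegral.integral_const_mul] at key
  have hmom : ∀ s, 1 / ((n : ℝ) + 1) * ∑ x ∈ Finset.range (n + 1),
      (x : ℝ) / ((n : ℝ) + 1) * R n x s = 1 / ((n : ℝ) + 1) ^ 2 *
        ∑ x ∈ Finset.range (n + 1), (x : ℝ) * R n x s := fun s => by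
    rw [Finset.mul_sum, Finset.mul_sum]
    refine Finset.sum_congr rfl fun x _ => by field_simp
  simp only [mul_sub, Finset.sum_sub_distrib, sub_zero, smul_eq_mul, mul_zero] at key hmom ⊢
  rw [hmom, hmom]
  rw [← mul_right_inj' (mul_pos hn0 hN0).ne']
  have : (n : ℝ) * (n + 1) * (1 / n * ∫ s in (0 : ℝ)..n ^ 2 * t, Q n n s) =
    (n + 1) * ∫ s in (0 : ℝ)..n ^ 2 * t, Q n n s := by field_simp
  rw [this, key]
  field_simp
  ring

end IsMeanChainFamily

end HarmonicChain

/-! ### Work of the oscillating force, harmonic by harmonic. -/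

namespace HarmonicChain

/-! ### The thermal part of the work -/

/-- With `z = ω² - 2iγω` the quadratic reads `(η - 1)² = -η z`, so `4/z - 1 = (i y)²` for `y = (η +
1)/(η - 1)`, and `1/(η - 1) = (y - 1)/2`. The growing root has positive imaginary part, which puts
`i y` in the right half-plane and hence on the principal branch. -/
lemma IsGrowthFactor.two_mul_re {γ ω : ℝ} (hγ : 0 < γ) (hω : 0 < ω) {η : ℂ}
    (hη : IsGrowthFactor γ (-ω) η) :
    2 * (Complex.I * ω / (η - 1)).re =
      ω * ((4 / ((ω : ℂ) ^ 2 - 2 * Complex.I * γ * ω) - 1) ^ (1 / 2 : ℂ)).re := by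
  have hη1 : η - 1 ≠ 0 := fun h0 => by
    have := hη.one_lt
    rw [sub_eq_zero.1 h0, norm_one] at this
    exact lt_irrefl _ this
  have hη0 : η ≠ 0 := fun h0 => by
    have := hη.one_lt
    rw [h0, norm_zero] at this
    linarith
  set z : ℂ := (ω : ℂ) ^ 2 - 2 * Complex.I * γ * ω with hz
  have hz0 : z ≠ 0 := fun h0 => by
    have := congrArg Complex.re h0
    simp [hz, ← Complex.ofReal_pow] at this
    exact hω.ne' this
  have heq : (η - 1) ^ 2 = -(η * z) := by
    rw [hη.eq, hz]
    push_cast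
    ring_nf
    rw [Complex.I_sq]
    ring
  -- Dividing the quadratic by `η` and taking imaginary parts gives `(‖η‖² - 1) Im η = 2γω ‖η‖²`.
  have him : 0 < η.im := by
    have h1 : η * (starRingEnd ℂ) η = ((‖η‖ ^ 2 : ℝ) : ℂ) := by
      rw [Complex.mul_conj, Complex.normSq_eq_norm_sq]
    have h2 : ((‖η‖ ^ 2 : ℝ) : ℂ) * (η - 2 + z) + (starRingEnd ℂ) η = 0 := by
      have h3 : η * (((‖η‖ ^ 2 : ℝ) : ℂ) * (η - 2 + z) + (starRingEnd ℂ) η) = 0 := by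
        rw [mul_add, h1]
        linear_combination ((‖η‖ ^ 2 : ℝ) : ℂ) * heq
      exact (mul_eq_zero.1 h3).resolve_left hη0
    have h4 := congrArg Complex.im h2
    rw [Complex.add_im, Complex.im_ofReal_mul, Complex.conj_im] at h4
    simp [hz, ← Complex.ofReal_pow] at h4
    have h5 : 1 < ‖η‖ ^ 2 := one_lt_pow₀ hη.one_lt two_ne_zero
    have h6 : 0 < ‖η‖ ^ 2 * (2 * γ * ω) := by positivity
    by_contra hneg
    nlinarith
  set y : ℂ := (η + 1) / (η - 1) with hy
  have hsq : 4 / z - 1 = (Complex.I * y) ^ 2 := by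
    rw [mul_pow, Complex.I_sq, hy, div_pow, heq]
    field_simp
    linear_combination -heq
  have hre : 0 < (Complex.I * y).re := by
    rw [Complex.I_mul_re, hy, Complex.div_im]
    have hN : 0 < Complex.normSq (η - 1) := Complex.normSq_pos.2 hη1
    have : -((η + 1).im * (η - 1).re / Complex.normSq (η - 1) -
        (η + 1).re * (η - 1).im / Complex.normSq (η - 1)) =
        2 * η.im / Complex.normSq (η - 1) := by
      simp only [Complex.add_im, Complex.sub_im, Complex.add_re, Complex.sub_re, Complex.one_re,
        Complex.one_im]
      ring
    rw [this]
    positivity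
  rw [hsq, one_div, Complex.sq_cpow_two_inv hre]
  have h7 : Complex.I * ω / (η - 1) = ((ω / 2 : ℝ) : ℂ) * (Complex.I * y) -
      ((ω / 2 : ℝ) : ℂ) * Complex.I := by
    rw [hy]
    push_cast
    field_simp
    ring
  rw [h7, Complex.sub_re, Complex.re_ofReal_mul, Complex.re_ofReal_mul, Complex.I_re]
  ring

/-- The sum `∑ a(ℓ) e^{iℓωs}`. -/
noncomputable def harmonicSum (a : ℤ → ℂ) (ω s : ℝ) : ℂ :=
  ∑' ℓ : ℤ, a ℓ * Complex.exp (Complex.I * ((ℓ * ω : ℝ) : ℂ) * s)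

section HarmonicSum

variable {a : ℤ → ℂ} (ha : Summable fun ℓ => ‖a ℓ‖) {ω : ℝ}

include ha

lemma summable_harmonicSum (ω s : ℝ) :
    Summable fun ℓ : ℤ => a ℓ * Complex.exp (Complex.I * ((ℓ * ω : ℝ) : ℂ) * s) :=
  ha.of_norm_bounded fun ℓ => by rw [norm_mul, norm_exp_I_mul, mul_one]

lemma norm_harmonicSum_le (ω s : ℝ) : ‖harmonicSum a ω s‖ ≤ ∑' ℓ, ‖a ℓ‖ :=
  tsum_of_norm_bounded ha.hasSum fun ℓ => by rw [norm_mul, norm_exp_I_mul, mul_one]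

lemma continuous_harmonicSum (ω : ℝ) : Continuous (harmonicSum a ω) :=
  continuous_tsum (fun ℓ => by fun_prop) ha fun ℓ s => by
    rw [norm_mul, norm_exp_I_mul, mul_one]

omit ha in
lemma harmonicSum_eq_ofReal (hreal : ∀ ℓ, a (-ℓ) = (starRingEnd ℂ) (a ℓ)) (ω s : ℝ) :
    ((harmonicSum a ω s).re : ℂ) = harmonicSum a ω s := by
  refine Complex.conj_eq_iff_re.1 ?_
  rw [harmonicSum, Complex.conj_tsum, ← (Equiv.neg ℤ).tsum_eq]
  refine tsum_congr fun ℓ => ?_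
  rw [Equiv.neg_apply, hreal, map_mul, Complex.conj_conj, ← Complex.exp_conj]
  simp

lemma hasSum_integral_harmonicSum {q : ℝ → ℂ} {T : ℝ} (hq : IntervalIntegrable q volume 0 T)
    (ω : ℝ) :
    HasSum (fun ℓ : ℤ => a ℓ * ∫ s in (0 : ℝ)..T, Complex.exp (Complex.I * ((ℓ * ω : ℝ) : ℂ) * s) *
      q s) (∫ s in (0 : ℝ)..T, harmonicSum a ω s * q s) := by
  have h := intervalIntegral.hasSum_integral_of_dominated_convergence (a := 0) (b := T)
    (μ := volume) (ι := ℤ)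
    (F := fun ℓ s => a ℓ * Complex.exp (Complex.I * ((ℓ * ω : ℝ) : ℂ) * s) * q s)
    (f := fun s => harmonicSum a ω s * q s) (fun ℓ s => ‖a ℓ‖ * ‖q s‖) (fun ℓ => ?_)
    (fun ℓ => ae_of_all _ fun s _ => ?_) (ae_of_all _ fun s _ => ha.mul_right _) ?_
    (ae_of_all _ fun s _ => (summable_harmonicSum ha ω s).hasSum.mul_right _)
  · simpa only [mul_assoc, intervalIntegral.integral_const_mul] using h
  · exact ((by fun_prop : Continuous fun s : ℝ => a ℓ *
      Complex.exp (Complex.I * ((ℓ * ω : ℝ) : ℂ) * s)).aestronglyMeasurable).mul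
      (intervalIntegrable_iff.1 hq).aestronglyMeasurable
  · rw [norm_mul, norm_mul, norm_exp_I_mul, mul_one]
  · simp only [tsum_mul_right]
    exact hq.norm.const_mul _

/-- The time averages of a harmonic sum recover its coefficients. -/
lemma tendsto_mean_harmonicSum (hω : ω ≠ 0) (m : ℤ) :
    Tendsto (fun T : ℝ => (1 / (T : ℂ)) * ∫ s in (0 : ℝ)..T,
      Complex.exp (Complex.I * ((m * ω : ℝ) : ℂ) * s) * harmonicSum a ω s) atTop
      (𝓝 (a (-m))) := by
  have hexp : ∀ T : ℝ, (1 / (T : ℂ)) * ∫ s in (0 : ℝ)..T,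
      Complex.exp (Complex.I * ((m * ω : ℝ) : ℂ) * s) * harmonicSum a ω s =
      ∑' ℓ : ℤ, a ℓ * ((1 / (T : ℂ)) * ∫ s in (0 : ℝ)..T,
        Complex.exp (Complex.I * (((ℓ + m) * ω : ℝ) : ℂ) * s)) := fun T => by
    have h1 := hasSum_integral_harmonicSum ha (T := T)
      (q := fun s => Complex.exp (Complex.I * ((m * ω : ℝ) : ℂ) * s))
      (Continuous.intervalIntegrable (by fun_prop) _ _) ω
    simp only [mul_comm (Complex.exp (Complex.I * ((m * ω : ℝ) : ℂ) * _))]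
    rw [← h1.tsum_eq, ← tsum_mul_left]
    refine tsum_congr fun ℓ => ?_
    rw [mul_left_comm]
    congr 3
    ext s
    rw [← Complex.exp_add]
    congr 1
    push_cast
    ring
  simp only [hexp]
  -- The averages of the exponentials are bounded by one and tend to zero except at frequency zero,
  -- so dominated convergence applies to the sum.
  have hlim : a (-m) = ∑' ℓ : ℤ, a ℓ * (if ℓ = -m then 1 else 0) := by simp
  rw [hlim]
  refine tendsto_tsum_of_dominated_convergence ha (fun ℓ => ?_) ?_
  · refine Tendsto.const_mul _ ?_
    split_ifs with h
    · refine tendsto_const_nhds.congr' ?_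
      filter_upwards [eventually_gt_atTop 0] with T hT
      have : (T : ℂ) ≠ 0 := by exact_mod_cast hT.ne'
      simp [h, this]
    · have hne : ((ℓ + m : ℤ) : ℝ) * ω ≠ 0 :=
        mul_ne_zero (by exact_mod_cast fun h0 => h (by omega)) hω
      have hl : Tendsto (fun T : ℝ => 2 / |((ℓ + m : ℤ) : ℝ) * ω| / T) atTop (𝓝 0) :=
        tendsto_id.const_div_atTop _
      refine squeeze_zero_norm' ?_ hl
      filter_upwards [eventually_gt_atTop 0] with T hT
      rw [norm_mul, norm_div, norm_one, Complex.norm_real, Real.norm_of_nonneg hT.le,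
        one_div_mul_eq_div]
      gcongr
      have := norm_integral_exp_le hne T
      push_cast at this ⊢
      exact this
  · filter_upwards [eventually_gt_atTop 0] with T hT ℓ
    rw [norm_mul]
    refine mul_le_of_le_one_right (norm_nonneg _) ?_
    rw [norm_mul, norm_div, norm_one, Complex.norm_real, Real.norm_of_nonneg hT.le,
      one_div_mul_eq_div, div_le_one hT]
    have := intervalIntegral.norm_integral_le_of_norm_le_const (a := 0) (b := T) (C := 1)
      (f := fun s : ℝ => Complex.exp (Complex.I * (((ℓ + m) * ω : ℝ) : ℂ) * s))
      fun s _ => (norm_exp_I_mul _ _).le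
    simpa [abs_of_pos hT] using this

end HarmonicSum

end HarmonicChain

namespace HarmonicChain

namespace IsMeanChainFamily

variable {γ Fbar A H θ : ℝ} {Fhat : ℤ → ℂ} {R Q : ℕ → ℕ → ℝ → ℝ}

/-- The work of the oscillating part of the force. -/
theorem tendsto_thermal (hθ : 0 < θ) (hreal : ∀ ℓ, Fhat (-ℓ) = (starRingEnd ℂ) (Fhat ℓ))
    (hsum : Summable fun ℓ => ‖Fhat ℓ‖) (hzero : Fhat 0 = 0)
    (h : IsMeanChainFamily γ Fbar A H (fun s => (harmonicSum Fhat (angFreq θ) s).re) R Q)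
    {t : ℝ} (ht : 0 < t) :
    (Summable fun ℓ : ℕ => thermalTerm γ θ Fhat (ℓ + 1)) ∧
    Tendsto (fun n : ℕ => 1 / ((n : ℝ) * √(n : ℝ)) * ∫ s in (0 : ℝ)..n ^ 2 * t,
      (harmonicSum Fhat (angFreq θ) s).re * Q n n s) atTop (𝓝 (t * thermalWork γ θ Fhat)) := by
  set w := angFreq θ with hw
  have hw0 : 0 < w := by rw [hw, angFreq]; positivity
  obtain ⟨C, hC⟩ := h.exists_norm_harmonic_le ht.le
  set X : ℕ → ℤ → ℂ := fun n ℓ => (1 / ((n : ℂ) * (√(n : ℝ) : ℝ))) *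
    ∫ s in (0 : ℝ)..(n ^ 2 * t), Complex.exp (Complex.I * ((ℓ * w : ℝ) : ℂ) * s) * (Q n n s : ℂ)
    with hX
  have hXlim : ∀ ℓ : ℤ, ℓ ≠ 0 → ∀ η, IsGrowthFactor γ (ℓ * w) η → Tendsto (fun n => X n ℓ) atTop
      (𝓝 (-(Complex.I * ((ℓ * w : ℝ) : ℂ) / (η - 1)) * (t * Fhat (-ℓ)))) := fun ℓ hℓ η hη => by
    refine h.tendsto_harmonic (mul_ne_zero (by exact_mod_cast hℓ) hw0.ne') hη ?_ ht
    simpa only [harmonicSum_eq_ofReal hreal] using tendsto_mean_harmonicSum hsum hw0.ne' ℓ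
  have hXconj : ∀ n ℓ, X n (-ℓ) = (starRingEnd ℂ) (X n ℓ) := fun n ℓ => by
    simp only [hX]
    have hT : (0 : ℝ) ≤ n ^ 2 * t := by positivity
    rw [map_mul, intervalIntegral.integral_of_le hT, intervalIntegral.integral_of_le hT,
      ← integral_conj]
    congr 1
    · simp
    · congr 1
      ext s
      rw [map_mul, ← Complex.exp_conj]
      simp
  have hex : ∀ ℓ : ℤ, ∃ b, Tendsto (fun n => Fhat ℓ * X n ℓ) atTop (𝓝 b) := fun ℓ => by
    rcases eq_or_ne ℓ 0 with rfl | hℓ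
    · exact ⟨0, by simp [hzero]⟩
    · obtain ⟨η, hη⟩ := exists_isGrowthFactor h.pos
        (mul_ne_zero (by exact_mod_cast hℓ : (ℓ : ℝ) ≠ 0) hw0.ne')
      exact ⟨_, (hXlim ℓ hℓ η hη).const_mul _⟩
  choose b hb using hex
  -- The bound for the harmonics of `Q_n` does not depend on the frequency, so absolute summability
  -- of the coefficients suffices.
  have hbd : ∀ᶠ n in atTop, ∀ ℓ, ‖Fhat ℓ * X n ℓ‖ ≤ ‖Fhat ℓ‖ * C := by
    filter_upwards [eventually_ge_atTop 1] with n hn ℓ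
    rw [norm_mul]
    gcongr
    exact hC n hn _
  have hbsum : Summable b := (hsum.mul_right C).of_norm_bounded fun ℓ =>
    le_of_tendsto (hb ℓ).norm (hbd.mono fun n hn => hn ℓ)
  have hmain := tendsto_tsum_of_dominated_convergence (hsum.mul_right C) hb hbd
  have hb0 : b 0 = 0 := tendsto_nhds_unique (hb 0) (by simp [hzero])
  -- Opposite harmonics are conjugate, so their sum is twice a real part. The response is evaluated
  -- at frequency `-ℓω`, where the growth factor matches `two_mul_re`.
  have hterm : ∀ ℓ : ℕ, b ℓ + b (-ℓ) = ((t * thermalTerm γ θ Fhat ℓ : ℝ) : ℂ) := by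
    intro ℓ
    rcases Nat.eq_zero_or_pos ℓ with rfl | hℓ
    · simp [hb0, thermalTerm]
    have hℓw : 0 < (ℓ : ℝ) * w := by positivity
    obtain ⟨η, hη⟩ := exists_isGrowthFactor (ω := -((ℓ : ℝ) * w)) h.pos (neg_ne_zero.2 hℓw.ne')
    have h1 := (hXlim (-ℓ) (by omega) η (by push_cast; rwa [neg_mul])).const_mul (Fhat (-ℓ))
    have h2 := tendsto_nhds_unique (hb (-ℓ)) h1
    have h3 : b ℓ = (starRingEnd ℂ) (b (-ℓ)) := by
      refine tendsto_nhds_unique (hb ℓ) ?_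
      refine ((Complex.continuous_conj.tendsto _).comp (hb (-ℓ))).congr fun n => ?_
      simp only [Function.comp_apply, map_mul, hXconj, hreal, Complex.conj_conj]
    have h4 : b (-ℓ) = ((t * ‖Fhat ℓ‖ ^ 2 : ℝ) : ℂ) *
        (Complex.I * ((ℓ * w : ℝ) : ℂ) / (η - 1)) := by
      have h5 : Fhat ℓ * (starRingEnd ℂ) (Fhat ℓ) = ((‖Fhat ℓ‖ ^ 2 : ℝ) : ℂ) := by
        rw [Complex.mul_conj, Complex.normSq_eq_norm_sq]
      rw [h2, neg_neg, hreal]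
      push_cast at h5 ⊢
      rw [← h5]
      ring
    rw [h3, add_comm, Complex.add_conj, h4, Complex.re_ofReal_mul]
    have h6 := hη.two_mul_re h.pos hℓw
    rw [thermalTerm, ← hw]
    have h7 : 2 * (t * ‖Fhat ℓ‖ ^ 2 * (Complex.I * ((ℓ * w : ℝ) : ℂ) / (η - 1)).re) =
        t * (‖Fhat ℓ‖ ^ 2 * (ℓ * w) * ((4 / (((ℓ * w : ℝ) : ℂ) ^ 2 -
          2 * Complex.I * γ * ((ℓ * w : ℝ) : ℂ)) - 1) ^ (1 / 2 : ℂ)).re) := by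
      linear_combination (t * ‖Fhat ℓ‖ ^ 2) * h6
    rw [← h7, Complex.ofReal_mul 2]
  have hs := hbsum.hasSum.nat_add_neg
  simp only [hterm, hb0, add_zero] at hs
  have hs1 : HasSum (fun ℓ : ℕ => t * thermalTerm γ θ Fhat ℓ) (∑' ℓ, b ℓ).re := by
    simpa using Complex.reCLM.hasSum hs
  have hs2 : HasSum (fun ℓ : ℕ => thermalTerm γ θ Fhat (ℓ + 1)) ((∑' ℓ, b ℓ).re / t) := by
    have h1 := (hasSum_nat_add_iff' 1).2 (hs1.div_const t)
    simpa [thermalTerm, ht.ne'] using h1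
  refine ⟨hs2.summable, ?_⟩
  have hval : t * thermalWork γ θ Fhat = (∑' ℓ, b ℓ).re := by
    rw [thermalWork, hs2.tsum_eq]
    field_simp
  rw [hval]
  refine ((Complex.continuous_re.tendsto _).comp hmain).congr' ?_
  filter_upwards [eventually_ge_atTop 1] with n hn
  have hq : IntervalIntegrable (fun s => (Q n n s : ℂ)) volume 0 ((n : ℝ) ^ 2 * t) := by
    have h1 := (h.chain n hn).cont_p n le_rfl
    have h2 := intervalIntegrable_of_continuousOn_Ici h1 le_rfl
      (by positivity : (0 : ℝ) ≤ n ^ 2 * t)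
    exact ⟨h2.1.ofReal, h2.2.ofReal⟩
  have h1 := hasSum_integral_harmonicSum hsum hq w
  have h2 : ∑' ℓ, Fhat ℓ * X n ℓ = (1 / ((n : ℂ) * (√(n : ℝ) : ℝ))) *
      ∫ s in (0 : ℝ)..(n ^ 2 * t), harmonicSum Fhat w s * (Q n n s : ℂ) := by
    rw [← h1.tsum_eq, ← tsum_mul_left]
    exact tsum_congr fun ℓ => mul_left_comm _ _ _
  rw [Function.comp_apply, h2]
  have h3 : ∀ s, harmonicSum Fhat w s * (Q n n s : ℂ) =
      (((harmonicSum Fhat w s).re * Q n n s : ℝ) : ℂ) := fun s => by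
    rw [Complex.ofReal_mul, harmonicSum_eq_ofReal hreal]
  simp only [h3, intervalIntegral.integral_ofReal]
  norm_cast

end IsMeanChainFamily

end HarmonicChain

/-! ### The heat equation: existence, smoothness, boundary flux and uniqueness. -/

namespace HarmonicChain

/-! ### Integration against signed measures on the unit interval -/

instance (ν : SignedMeasure I) : IsFiniteMeasure ν.variation := by
  rw [← SignedMeasure.totalVariation_eq_variation, SignedMeasure.totalVariation]
  infer_instance

lemma integrable_of_continuous {μ : Measure I} [IsFiniteMeasure μ] {f : I → ℝ}
    (hf : Continuous f) : Integrable f μ :=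
  hf.integrable_of_hasCompactSupport (HasCompactSupport.of_compactSpace f)

lemma integral_toSignedMeasure_sub (μ₁ μ₂ : Measure I) [IsFiniteMeasure μ₁] [IsFiniteMeasure μ₂]
    {f : I → ℝ} (hf : Continuous f) :
    ∫ᵛ u, f u ∂•(μ₁.toSignedMeasure - μ₂.toSignedMeasure) = (∫ u, f u ∂μ₁) - ∫ u, f u ∂μ₂ := by
  have hflip : ContinuousLinearMap.lsmul ℝ ℝ =
      (ContinuousLinearMap.lsmul ℝ ℝ : ℝ →L[ℝ] ℝ →L[ℝ] ℝ).flip := by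
    ext
    simp
  rw [VectorMeasure.integral_sub_vectorMeasure (integrable_of_continuous hf)
    (integrable_of_continuous hf), hflip, VectorMeasure.integral_toSignedMeasure,
    VectorMeasure.integral_toSignedMeasure]

lemma integral_withDensityᵥ {ρ : ℝ → ℝ} (hρ : ContinuousOn ρ (Icc 0 1)) {f : ℝ → ℝ}
    (hf : Continuous f) :
    ∫ᵛ u : I, f u ∂•((volume : Measure I).withDensityᵥ fun u : I => ρ u) =
      ∫ u in (0 : ℝ)..1, f u * ρ u := by
  have hρ' : Continuous fun u : I => ρ u := continuousOn_iff_continuous_domRestrict.1 hρ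
  have hf' : Continuous fun u : I => f u := hf.comp continuous_subtype_val
  have hi : Integrable (fun u : I => ρ u) volume := integrable_of_continuous hρ'
  have h1 := isFiniteMeasure_withDensity_ofReal hi.2
  have h2 := isFiniteMeasure_withDensity_ofReal hi.neg.2
  have hneg : ∀ u : I, (-fun u : I => ρ u) u = -ρ u := fun _ => rfl
  simp only [hneg] at h2
  rw [withDensityᵥ_eq_withDensity_pos_part_sub_withDensity_neg_part hi,
    integral_toSignedMeasure_sub _ _ hf',
    integral_withDensity_eq_integral_toReal_smul hρ'.measurable.ennreal_ofReal
      (ae_of_all _ fun _ => ENNReal.ofReal_lt_top),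
    integral_withDensity_eq_integral_toReal_smul
      hρ'.fun_neg.measurable.ennreal_ofReal
      (ae_of_all _ fun _ => ENNReal.ofReal_lt_top), ← integral_sub]
  · rw [intervalIntegral.integral_of_le zero_le_one, ← integral_Icc_eq_integral_Ioc,
      ← integral_subtype_comap measurableSet_Icc fun u => f u * ρ u]
    refine integral_congr_ae (ae_of_all _ fun u => ?_)
    simp only [ENNReal.toReal_ofReal', smul_eq_mul]
    rw [← sub_mul, max_zero_sub_max_neg_zero_eq_self]
    ring
  · simp only [ENNReal.toReal_ofReal']
    exact integrable_of_continuous ((hρ'.max continuous_const).smul hf')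
  · simp only [ENNReal.toReal_ofReal']
    exact integrable_of_continuous ((hρ'.fun_neg.max continuous_const).smul hf')

/-- The two parts of the Jordan decomposition then have the same integrals against continuous
functions, hence coincide. -/
lemma eq_zero_of_forall_integral_eq_zero {ν : SignedMeasure I}
    (h : ∀ f : C(I, ℝ), ∫ᵛ u, f u ∂•ν = 0) : ν = 0 := by
  have hJ := SignedMeasure.toSignedMeasure_toJordanDecomposition ν
  rw [JordanDecomposition.toSignedMeasure] at hJ
  have heq : ν.toJordanDecomposition.posPart = ν.toJordanDecomposition.negPart := by
    refine ext_of_forall_integral_eq_of_IsFiniteMeasure fun f => ?_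
    have h1 := h f.toContinuousMap
    rw [← hJ, integral_toSignedMeasure_sub _ _ f.toContinuousMap.continuous] at h1
    exact sub_eq_zero.1 h1
  rw [← hJ]
  simp only [heq, sub_self]

lemma abs_integral_signedMeasure_le (ν : SignedMeasure I) : ∃ V, 0 ≤ V ∧ ∀ (f : I → ℝ) (C : ℝ),
    (∀ u, |f u| ≤ C) → |∫ᵛ u, f u ∂•ν| ≤ C * V := by
  refine ⟨‖(ContinuousLinearMap.lsmul ℝ ℝ : ℝ →L[ℝ] ℝ →L[ℝ] ℝ)‖ * ν.variation.real univ,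
    by positivity, fun f C hf => ?_⟩
  rw [← mul_assoc]
  exact VectorMeasure.norm_integral_le_of_norm_le_const (μ := ν) (f := f)
    (B := (ContinuousLinearMap.lsmul ℝ ℝ : ℝ →L[ℝ] ℝ →L[ℝ] ℝ)) (ae_of_all _ fun u => hf u)

end HarmonicChain

namespace HarmonicChain

/-! ### Smoothness of the solutions of the heat equation -/

/-- The sequence `c` grows at most polynomially. -/
def IsPolyBounded (c : ℕ → ℂ) : Prop := ∃ (K : ℝ) (p : ℕ), ∀ j : ℕ, ‖c j‖ ≤ K * ((j : ℝ) + 1) ^ p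

lemma IsPolyBounded.mul {c d : ℕ → ℂ} (hc : IsPolyBounded c) (hd : IsPolyBounded d) :
    IsPolyBounded fun j => c j * d j := by
  obtain ⟨K, p, h1⟩ := hc
  obtain ⟨L, q, h2⟩ := hd
  refine ⟨K * L, p + q, fun j => ?_⟩
  rw [norm_mul, pow_add]
  calc _ ≤ (K * ((j : ℝ) + 1) ^ p) * (L * ((j : ℝ) + 1) ^ q) :=
        mul_le_mul (h1 j) (h2 j) (norm_nonneg _) ((norm_nonneg _).trans (h1 j))
    _ = _ := by ring

lemma isPolyBounded_heatRate {γ : ℝ} (hγ : 0 < γ) :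
    IsPolyBounded fun j => ((-heatRate γ j : ℝ) : ℂ) := by
  refine ⟨Real.pi ^ 2 / (2 * γ), 2, fun j => ?_⟩
  rw [Complex.norm_real, norm_neg, Real.norm_of_nonneg (heatRate_nonneg hγ j), heatRate, mul_pow,
    mul_div_right_comm]
  gcongr
  linarith

lemma isPolyBounded_freq : IsPolyBounded fun j => Complex.I * ((Real.pi * j : ℝ) : ℂ) := by
  refine ⟨Real.pi, 1, fun j => ?_⟩
  rw [norm_mul, Complex.norm_I, one_mul, Complex.norm_real, Real.norm_of_nonneg (by positivity),
    pow_one]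
  gcongr
  linarith

/-- Since `j ≤ j²`, the Gaussian factor is at most a geometric one, which beats any polynomial. -/
lemma IsPolyBounded.summable {c : ℕ → ℂ} (hc : IsPolyBounded c) {γ t : ℝ} (hγ : 0 < γ)
    (ht : 0 < t) : Summable fun j => ‖c j‖ * Real.exp (-(heatRate γ j * t)) := by
  obtain ⟨K, p, h⟩ := hc
  have hK : 0 ≤ K := by simpa using (norm_nonneg _).trans (h 0)
  set κ : ℝ := Real.pi ^ 2 / (2 * γ) * t with hκ
  have hκ0 : 0 < κ := by positivity
  have hr1 : Real.exp (-κ) < 1 := Real.exp_lt_one_iff.2 (neg_lt_zero.2 hκ0)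
  have h1 := (summable_nat_add_iff 1).2 (summable_pow_mul_geometric_of_norm_lt_one (R := ℝ) p
    (r := Real.exp (-κ)) (by rwa [Real.norm_of_nonneg (Real.exp_pos _).le]))
  refine Summable.of_nonneg_of_le (fun j => by positivity) (fun j => ?_)
    (h1.mul_left (K * Real.exp κ))
  have h2 : Real.exp (-(heatRate γ j * t)) ≤ Real.exp κ * Real.exp (-κ) ^ (j + 1) := by
    rw [← Real.exp_nat_mul, ← Real.exp_add]
    refine Real.exp_le_exp.2 ?_
    have hj : (j : ℝ) ≤ (j : ℝ) ^ 2 := by exact_mod_cast Nat.le_self_pow two_ne_zero j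
    have : heatRate γ j * t = κ * (j : ℝ) ^ 2 := by rw [heatRate, hκ]; ring
    rw [this]
    push_cast
    nlinarith
  calc _ ≤ (K * ((j : ℝ) + 1) ^ p) * (Real.exp κ * Real.exp (-κ) ^ (j + 1)) := by
        gcongr
        exact h j
    _ = _ := by push_cast; ring

/-- The exponent of the `j`-th mode, a linear function of `(t, u)`. -/
noncomputable def modeExponent (γ : ℝ) (j : ℕ) : ℝ × ℝ →L[ℝ] ℂ :=
  ((-heatRate γ j : ℝ) : ℂ) • (Complex.ofRealCLM.comp (ContinuousLinearMap.fst ℝ ℝ ℝ)) +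
    (Complex.I * ((Real.pi * j : ℝ) : ℂ)) •
      (Complex.ofRealCLM.comp (ContinuousLinearMap.snd ℝ ℝ ℝ))

lemma modeExponent_apply (γ : ℝ) (j : ℕ) (q : ℝ × ℝ) : modeExponent γ j q =
    ((-(heatRate γ j * q.1) : ℝ) : ℂ) + ((Real.pi * j * q.2 : ℝ) : ℂ) * Complex.I := by
  simp [modeExponent]
  ring

lemma norm_exp_modeExponent (γ : ℝ) (j : ℕ) (q : ℝ × ℝ) :
    ‖Complex.exp (modeExponent γ j q)‖ = Real.exp (-(heatRate γ j * q.1)) := by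
  rw [Complex.norm_exp, modeExponent_apply]
  simp

/-- The series `∑ c_j exp(-λ_j t + iπju)`. -/
noncomputable def heatSeries (γ : ℝ) (c : ℕ → ℂ) (q : ℝ × ℝ) : ℂ :=
  ∑' j, c j * Complex.exp (modeExponent γ j q)

lemma IsPolyBounded.summable_heatSeries {c : ℕ → ℂ} (hc : IsPolyBounded c) {γ : ℝ} (hγ : 0 < γ)
    {q : ℝ × ℝ} (hq : 0 < q.1) : Summable fun j => c j * Complex.exp (modeExponent γ j q) :=
  (hc.summable hγ hq).of_norm_bounded fun j => by rw [norm_mul, norm_exp_modeExponent]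

/-- The coefficients of the time derivative. -/
noncomputable def timeCoeff (γ : ℝ) (c : ℕ → ℂ) (j : ℕ) : ℂ := c j * ((-heatRate γ j : ℝ) : ℂ)

/-- The coefficients of the space derivative. -/
noncomputable def spaceCoeff (c : ℕ → ℂ) (j : ℕ) : ℂ :=
  c j * (Complex.I * ((Real.pi * j : ℝ) : ℂ))

lemma IsPolyBounded.timeCoeff {c : ℕ → ℂ} (hc : IsPolyBounded c) {γ : ℝ} (hγ : 0 < γ) :
    IsPolyBounded (timeCoeff γ c) := hc.mul (isPolyBounded_heatRate hγ)

lemma IsPolyBounded.spaceCoeff {c : ℕ → ℂ} (hc : IsPolyBounded c) :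
    IsPolyBounded (spaceCoeff c) := hc.mul isPolyBounded_freq

/-- Differentiation term by term on the half-plane of times exceeding half of the given one, where
the derivatives are uniformly summable. Both partial derivatives are again heat series. -/
lemma IsPolyBounded.hasFDerivAt {c : ℕ → ℂ} (hc : IsPolyBounded c) {γ : ℝ} (hγ : 0 < γ)
    {q : ℝ × ℝ} (hq : 0 < q.1) :
    HasFDerivAt (heatSeries γ c)
      (heatSeries γ (HarmonicChain.timeCoeff γ c) q •
          (Complex.ofRealCLM.comp (ContinuousLinearMap.fst ℝ ℝ ℝ)) +
        heatSeries γ (HarmonicChain.spaceCoeff c) q •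
          (Complex.ofRealCLM.comp (ContinuousLinearMap.snd ℝ ℝ ℝ))) q := by
  set Lt : ℝ × ℝ →L[ℝ] ℂ := Complex.ofRealCLM.comp (ContinuousLinearMap.fst ℝ ℝ ℝ) with hLt
  set Lu : ℝ × ℝ →L[ℝ] ℂ := Complex.ofRealCLM.comp (ContinuousLinearMap.snd ℝ ℝ ℝ) with hLu
  have ht := hc.timeCoeff hγ
  have hs := hc.spaceCoeff
  set δ := q.1 / 2 with hδ
  have hδ0 : 0 < δ := by positivity
  have hsplit : ∀ j (y : ℝ × ℝ), (c j * Complex.exp (modeExponent γ j y)) • modeExponent γ j =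
      (HarmonicChain.timeCoeff γ c j * Complex.exp (modeExponent γ j y)) • Lt +
        (HarmonicChain.spaceCoeff c j * Complex.exp (modeExponent γ j y)) • Lu := fun j y => by
    conv_lhs => enter [2]; rw [modeExponent]
    rw [smul_add, smul_smul, smul_smul, HarmonicChain.timeCoeff, HarmonicChain.spaceCoeff]
    congr 2 <;> ring
  have h := hasFDerivAt_tsum_of_isPreconnected (𝕜 := ℝ) (s := {y : ℝ × ℝ | δ < y.1})
    (x₀ := q) (x := q)
    (f := fun j y => c j * Complex.exp (modeExponent γ j y))
    (f' := fun j y => (c j * Complex.exp (modeExponent γ j y)) • modeExponent γ j)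
    (((ht.summable hγ hδ0).mul_right ‖Lt‖).add ((hs.summable hγ hδ0).mul_right ‖Lu‖))
    (isOpen_lt continuous_const continuous_fst)
    ((convex_halfSpace_gt (f := fun y : ℝ × ℝ => y.1)
      ⟨fun _ _ => rfl, fun _ _ => rfl⟩ δ).isPreconnected) (fun j y _ => ?_) (fun j y hy => ?_)
    (by simp [hδ, hq]) (hc.summable_heatSeries hγ hq) (by simp [hδ, hq])
  · refine h.congr_fderiv ?_
    simp only [hsplit]
    rw [(((ht.summable_heatSeries hγ hq).smul_const Lt)).tsum_add
      ((hs.summable_heatSeries hγ hq).smul_const Lu),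
      (ht.summable_heatSeries hγ hq).tsum_smul_const, (hs.summable_heatSeries hγ hq).tsum_smul_const]
    rfl
  · refine (((modeExponent γ j).hasFDerivAt (x := y)).cexp.const_mul (c j)).congr_fderiv ?_
    rw [smul_smul]
  · rw [hsplit]
    have he : Real.exp (-(heatRate γ j * y.1)) ≤ Real.exp (-(heatRate γ j * δ)) := by
      have := mul_le_mul_of_nonneg_left (le_of_lt hy) (heatRate_nonneg hγ j)
      exact Real.exp_le_exp.2 (by linarith)
    refine (norm_add_le _ _).trans ?_
    rw [norm_smul, norm_smul, norm_mul, norm_mul, norm_exp_modeExponent]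
    gcongr

/-- Polynomially bounded coefficients are stable under both derivatives, so one inducts on the order
of smoothness for all such sequences at once. -/
theorem IsPolyBounded.contDiffOn {c : ℕ → ℂ} (hc : IsPolyBounded c) {γ : ℝ} (hγ : 0 < γ) :
    ContDiffOn ℝ (⊤ : ℕ∞) (heatSeries γ c) {q | 0 < q.1} := by
  have ho : IsOpen {q : ℝ × ℝ | 0 < q.1} := isOpen_lt continuous_const continuous_fst
  refine contDiffOn_infty.2 fun n => ?_
  induction n generalizing c with
  | zero =>
    exact contDiffOn_zero.2 fun q hq => (hc.hasFDerivAt hγ hq).continuousAt.continuousWithinAt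
  | succ n ih =>
    rw [Nat.cast_succ]
    refine (contDiffOn_succ_iff_fderiv_of_isOpen ho).2
      ⟨fun q hq => (hc.hasFDerivAt hγ hq).differentiableAt.differentiableWithinAt,
        fun h => absurd h (by exact WithTop.coe_ne_top), ?_⟩
    refine ContDiffOn.congr ?_ fun q hq => (hc.hasFDerivAt hγ hq).fderiv
    exact ((ih (hc.timeCoeff hγ)).smul contDiffOn_const).add
      ((ih hc.spaceCoeff).smul contDiffOn_const)

end HarmonicChain

namespace HarmonicChain

/-! ### The macroscopic stretch -/

/-- The solution of the heat equation with boundary values `0` and `F̄`. -/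
noncomputable def heatDensity (γ Fbar : ℝ) (r₀ : ℝ → ℝ) (t u : ℝ) : ℝ :=
  Fbar * u + (heatSeries γ (fun j => (profileCoeff Fbar r₀ j : ℂ)) (t, u)).im

open Classical in
/-- The measure-valued solution of the heat equation. -/
noncomputable def heatFlow (γ Fbar : ℝ) (r₀ : ℝ → ℝ) (t : ℝ) : SignedMeasure I :=
  if 0 < t then (volume : Measure I).withDensityᵥ fun u : I => heatDensity γ Fbar r₀ t u
  else (volume : Measure I).withDensityᵥ fun u : I => r₀ u

lemma integral_heatRate_mul_exp (γ : ℝ) (j : ℕ) (t : ℝ) :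
    ∫ s in (0 : ℝ)..t, heatRate γ j * Real.exp (-(heatRate γ j * s)) =
      1 - Real.exp (-(heatRate γ j * t)) := by
  have h : ∀ s ∈ uIcc 0 t, HasDerivAt (fun s => -Real.exp (-(heatRate γ j * s)))
      (heatRate γ j * Real.exp (-(heatRate γ j * s))) s := fun s _ => by
    have h1 : HasDerivAt (fun s => -(heatRate γ j * s)) (-heatRate γ j) s :=
      ((hasDerivAt_id' s).const_mul (heatRate γ j)).fun_neg.congr_deriv (by ring)
    exact h1.exp.fun_neg.congr_deriv (by ring)
  rw [intervalIntegral.integral_eq_sub_of_hasDerivAt h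
    (Continuous.intervalIntegrable (by fun_prop) _ _)]
  simp
  ring

section

variable {γ : ℝ} (hγ : 0 < γ) (Fbar : ℝ) {r₀ : ℝ → ℝ} (hr₀ : Continuous r₀)

include hr₀ in
lemma isPolyBounded_profileCoeff : IsPolyBounded fun j => (profileCoeff Fbar r₀ j : ℂ) := by
  have h := hasSum_sq_sineCoeff (f := fun u => r₀ u - Fbar * u) (by fun_prop)
  refine ⟨2 + ∫ u in (0 : ℝ)..1, (r₀ u - Fbar * u) ^ 2, 0, fun j => ?_⟩
  have h1 := le_hasSum h j fun _ _ => by positivity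
  rw [Complex.norm_real, Real.norm_eq_abs, profileCoeff, pow_zero, mul_one, abs_mul, abs_two]
  nlinarith [sq_abs (sineCoeff (fun u => r₀ u - Fbar * u) j),
    sq_nonneg (|sineCoeff (fun u => r₀ u - Fbar * u) j| - 1)]

include hγ hr₀

lemma hasSum_heatDensity {t : ℝ} (ht : 0 < t) (u : ℝ) :
    HasSum (fun j => profileCoeff Fbar r₀ j * Real.exp (-(heatRate γ j * t)) *
      Real.sin (Real.pi * j * u)) (heatDensity γ Fbar r₀ t u - Fbar * u) := by
  have h := Complex.imCLM.hasSum ((isPolyBounded_profileCoeff Fbar hr₀).summable_heatSeries hγ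
    (q := (t, u)) ht).hasSum
  rw [heatDensity, add_sub_cancel_left]
  refine h.congr_fun fun j => ?_
  simp only [Complex.imCLM_apply, Complex.im_ofReal_mul, modeExponent_apply,
    Complex.exp_add, ← Complex.ofReal_exp, Complex.exp_ofReal_mul_I_im]
  ring

lemma contDiffOn_heatDensity :
    ContDiffOn ℝ (⊤ : ℕ∞) (fun q : ℝ × ℝ => heatDensity γ Fbar r₀ q.1 q.2) {q | 0 < q.1} := by
  have h := (isPolyBounded_profileCoeff Fbar hr₀).contDiffOn hγ
  exact (contDiffOn_const.mul contDiffOn_snd).add (Complex.imCLM.contDiff.comp_contDiffOn h)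

lemma continuous_heatDensity {t : ℝ} (ht : 0 < t) : Continuous (heatDensity γ Fbar r₀ t) := by
  have h := (contDiffOn_heatDensity hγ Fbar hr₀).continuousOn
  exact h.comp_continuous (by fun_prop : Continuous fun u : ℝ => (t, u)) fun _ => ht

lemma integral_mul_heatDensity {f : ℝ → ℝ} (hf : Continuous f) {t : ℝ} (ht : 0 < t) :
    ∫ u in (0 : ℝ)..1, f u * heatDensity γ Fbar r₀ t u = heatPairing γ Fbar r₀ f t := by
  have hsum := (isPolyBounded_profileCoeff Fbar hr₀).summable hγ ht
  have h := intervalIntegral.hasSum_integral_of_dominated_convergence (a := 0) (b := 1)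
    (μ := volume) (ι := ℕ)
    (F := fun j u => f u * (profileCoeff Fbar r₀ j * Real.exp (-(heatRate γ j * t)) *
      Real.sin (Real.pi * j * u)))
    (f := fun u => f u * (heatDensity γ Fbar r₀ t u - Fbar * u))
    (fun j u => |f u| * (‖(profileCoeff Fbar r₀ j : ℂ)‖ * Real.exp (-(heatRate γ j * t))))
    (fun j => (by fun_prop : Continuous _).aestronglyMeasurable)
    (fun j => ae_of_all _ fun u _ => ?_) (ae_of_all _ fun u _ => hsum.mul_left _) ?_
    (ae_of_all _ fun u _ => (hasSum_heatDensity hγ Fbar hr₀ ht u).mul_left _)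
  · have e : ∀ u, f u * heatDensity γ Fbar r₀ t u =
        Fbar * (u * f u) + f u * (heatDensity γ Fbar r₀ t u - Fbar * u) := fun u => by ring
    have hc := continuous_heatDensity hγ Fbar hr₀ ht
    simp only [e]
    rw [intervalIntegral.integral_add (Continuous.intervalIntegrable (by fun_prop) _ _)
      (Continuous.intervalIntegrable (by fun_prop) _ _), intervalIntegral.integral_const_mul,
      heatPairing, ← h.tsum_eq]
    congr 1
    refine tsum_congr fun j => ?_
    rw [sineCoeff, mul_right_comm, ← intervalIntegral.integral_const_mul]
    congr 1
    ext u
    ring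
  · rw [norm_mul, norm_mul, norm_mul, Complex.norm_real, Real.norm_eq_abs (f u),
      Real.norm_eq_abs (Real.exp _), Real.abs_exp, Real.norm_eq_abs (Real.sin _)]
    exact mul_le_mul_of_nonneg_left
      (mul_le_of_le_one_right (by positivity) (Real.abs_sin_le_one _)) (abs_nonneg _)
  · simp only [tsum_mul_left]
    exact Continuous.intervalIntegrable (by fun_prop) _ _

omit hγ in
lemma integral_mul_eq_heatPairing_zero {f : ℝ → ℝ} (hf : Continuous f) :
    ∫ u in (0 : ℝ)..1, f u * r₀ u = heatPairing γ Fbar r₀ f 0 := by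
  have h := hasSum_mul_sineCoeff (f := fun u => r₀ u - Fbar * u) (by fun_prop) hf
  have e : ∀ u, f u * r₀ u = Fbar * (u * f u) + (r₀ u - Fbar * u) * f u := fun u => by ring
  simp only [e]
  rw [intervalIntegral.integral_add (Continuous.intervalIntegrable (by fun_prop) _ _)
    (Continuous.intervalIntegrable (by fun_prop) _ _), intervalIntegral.integral_const_mul,
    heatPairing, ← h.tsum_eq]
  simp [profileCoeff]

lemma integral_heatFlow {f : ℝ → ℝ} (hf : Continuous f) {t : ℝ} (ht : 0 ≤ t) :
    ∫ᵛ u : I, f u ∂•(heatFlow γ Fbar r₀ t) = heatPairing γ Fbar r₀ f t := by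
  rcases ht.eq_or_lt with rfl | ht
  · rw [heatFlow, if_neg (lt_irrefl _), integral_withDensityᵥ hr₀.continuousOn hf]
    exact integral_mul_eq_heatPairing_zero Fbar hr₀ hf
  · rw [heatFlow, if_pos ht,
      integral_withDensityᵥ (continuous_heatDensity hγ Fbar hr₀ ht).continuousOn hf]
    exact integral_mul_heatDensity hγ Fbar hr₀ hf ht

/-- The products of coefficients are absolutely summable by Parseval, so convergence is uniform down
to `t = 0`, where the density itself need not converge. -/
lemma continuousOn_heatPairing {f : ℝ → ℝ} (hf : Continuous f) :
    ContinuousOn (heatPairing γ Fbar r₀ f) (Ici 0) := by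
  unfold heatPairing
  refine continuousOn_const.add (continuousOn_tsum (fun j => by fun_prop)
    (summable_profileCoeff_mul hr₀ hf Fbar) fun j t ht => ?_)
  exact abs_heatPairing_term_le hγ Fbar r₀ f j ht

omit hγ hr₀ in
lemma sineCoeff_deriv_deriv {φ : ℝ → ℝ} (hφ : ContDiff ℝ 2 φ) (h0 : φ 0 = 0) (h1 : φ 1 = 0)
    (j : ℕ) : sineCoeff (deriv (deriv φ)) j = -(Real.pi * j) ^ 2 * sineCoeff φ j := by
  have hφ1 : ContDiff ℝ 1 (deriv φ) := hφ.deriv' (n := 1)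
  have hφ2 : Continuous (deriv (deriv φ)) := hφ1.continuous_deriv le_rfl
  have hd : ∀ u, HasDerivAt φ (deriv φ u) u := fun u =>
    ((hφ.differentiable two_ne_zero) u).hasDerivAt
  have hd1 : ∀ u, HasDerivAt (deriv φ) (deriv (deriv φ) u) u := fun u =>
    ((hφ1.differentiable one_ne_zero) u).hasDerivAt
  have h : ∀ u ∈ uIcc (0 : ℝ) 1, HasDerivAt (fun u => Real.sin (Real.pi * j * u) * deriv φ u -
      Real.pi * j * Real.cos (Real.pi * j * u) * φ u)
      (Real.sin (Real.pi * j * u) * deriv (deriv φ) u +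
        (Real.pi * j) ^ 2 * (Real.sin (Real.pi * j * u) * φ u)) u := fun u _ => by
    have hl : HasDerivAt (fun u : ℝ => Real.pi * j * u) (Real.pi * j) u := by
      simpa using (hasDerivAt_id u).const_mul (Real.pi * j)
    refine ((hl.sin.fun_mul (hd1 u)).fun_sub
      ((hl.cos.const_mul (Real.pi * j)).fun_mul (hd u))).congr_deriv ?_
    ring
  have hc := hφ.continuous
  have key := intervalIntegral.integral_eq_sub_of_hasDerivAt h
    (Continuous.intervalIntegrable (by fun_prop) _ _)
  rw [intervalIntegral.integral_add (Continuous.intervalIntegrable (by fun_prop) _ _)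
    (Continuous.intervalIntegrable (by fun_prop) _ _), intervalIntegral.integral_const_mul] at key
  have hs : Real.sin (Real.pi * j) = 0 := by rw [mul_comm]; exact Real.sin_nat_mul_pi j
  simp only [mul_one, hs, zero_mul, h1, h0, mul_zero, Real.sin_zero, sub_self] at key
  unfold sineCoeff
  linear_combination key

omit hγ hr₀ in
lemma integral_id_mul_deriv_deriv {φ : ℝ → ℝ} (hφ : ContDiff ℝ 2 φ) (h0 : φ 0 = 0)
    (h1 : φ 1 = 0) : ∫ u in (0 : ℝ)..1, u * deriv (deriv φ) u = deriv φ 1 := by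
  have hφ1 : ContDiff ℝ 1 (deriv φ) := hφ.deriv' (n := 1)
  have hφ2 : Continuous (deriv (deriv φ)) := hφ1.continuous_deriv le_rfl
  have h : ∀ u ∈ uIcc (0 : ℝ) 1, HasDerivAt (fun u => u * deriv φ u - φ u)
      (u * deriv (deriv φ) u) u := fun u _ =>
    (((hasDerivAt_id' u).fun_mul ((hφ1.differentiable one_ne_zero) u).hasDerivAt).fun_sub
      ((hφ.differentiable two_ne_zero) u).hasDerivAt).congr_deriv (by ring)
  rw [intervalIntegral.integral_eq_sub_of_hasDerivAt h
    (Continuous.intervalIntegrable (by fun_prop) _ _)]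
  simp [h0, h1]

theorem isWeakStretch_heatFlow : IsWeakStretch γ Fbar r₀ (heatFlow γ Fbar r₀) where
  cont f := by
    have hf : Continuous (IccExtend (zero_le_one (α := ℝ)) f) := f.continuous.Icc_extend'
    refine (continuousOn_heatPairing hγ Fbar hr₀ hf).congr fun t ht => ?_
    rw [← integral_heatFlow hγ Fbar hr₀ hf ht]
    simp
  weak φ hφ h0 h1 t ht := by
    have hφ2 : Continuous (deriv (deriv φ)) :=
      (hφ.deriv' (n := 1)).continuous_deriv le_rfl
    have e1 : ∫ s in (0 : ℝ)..t, ∫ᵛ u : I, deriv (deriv φ) u ∂•(heatFlow γ Fbar r₀ s) =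
        ∫ s in (0 : ℝ)..t, heatPairing γ Fbar r₀ (deriv (deriv φ)) s := by
      refine intervalIntegral.integral_congr fun s hs => ?_
      rw [uIcc_of_le ht] at hs
      exact integral_heatFlow hγ Fbar hr₀ hφ2 hs.1
    -- Two derivatives of `φ` multiply its coefficient by `-(πj)² = -2γ` times the decay rate, and
    -- each mode can then be integrated exactly in time.
    have hterm : ∀ j s, profileCoeff Fbar r₀ j * sineCoeff (deriv (deriv φ)) j *
        Real.exp (-(heatRate γ j * s)) = -(2 * γ) * (profileCoeff Fbar r₀ j * sineCoeff φ j) *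
          (heatRate γ j * Real.exp (-(heatRate γ j * s))) := fun j s => by
      rw [sineCoeff_deriv_deriv hφ h0 h1, heatRate]
      field_simp
    have h2 := intervalIntegral.hasSum_integral_of_dominated_convergence (a := 0) (b := t)
      (μ := volume) (ι := ℕ)
      (F := fun j s => profileCoeff Fbar r₀ j * sineCoeff (deriv (deriv φ)) j *
        Real.exp (-(heatRate γ j * s)))
      (f := fun s => ∑' j, profileCoeff Fbar r₀ j * sineCoeff (deriv (deriv φ)) j *
        Real.exp (-(heatRate γ j * s)))
      (fun j _ => |profileCoeff Fbar r₀ j * sineCoeff (deriv (deriv φ)) j|)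
      (fun j => (by fun_prop : Continuous _).aestronglyMeasurable)
      (fun j => ae_of_all _ fun s hs => abs_heatPairing_term_le hγ Fbar r₀ _ j (by
        rw [uIoc_of_le ht] at hs; exact hs.1.le))
      (ae_of_all _ fun s _ => summable_profileCoeff_mul hr₀ hφ2 Fbar) (by simp)
      (ae_of_all _ fun s hs => (summable_heatPairing hγ Fbar hr₀ hφ2 (by
        rw [uIoc_of_le ht] at hs; exact hs.1.le)).hasSum)
    simp only [hterm] at h2
    have hA : Summable fun j => profileCoeff Fbar r₀ j * sineCoeff φ j :=
      (summable_profileCoeff_mul hr₀ hφ.continuous Fbar).of_abs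
    have hB := summable_heatPairing hγ Fbar hr₀ hφ.continuous ht
    have h3 := ((hA.hasSum.sub hB.hasSum).mul_left (-(2 * γ))).unique
      (h2.congr_fun fun j => by
        rw [intervalIntegral.integral_const_mul, integral_heatRate_mul_exp]
        ring)
    -- The linear profile contributes `F̄ ∫ u φ'' = F̄ φ'(1)`, which cancels the boundary term of
    -- the weak formulation.
    have e2 : ∫ s in (0 : ℝ)..t, heatPairing γ Fbar r₀ (deriv (deriv φ)) s =
        t * (Fbar * deriv φ 1) + -(2 * γ) * ((∑' j, profileCoeff Fbar r₀ j * sineCoeff φ j) -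
          ∑' j, profileCoeff Fbar r₀ j * sineCoeff φ j * Real.exp (-(heatRate γ j * t))) := by
      have hint := intervalIntegrable_of_continuousOn_Ici
        (continuousOn_heatPairing hγ Fbar hr₀ hφ2) le_rfl ht
      have hint2 := hint.sub (_root_.intervalIntegrable_const
        (c := Fbar * deriv φ 1) (μ := volume) (a := 0) (b := t))
      rw [h3]
      have e3 : ∀ s, heatPairing γ Fbar r₀ (deriv (deriv φ)) s = Fbar * deriv φ 1 +
          (heatPairing γ Fbar r₀ (deriv (deriv φ)) s - Fbar * deriv φ 1) := fun s => by ring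
      rw [intervalIntegral.integral_congr fun s _ => e3 s, intervalIntegral.integral_add
        _root_.intervalIntegrable_const hint2, intervalIntegral.integral_const, sub_zero,
        smul_eq_mul]
      congr 1
      refine intervalIntegral.integral_congr fun s _ => ?_
      simp only [heatPairing, integral_id_mul_deriv_deriv hφ h0 h1, hterm, add_sub_cancel_left]
    rw [integral_heatFlow hγ Fbar hr₀ hφ.continuous ht,
      integral_mul_eq_heatPairing_zero (γ := γ) Fbar hr₀ hφ.continuous, e1, e2, heatPairing,
      heatPairing]
    simp only [mul_zero, neg_zero, Real.exp_zero, mul_one]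
    generalize (∑' j, profileCoeff Fbar r₀ j * sineCoeff φ j) = SA
    generalize (∑' j, profileCoeff Fbar r₀ j * sineCoeff φ j *
      Real.exp (-(heatRate γ j * t))) = SB
    field_simp
    ring

theorem hasSmoothDensity_heatFlow :
    HasSmoothDensity (heatFlow γ Fbar r₀) (heatDensity γ Fbar r₀) where
  smooth := (contDiffOn_heatDensity hγ Fbar hr₀).mono fun _ hq => hq.1
  density t ht := by rw [heatFlow, if_pos ht]

end

end HarmonicChain

namespace HarmonicChain

/-! ### The boundary derivative -/

/-- Summability of the `L¹` norms. Continuity of the sum only supplies its measurability. -/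
lemma integrableOn_tsum_of_summable {F : ℕ → ℝ → ℝ} {s : Set ℝ} (hs : MeasurableSet s)
    (hF : ∀ j, IntegrableOn (F j) s) (hsum : Summable fun j => ∫ u in s, ‖F j u‖)
    (hc : ContinuousOn (fun u => ∑' j, F j u) s) : IntegrableOn (fun u => ∑' j, F j u) s := by
  refine ⟨hc.aestronglyMeasurable hs, ?_⟩
  refine lt_of_le_of_lt (lintegral_mono fun u => enorm_tsum_le_tsum_enorm) ?_
  rw [lintegral_tsum fun j => (hF j).1.enorm]
  have h : ∀ j, ∫⁻ u in s, ‖F j u‖ₑ = ENNReal.ofReal (∫ u in s, ‖F j u‖) := fun j =>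
    (ofReal_integral_norm_eq_lintegral_enorm (hF j)).symm
  simp only [h]
  exact hsum.tsum_ofReal_lt_top

section

variable {γ : ℝ} (hγ : 0 < γ) (Fbar : ℝ) {r₀ : ℝ → ℝ} (hr₀ : Continuous r₀)

include hγ hr₀

lemma boundaryDeriv_heatDensity {s : ℝ} (hs : 0 < s) :
    boundaryDeriv (heatDensity γ Fbar r₀) s = Fbar +
      (heatSeries γ (spaceCoeff fun j => (profileCoeff Fbar r₀ j : ℂ)) (s, 1)).im := by
  have h1 := (isPolyBounded_profileCoeff Fbar hr₀).hasFDerivAt hγ (q := (s, 1)) hs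
  have h2 : HasDerivAt (fun u : ℝ => (s, u)) ((0 : ℝ), (1 : ℝ)) 1 :=
    (hasDerivAt_const _ _).prodMk (hasDerivAt_id _)
  have h3 := h1.comp_hasDerivAt (1 : ℝ) h2
  have h4 := Complex.imCLM.hasFDerivAt.comp_hasDerivAt (1 : ℝ) h3
  have h5 : HasDerivAt (heatDensity γ Fbar r₀ s) (Fbar +
      (heatSeries γ (spaceCoeff fun j => (profileCoeff Fbar r₀ j : ℂ)) (s, 1)).im) 1 := by
    refine (((hasDerivAt_id' (1 : ℝ)).const_mul Fbar).fun_add h4).congr_deriv ?_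
    simp
  exact h5.hasDerivWithinAt.derivWithin (uniqueDiffOn_Icc zero_lt_one 1 (by simp))

/-- The slope `πj (-1)^j` of a sine at `1` equals `-(πj)²` times the sine coefficient of `u`. Hence
`∂_u r(s,1) - F̄` is `2γ` times the time derivative of the first moment, mode by mode. -/
lemma im_heatSeries_spaceCoeff {s : ℝ} (hs : 0 < s) :
    (heatSeries γ (spaceCoeff fun j => (profileCoeff Fbar r₀ j : ℂ)) (s, 1)).im =
      ∑' j, -(2 * γ) * (profileCoeff Fbar r₀ j * sineCoeff (fun u => u) j) *
        (heatRate γ j * Real.exp (-(heatRate γ j * s))) := by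
  have h := Complex.imCLM.hasSum
    (((isPolyBounded_profileCoeff Fbar hr₀).spaceCoeff).summable_heatSeries hγ
      (q := (s, 1)) hs).hasSum
  refine (h.congr_fun fun j => ?_).tsum_eq.symm
  rcases Nat.eq_zero_or_pos j with rfl | hj
  · simp [spaceCoeff, heatRate]
  have hcos : Real.cos (Real.pi * j) = (-1) ^ j := by rw [mul_comm]; exact Real.cos_nat_mul_pi j
  simp only [Complex.imCLM_apply, spaceCoeff, modeExponent_apply, Complex.exp_add,
    ← Complex.ofReal_exp, mul_one, sineCoeff_id, heatRate]
  have e : ∀ (a b c : ℝ) (z : ℂ), (a : ℂ) * (Complex.I * (b : ℂ)) * ((c : ℂ) * z) =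
      ((a * b * c : ℝ) : ℂ) * (Complex.I * z) := fun a b c z => by push_cast; ring
  rw [e, Complex.im_ofReal_mul, Complex.I_mul_im, Complex.exp_ofReal_mul_I_re, hcos]
  field_simp

/-- Each mode has `L¹(0,t)` norm at most `2γ` times a product of sine coefficients, and these
products are summable by Parseval. This gives integrability up to `s = 0` without smoothness of the
initial profile, and allows integration term by term. -/
lemma boundaryDeriv_integral {t : ℝ} (ht : 0 < t) :
    IntervalIntegrable (boundaryDeriv (heatDensity γ Fbar r₀)) volume 0 t ∧
    ∫ s in (0 : ℝ)..t, boundaryDeriv (heatDensity γ Fbar r₀) s = Fbar * t +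
      2 * γ * (heatPairing γ Fbar r₀ (fun u => u) t - heatPairing γ Fbar r₀ (fun u => u) 0) := by
  set F : ℕ → ℝ → ℝ := fun j s => -(2 * γ) * (profileCoeff Fbar r₀ j * sineCoeff (fun u => u) j) *
        (heatRate γ j * Real.exp (-(heatRate γ j * s))) with hF
  have hFc : ∀ j, Continuous (F j) := fun j => by simp only [hF]; fun_prop
  have hFi : ∀ j, IntegrableOn (F j) (Ioc 0 t) := fun j =>
    ((hFc j).intervalIntegrable 0 t).1
  have habs := summable_profileCoeff_mul hr₀ (continuous_id' (X := ℝ)) Fbar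
  have hFn : ∀ j, ∫ s in Ioc 0 t, ‖F j s‖ ≤
      2 * γ * |profileCoeff Fbar r₀ j * sineCoeff (fun u => u) j| := fun j => by
    have e : ∀ s, ‖F j s‖ = 2 * γ * |profileCoeff Fbar r₀ j * sineCoeff (fun u => u) j| *
        (heatRate γ j * Real.exp (-(heatRate γ j * s))) := fun s => by
      simp only [hF]
      rw [norm_mul, norm_mul, norm_neg, Real.norm_of_nonneg (by positivity : 0 ≤ 2 * γ),
        Real.norm_eq_abs, Real.norm_of_nonneg
          (mul_nonneg (heatRate_nonneg hγ j) (Real.exp_pos _).le)]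
    simp only [e]
    rw [← intervalIntegral.integral_of_le ht.le, intervalIntegral.integral_const_mul,
      integral_heatRate_mul_exp]
    exact mul_le_of_le_one_right (by positivity) (by linarith [Real.exp_pos (-(heatRate γ j * t))])
  have hFs : Summable fun j => ∫ s in Ioc 0 t, ‖F j s‖ :=
    Summable.of_nonneg_of_le (fun j => integral_nonneg fun _ => norm_nonneg _) hFn
      (habs.mul_left (2 * γ))
  have heq : EqOn (fun s => Fbar + ∑' j, F j s) (boundaryDeriv (heatDensity γ Fbar r₀))
      (Ioc 0 t) := fun s hs => by
    rw [boundaryDeriv_heatDensity hγ Fbar hr₀ hs.1, im_heatSeries_spaceCoeff hγ Fbar hr₀ hs.1]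
  have hcont : ContinuousOn (fun s => ∑' j, F j s) (Ioc 0 t) := by
    have h1 := ((isPolyBounded_profileCoeff Fbar hr₀).spaceCoeff.contDiffOn hγ).continuousOn
    have h2 : ContinuousOn (fun s : ℝ => (heatSeries γ (spaceCoeff fun j =>
        (profileCoeff Fbar r₀ j : ℂ)) (s, 1)).im) (Ioc 0 t) :=
      Complex.continuous_im.comp_continuousOn (h1.comp (by fun_prop) fun s hs => hs.1)
    exact h2.congr fun s hs => (im_heatSeries_spaceCoeff hγ Fbar hr₀ hs.1).symm
  have hint := integrableOn_tsum_of_summable measurableSet_Ioc hFi hFs hcont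
  have hii : IntervalIntegrable (fun s => ∑' j, F j s) volume 0 t :=
    (intervalIntegrable_iff_integrableOn_Ioc_of_le ht.le).2 hint
  rw [← uIoc_of_le ht.le] at heq
  have hconst : IntervalIntegrable (fun _ : ℝ => Fbar) volume 0 t :=
    _root_.intervalIntegrable_const
  refine ⟨(hconst.add hii).congr heq, ?_⟩
  rw [← intervalIntegral.integral_congr_ae (ae_of_all _ fun s hs => heq hs),
    intervalIntegral.integral_add hconst hii, intervalIntegral.integral_const, sub_zero, smul_eq_mul,
    mul_comm t]
  congr 1
  have h1 := hasSum_integral_of_summable_integral_norm hFi hFs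
  rw [← intervalIntegral.integral_of_le ht.le] at h1
  have hA := summable_heatPairing hγ Fbar hr₀ (continuous_id' (X := ℝ)) ht.le
  have hB := summable_heatPairing hγ Fbar hr₀ (continuous_id' (X := ℝ)) le_rfl
  have h2 := ((hA.hasSum.sub hB.hasSum).mul_left (2 * γ)).congr_fun (g := fun j =>
      ∫ s in Ioc 0 t, F j s) fun j => by
    rw [← intervalIntegral.integral_of_le ht.le]
    simp only [hF]
    rw [intervalIntegral.integral_const_mul, integral_heatRate_mul_exp, mul_zero, neg_zero,
      Real.exp_zero]
    ring
  rw [h1.unique h2, heatPairing, heatPairing]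
  ring

end

end HarmonicChain

namespace HarmonicChain

/-! ### Uniqueness of the weak solution -/

lemma exists_abs_sineCoeff_le {f : ℝ → ℝ} (hf : Continuous f) :
    ∃ K, 0 ≤ K ∧ ∀ j, |sineCoeff f j| ≤ K := by
  have h := hasSum_sq_sineCoeff hf
  have h0 : 0 ≤ ∫ u in (0 : ℝ)..1, f u ^ 2 :=
    intervalIntegral.integral_nonneg zero_le_one fun _ _ => sq_nonneg _
  refine ⟨1 + ∫ u in (0 : ℝ)..1, f u ^ 2, by positivity, fun j => ?_⟩
  have h1 := le_hasSum h j fun _ _ => by positivity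
  nlinarith [sq_abs (sineCoeff f j), sq_nonneg (|sineCoeff f j| - 1)]

/-- The coefficients of `φ''` are bounded, so those of `φ` are `O(j⁻²)`. -/
lemma summable_abs_sineCoeff {φ : ℝ → ℝ} (hφ : ContDiff ℝ 2 φ) (h0 : φ 0 = 0) (h1 : φ 1 = 0) :
    Summable fun j => |2 * sineCoeff φ j| := by
  obtain ⟨K, hK, hb⟩ := exists_abs_sineCoeff_le (f := deriv (deriv φ))
    ((hφ.deriv' (n := 1)).continuous_deriv le_rfl)
  have hs : Summable fun j : ℕ => 2 * K / Real.pi ^ 2 * (1 / (j : ℝ) ^ 2) :=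
    (Real.summable_one_div_nat_pow.2 one_lt_two).mul_left _
  refine Summable.of_nonneg_of_le (fun _ => abs_nonneg _) (fun j => ?_) hs
  rcases Nat.eq_zero_or_pos j with rfl | hj
  · simp
  have h2 := hb j
  rw [sineCoeff_deriv_deriv hφ h0 h1, abs_mul, abs_neg, abs_of_pos (by positivity)] at h2
  rw [abs_mul, abs_two, div_mul_div_comm, mul_one, le_div_iff₀ (by positivity)]
  linarith [mul_pow Real.pi (j : ℝ) 2, mul_comm (|sineCoeff φ j|) ((Real.pi * j) ^ 2)]

/-- A `C²` function vanishing at the end points is the sum of its sine series. -/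
lemma hasSum_sineSeries {φ : ℝ → ℝ} (hφ : ContDiff ℝ 2 φ) (h0 : φ 0 = 0) (h1 : φ 1 = 0) :
    EqOn (fun u => ∑' j, 2 * sineCoeff φ j * Real.sin (Real.pi * j * u)) φ (Icc 0 1) := by
  have hs := summable_abs_sineCoeff hφ h0 h1
  have hle : ∀ (j : ℕ) (u : ℝ), ‖2 * sineCoeff φ j * Real.sin (Real.pi * j * u)‖ ≤
      |2 * sineCoeff φ j| := fun j u => by
    rw [norm_mul, Real.norm_eq_abs, Real.norm_eq_abs]
    exact mul_le_of_le_one_right (abs_nonneg _) (Real.abs_sin_le_one _)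
  have hc : Continuous fun u => ∑' j, 2 * sineCoeff φ j * Real.sin (Real.pi * j * u) :=
    continuous_tsum (fun j => by fun_prop) hs hle
  refine eqOn_of_sineCoeff_eq hc hφ.continuous fun k => ?_
  have h := intervalIntegral.hasSum_integral_of_dominated_convergence (a := 0) (b := 1)
    (μ := volume) (ι := ℕ)
    (F := fun j u => Real.sin (Real.pi * k * u) *
      (2 * sineCoeff φ j * Real.sin (Real.pi * j * u)))
    (f := fun u => Real.sin (Real.pi * k * u) *
      ∑' j, 2 * sineCoeff φ j * Real.sin (Real.pi * j * u))
    (fun j _ => |2 * sineCoeff φ j|)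
    (fun j => (by fun_prop : Continuous _).aestronglyMeasurable)
    (fun j => ae_of_all _ fun u _ => by
      rw [norm_mul, Real.norm_eq_abs (Real.sin _)]
      exact (mul_le_of_le_one_left (norm_nonneg _) (Real.abs_sin_le_one _)).trans (hle j u))
    (ae_of_all _ fun u _ => hs) (by simp)
    (ae_of_all _ fun u _ => (hs.of_norm_bounded fun j => hle j u).hasSum.mul_left _)
  refine h.unique ?_
  have hval : ∫ u in (0 : ℝ)..1, Real.sin (Real.pi * k * u) *
      (2 * sineCoeff φ k * Real.sin (Real.pi * k * u)) = sineCoeff φ k := by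
    rcases Nat.eq_zero_or_pos k with rfl | hk
    · simp
    · have e : ∀ u, Real.sin (Real.pi * k * u) * (2 * sineCoeff φ k * Real.sin (Real.pi * k * u)) =
          2 * sineCoeff φ k * Real.sin (Real.pi * k * u) ^ 2 := fun u => by ring
      simp only [e]
      rw [intervalIntegral.integral_const_mul, integral_sin_sq_mode hk]
      ring
  have hsingle := hasSum_single (f := fun j => ∫ u in (0 : ℝ)..1, Real.sin (Real.pi * k * u) *
      (2 * sineCoeff φ j * Real.sin (Real.pi * j * u))) k fun j hj => by
    have e : ∀ u, Real.sin (Real.pi * k * u) * (2 * sineCoeff φ j * Real.sin (Real.pi * j * u)) =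
        2 * sineCoeff φ j * (Real.sin (Real.pi * k * u) * Real.sin (Real.pi * j * u)) :=
      fun u => by ring
    simp only [e]
    rw [intervalIntegral.integral_const_mul, integral_sin_mul_sin_of_ne hj.symm, mul_zero]
  rwa [hval] at hsingle

/-- The sine series of `φ` converges uniformly, and `ν` has finite variation, so only the vanishing
tails of the series contribute. -/
lemma integral_eq_zero_of_sine {ν : SignedMeasure I}
    (hν : ∀ j : ℕ, ∫ᵛ u : I, Real.sin (Real.pi * j * u) ∂•ν = 0) {φ : ℝ → ℝ}
    (hφ : ContDiff ℝ 2 φ) (h0 : φ 0 = 0) (h1 : φ 1 = 0) : ∫ᵛ u : I, φ u ∂•ν = 0 := by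
  obtain ⟨V, hV, hb⟩ := abs_integral_signedMeasure_le ν
  have hs := summable_abs_sineCoeff hφ h0 h1
  have hle : ∀ (j : ℕ) (u : ℝ), ‖2 * sineCoeff φ j * Real.sin (Real.pi * j * u)‖ ≤
      |2 * sineCoeff φ j| := fun j u => by
    rw [norm_mul, Real.norm_eq_abs, Real.norm_eq_abs]
    exact mul_le_of_le_one_right (abs_nonneg _) (Real.abs_sin_le_one _)
  have key : ∀ M, |∫ᵛ u : I, φ u ∂•ν| ≤ (∑' j, |2 * sineCoeff φ (j + M)|) * V := by
    intro M
    have hφc : Continuous fun u : I => φ u := hφ.continuous.comp continuous_subtype_val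
    have hsin : ∀ j : ℕ, Continuous fun u : I => Real.sin (Real.pi * j * (u : ℝ)) := fun j => by
      fun_prop
    have hS : ∫ᵛ u : I, (∑ j ∈ Finset.range M,
        (2 * sineCoeff φ j) • Real.sin (Real.pi * j * u)) ∂•ν = 0 := by
      rw [VectorMeasure.integral_finsetSum (f := fun (j : ℕ) (u : I) =>
        (2 * sineCoeff φ j) • Real.sin (Real.pi * j * (u : ℝ))) _ fun j _ =>
        integrable_of_continuous ((hsin j).fun_const_smul _)]
      refine Finset.sum_eq_zero fun j _ => ?_
      rw [VectorMeasure.integral_fun_smul, hν, smul_zero]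
    have hsub := VectorMeasure.integral_fun_sub (μ := ν)
      (B := (ContinuousLinearMap.lsmul ℝ ℝ : ℝ →L[ℝ] ℝ →L[ℝ] ℝ)) (integrable_of_continuous hφc)
      (integrable_of_continuous (μ := ν.variation) (f := fun u : I => ∑ j ∈ Finset.range M,
        (2 * sineCoeff φ j) • Real.sin (Real.pi * j * (u : ℝ))) (by fun_prop))
    rw [hS, sub_zero] at hsub
    rw [← hsub]
    refine hb _ _ fun u => ?_
    have h2 := hasSum_sineSeries hφ h0 h1 u.2
    simp only at h2
    rw [← h2, ← (hs.of_norm_bounded fun j => hle j u).sum_add_tsum_nat_add M]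
    simp only [smul_eq_mul, add_sub_cancel_left]
    exact tsum_of_norm_bounded ((summable_nat_add_iff M).2 hs).hasSum fun j => hle _ _
  have hlim := (tendsto_sum_nat_add fun j => |2 * sineCoeff φ j|).mul_const V
  rw [zero_mul] at hlim
  exact abs_eq_zero.1 (le_antisymm (ge_of_tendsto' hlim key) (abs_nonneg _))

lemma eqOn_zero_of_integral_eq_zero {g : ℝ → ℝ} (hg : ContinuousOn g (Ici 0))
    (h : ∀ t, 0 ≤ t → ∫ s in (0 : ℝ)..t, g s = 0) {t : ℝ} (ht : 0 ≤ t) : g t = 0 := by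
  have hpos : ∀ t, 0 < t → g t = 0 := fun t ht => by
    refine (hasDerivAt_primitive_Ici hg ht).unique ?_
    refine (hasDerivAt_const t (0 : ℝ)).congr_of_eventuallyEq ?_
    filter_upwards [lt_mem_nhds ht] with s hs
    exact h s hs.le
  rcases ht.eq_or_lt with rfl | ht
  · have h1 : Tendsto g (𝓝[>] 0) (𝓝 (g 0)) :=
      (hg 0 self_mem_Ici).mono_left (nhdsWithin_mono _ Ioi_subset_Ici_self)
    refine tendsto_nhds_unique h1 (tendsto_const_nhds.congr' ?_)
    filter_upwards [self_mem_nhdsWithin] with s hs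
    exact (hpos s hs).symm
  · exact hpos t ht

lemma eq_zero_of_eq_integral {g : ℝ → ℝ} (hg : ContinuousOn g (Ici 0)) (c : ℝ)
    (h : ∀ t, 0 ≤ t → g t = c * ∫ s in (0 : ℝ)..t, g s) {t : ℝ} (ht : 0 ≤ t) : g t = 0 := by
  have hi : ∀ t, 0 ≤ t → IntervalIntegrable g volume 0 t := fun t ht =>
    intervalIntegrable_of_continuousOn_Ici hg le_rfl ht
  have h1 := gronwall_integral (u := fun s => |g s|) (a := fun _ => 0) (abs_nonneg c) ht
    (hi t ht).abs (fun s hs => ((hg s hs.1).mono (Ici_subset_Ici.2 hs.1)).abs) continuous_const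
    (fun _ => le_rfl) fun s hs => by
      rw [h s hs.1, abs_mul, zero_add]
      gcongr
      exact intervalIntegral.abs_integral_le_integral_abs hs.1
  simp only [intervalIntegral.integral_zero, mul_zero, add_zero] at h1
  exact abs_eq_zero.1 (le_antisymm h1 (abs_nonneg _))

/-- Every continuous function is the second derivative of a `C²` function vanishing at the end
points. -/
lemma exists_deriv_deriv_eq {f : ℝ → ℝ} (hf : Continuous f) :
    ∃ φ : ℝ → ℝ, ContDiff ℝ 2 φ ∧ φ 0 = 0 ∧ φ 1 = 0 ∧ deriv (deriv φ) = f := by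
  set G : ℝ → ℝ := fun u => ∫ v in (0 : ℝ)..u, f v with hG
  have hGd : ∀ u, HasDerivAt G (f u) u := fun u => hf.integral_hasStrictDerivAt 0 u |>.hasDerivAt
  have hGc : Continuous G := continuous_iff_continuousAt.2 fun u => (hGd u).continuousAt
  set c := ∫ v in (0 : ℝ)..1, G v with hc
  set φ : ℝ → ℝ := fun u => (∫ v in (0 : ℝ)..u, G v) - u * c with hφ
  have hφd : ∀ u, HasDerivAt φ (G u - c) u := fun u =>
    ((hGc.integral_hasStrictDerivAt 0 u).hasDerivAt.fun_sub
      ((hasDerivAt_id' u).mul_const c)).congr_deriv (by ring)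
  have hd1 : deriv φ = fun u => G u - c := funext fun u => (hφd u).deriv
  have hd2 : deriv (deriv φ) = f := by
    rw [hd1]
    exact funext fun u => ((hGd u).sub_const c).deriv
  refine ⟨φ, ?_, by simp [hφ], by simp [hφ, hc], hd2⟩
  rw [show (2 : WithTop ℕ∞) = 1 + 1 by norm_num, contDiff_succ_iff_deriv]
  refine ⟨fun u => (hφd u).differentiableAt, fun h => absurd h (by simp), ?_⟩
  rw [contDiff_one_iff_deriv, hd2]
  refine ⟨?_, hf⟩
  rw [hd1]
  exact fun u => ((hGd u).sub_const c).differentiableAt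

/-- The difference solves the homogeneous equation. Sines are eigenfunctions, so their integrals
satisfy a linear Volterra equation and vanish; hence so do the integrals of all admissible `φ`. -/
theorem IsWeakStretch.unique {γ Fbar : ℝ} (hγ : 0 < γ) {r₀ : ℝ → ℝ} {m m' : ℝ → SignedMeasure I}
    (h : IsWeakStretch γ Fbar r₀ m) (h' : IsWeakStretch γ Fbar r₀ m') {t : ℝ} (ht : 0 ≤ t) :
    m' t = m t := by
  have hsub : ∀ {f : ℝ → ℝ}, Continuous f → ∀ s, ∫ᵛ u : I, f u ∂•(m' s - m s) =
      (∫ᵛ u : I, f u ∂•(m' s)) - ∫ᵛ u : I, f u ∂•(m s) := fun hf s =>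
    VectorMeasure.integral_sub_vectorMeasure
      (integrable_of_continuous (hf.comp continuous_subtype_val))
      (integrable_of_continuous (hf.comp continuous_subtype_val))
  have hc : ∀ {f : ℝ → ℝ}, Continuous f →
      ContinuousOn (fun s => ∫ᵛ u : I, f u ∂•(m s)) (Ici 0) ∧
      ContinuousOn (fun s => ∫ᵛ u : I, f u ∂•(m' s)) (Ici 0) := fun {f} hf =>
    ⟨h.cont ⟨fun u => f u, hf.comp continuous_subtype_val⟩,
      h'.cont ⟨fun u => f u, hf.comp continuous_subtype_val⟩⟩
  have hcd : ∀ {f : ℝ → ℝ}, Continuous f →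
      ContinuousOn (fun s => ∫ᵛ u : I, f u ∂•(m' s - m s)) (Ici 0) := fun hf => by
    simp only [hsub hf]
    exact (hc hf).2.sub (hc hf).1
  have hweak : ∀ φ : ℝ → ℝ, ContDiff ℝ 2 φ → φ 0 = 0 → φ 1 = 0 → ∀ s, 0 ≤ s →
      ∫ᵛ u : I, φ u ∂•(m' s - m s) =
        1 / (2 * γ) * ∫ s in (0 : ℝ)..s, ∫ᵛ u : I, deriv (deriv φ) u ∂•(m' s - m s) := by
    intro φ hφ h0 h1 s hs
    have hφ2 : Continuous (deriv (deriv φ)) := (hφ.deriv' (n := 1)).continuous_deriv le_rfl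
    have e := h.weak φ hφ h0 h1 s hs
    have e' := h'.weak φ hφ h0 h1 s hs
    simp only [hsub hφ2, hsub hφ.continuous]
    rw [intervalIntegral.integral_sub
      (intervalIntegrable_of_continuousOn_Ici (hc hφ2).2 le_rfl hs)
      (intervalIntegrable_of_continuousOn_Ici (hc hφ2).1 le_rfl hs)]
    linear_combination e' - e
  have hsine : ∀ s, 0 ≤ s → ∀ j : ℕ, ∫ᵛ u : I, Real.sin (Real.pi * j * u) ∂•(m' s - m s) = 0 := by
    intro s hs j
    have hl : ∀ u, HasDerivAt (fun u : ℝ => Real.pi * j * u) (Real.pi * j) u := fun u => by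
      simpa using (hasDerivAt_id u).const_mul (Real.pi * j)
    have d1 : deriv (fun u : ℝ => Real.sin (Real.pi * j * u)) =
        fun u => Real.cos (Real.pi * j * u) * (Real.pi * j) := funext fun u => (hl u).sin.deriv
    have d2 : deriv (deriv fun u : ℝ => Real.sin (Real.pi * j * u)) =
        fun u => (-(Real.pi * j) ^ 2) • Real.sin (Real.pi * j * u) := by
      rw [d1]
      refine funext fun u => ((hl u).cos.mul_const (Real.pi * j)).deriv.trans ?_
      rw [smul_eq_mul]
      ring
    refine eq_zero_of_eq_integral (hcd (f := fun u => Real.sin (Real.pi * j * u)) (by fun_prop))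
      (1 / (2 * γ) * -(Real.pi * j) ^ 2) (fun s hs => ?_) hs
    have e := hweak (fun u => Real.sin (Real.pi * j * u)) (by fun_prop) (by simp)
      (by rw [mul_one, mul_comm]; exact Real.sin_nat_mul_pi j) s hs
    have hz : ∀ s, ∫ᵛ u : I, (-(Real.pi * j) ^ 2) • Real.sin (Real.pi * j * u) ∂•(m' s - m s) =
        -(Real.pi * j) ^ 2 * ∫ᵛ u : I, Real.sin (Real.pi * j * u) ∂•(m' s - m s) := fun s =>
      VectorMeasure.integral_fun_smul _ _ _ _
    simp only [d2, hz] at e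
    rw [e, intervalIntegral.integral_const_mul]
    ring
  refine sub_eq_zero.1 (eq_zero_of_forall_integral_eq_zero fun f => ?_)
  have hf : Continuous (IccExtend (zero_le_one (α := ℝ)) f) := f.continuous.Icc_extend'
  -- The sines cannot see mass at the end points. The weak equation can: with its left side zero,
  -- the time integral of the pairing with `φ'' = f` vanishes for every continuous `f`, including
  -- those not zero at the ends.
  have hz := eqOn_zero_of_integral_eq_zero (hcd hf) ?_ ht
  · simpa using hz
  · intro s hs
    obtain ⟨φ, hφ, h0, h1, h2⟩ := exists_deriv_deriv_eq hf
    have h3 := hweak φ hφ h0 h1 s hs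
    rw [integral_eq_zero_of_sine (hsine s hs) hφ h0 h1, h2] at h3
    exact (mul_eq_zero.1 h3.symm).resolve_left (by positivity)

end HarmonicChain

/-! ### Assembly of the two parts of the work. -/

namespace HarmonicChain

/-! ### The macroscopic work -/

lemma IsWeakStretch.congr {γ Fbar : ℝ} {r₀ r₁ : ℝ → ℝ} (hr : EqOn r₀ r₁ (Icc 0 1))
    {m : ℝ → SignedMeasure I} (h : IsWeakStretch γ Fbar r₀ m) : IsWeakStretch γ Fbar r₁ m where
  cont := h.cont
  weak φ hφ h0 h1 t ht := by
    rw [← h.weak φ hφ h0 h1 t ht]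
    congr 1
    refine intervalIntegral.integral_congr fun u hu => ?_
    rw [uIcc_of_le zero_le_one] at hu
    simp only [hr hu]

/-- The Fourier coefficients `F̂` of the force, with the coefficient at `0` set to `0`. -/
noncomputable def oscillation (Fhat : ℤ → ℂ) (ℓ : ℤ) : ℂ := if ℓ = 0 then 0 else Fhat ℓ

lemma summable_oscillation {Fhat : ℤ → ℂ}
    (hsum : Summable fun ℓ : {ℓ : ℤ // ℓ ≠ 0} => ‖Fhat ℓ‖) :
    Summable fun ℓ => ‖oscillation Fhat ℓ‖ := by
  refine (Subtype.val_injective.summable_iff (g := ((↑) : {ℓ : ℤ // ℓ ≠ 0} → ℤ))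
    fun ℓ hℓ => ?_).1 (hsum.congr fun ℓ => ?_)
  · have : ℓ = 0 := by
      by_contra h0
      exact hℓ ⟨⟨ℓ, h0⟩, rfl⟩
    simp [oscillation, this]
  · simp [oscillation, ℓ.2]

lemma oscillation_neg {Fhat : ℤ → ℂ} (hreal : ∀ ℓ : ℤ, Fhat (-ℓ) = (starRingEnd ℂ) (Fhat ℓ))
    (ℓ : ℤ) : oscillation Fhat (-ℓ) = (starRingEnd ℂ) (oscillation Fhat ℓ) := by
  unfold oscillation
  by_cases h : ℓ = 0
  · simp [h]
  · simp [h, hreal]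

lemma force_eq (θ Fbar : ℝ) (Fhat : ℤ → ℂ) (n : ℕ) :
    force θ Fbar Fhat n =
      fun t => Fbar + 1 / √(n : ℝ) * (harmonicSum (oscillation Fhat) (angFreq θ) t).re := by
  ext t
  rw [force, harmonicSum]
  congr 3
  rw [← Subtype.val_injective.tsum_eq (g := ((↑) : {ℓ : ℤ // ℓ ≠ 0} → ℤ)) fun ℓ hℓ => ?_]
  · refine tsum_congr fun ℓ => ?_
    rw [oscillation, if_neg ℓ.2]
    push_cast
    rw [mul_assoc Complex.I]
  · have : ℓ ≠ 0 := fun h0 => hℓ (by simp [oscillation, h0])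
    exact ⟨⟨ℓ, this⟩, rfl⟩

lemma thermalTerm_oscillation (γ θ : ℝ) (Fhat : ℤ → ℂ) (ℓ : ℕ) :
    thermalTerm γ θ (oscillation Fhat) (ℓ + 1) = thermalTerm γ θ Fhat (ℓ + 1) := by
  have : ((ℓ + 1 : ℕ) : ℤ) ≠ 0 := by omega
  rw [thermalTerm, thermalTerm, oscillation, if_neg this]

/-- The limit of the works of a family of averaged chains. -/
theorem IsMeanChainFamily.tendsto_work {γ Fbar A H θ t : ℝ} {a : ℤ → ℂ} {R Q : ℕ → ℕ → ℝ → ℝ}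
    (hθ : 0 < θ) (hreal : ∀ ℓ, a (-ℓ) = (starRingEnd ℂ) (a ℓ)) (hsum : Summable fun ℓ => ‖a ℓ‖)
    (hzero : a 0 = 0)
    (h : IsMeanChainFamily γ Fbar A H (fun s => (harmonicSum a (angFreq θ) s).re) R Q)
    {r₀ : ℝ → ℝ} (hr₀ : Continuous r₀)
    (hprofile : Tendsto (fun n : ℕ => (1 / (n : ℝ)) * ∑ x ∈ Finset.Icc 1 n,
      (R n x 0 - r₀ ((x : ℝ) / n)) ^ 2) atTop (𝓝 0)) (ht : 0 < t) :
    Tendsto (fun n : ℕ => work n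
      (fun s => Fbar + 1 / √(n : ℝ) * (harmonicSum a (angFreq θ) s).re) (Q n n) t) atTop
      (𝓝 (Fbar / (2 * γ) * (∫ s in (0 : ℝ)..t, boundaryDeriv (heatDensity γ Fbar r₀) s) +
        t * thermalWork γ θ a)) := by
  have h1 := (h.tendsto_integral_p hr₀ hprofile ht.le).const_mul Fbar
  have h2 := (IsMeanChainFamily.tendsto_thermal hθ hreal hsum hzero h ht).2
  have hγ := h.pos
  have hval : Fbar / (2 * γ) * (∫ s in (0 : ℝ)..t, boundaryDeriv (heatDensity γ Fbar r₀) s) =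
      Fbar * (heatPairing γ Fbar r₀ (fun u => u) t - heatPairing γ Fbar r₀ (fun u => u) 0 +
        Fbar * t / (2 * γ)) := by
    rw [(boundaryDeriv_integral hγ Fbar hr₀ ht).2]
    field_simp
    ring
  rw [hval]
  refine (h1.add h2).congr' ?_
  filter_upwards [eventually_ge_atTop 1] with n hn
  have hQ := intervalIntegrable_of_continuousOn_Ici ((h.chain n hn).cont_p n le_rfl) le_rfl
    (by positivity : 0 ≤ (n : ℝ) ^ 2 * t)
  have hfQ : IntervalIntegrable (fun s => (harmonicSum a (angFreq θ) s).re * Q n n s) volume 0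
      ((n : ℝ) ^ 2 * t) := intervalIntegrable_of_continuousOn_Ici
    ((h.cont.continuousOn (s := Ici 0)).mul ((h.chain n hn).cont_p n le_rfl)) le_rfl
    (by positivity : 0 ≤ (n : ℝ) ^ 2 * t)
  have e : ∀ s, (Fbar + 1 / √(n : ℝ) * (harmonicSum a (angFreq θ) s).re) * Q n n s =
      Fbar * Q n n s + 1 / √(n : ℝ) * ((harmonicSum a (angFreq θ) s).re * Q n n s) :=
    fun s => by ring
  rw [work]
  simp only [e]
  rw [intervalIntegral.integral_add (hQ.const_mul _) (hfQ.const_mul _),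
    intervalIntegral.integral_const_mul, intervalIntegral.integral_const_mul,
    ← one_div_mul_one_div]
  ring

end HarmonicChain

theorem mainTheorem4
    -- parameters of the chain and of the force
    (γ T θ Fbar : ℝ) (hγ : 0 < γ) (hT : 0 < T) (hθ : 0 < θ)
    (Fhat : ℤ → ℂ) (hreal : ∀ ℓ : ℤ, Fhat (-ℓ) = (starRingEnd ℂ) (Fhat ℓ))
    (hsum : Summable fun ℓ : {ℓ : ℤ // ℓ ≠ 0} => ‖Fhat ℓ‖)
    -- the processes, one chain for each `n ≥ 1`
    {Ω : ℕ → Type*} [mΩ : ∀ n, MeasurableSpace (Ω n)] (P : ∀ n, Measure (Ω n))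
    (ℱ : ∀ n, Filtration ℝ≥0 (mΩ n))
    (N : ∀ n, ℕ → ℝ≥0 → Ω n → ℕ) (w : ∀ n, ℝ≥0 → Ω n → ℝ)
    (r p : ∀ n, ℕ → ℝ → Ω n → ℝ)
    (hchain : ∀ n, 1 ≤ n → HarmonicChain.IsChainProcess n γ T
      (HarmonicChain.force θ Fbar Fhat n) (P n) (ℱ n) (N n) (w n) (r n) (p n))
    -- the initial averages exist
    (hint : ∀ n, 1 ≤ n → ∀ x ≤ n, Integrable (r n x 0) (P n) ∧ Integrable (p n x 0) (P n))
    -- initial bound on the averages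
    (hbound : ∃ H : ℝ, 0 < H ∧ ∀ n : ℕ, 1 ≤ n →
      (1 / (n : ℝ)) * ∑ x ∈ Finset.range (n + 1),
        ((∫ ω, r n x 0 ω ∂(P n)) ^ 2 + (∫ ω, p n x 0 ω ∂(P n)) ^ 2) ≤ H)
    -- initial stretch profile
    (r₀ : ℝ → ℝ) (hr₀ : ContinuousOn r₀ (Icc 0 1))
    (hprofile : Tendsto
      (fun n : ℕ => (1 / (n : ℝ)) * ∑ x ∈ Finset.Icc 1 n,
        ((∫ ω, r n x 0 ω ∂(P n)) - r₀ ((x : ℝ) / n)) ^ 2) atTop (𝓝 0)) :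
    -- the averaged momenta and the works are well defined
    (∀ n, 1 ≤ n → ∀ t, 0 ≤ t → Integrable (p n n t) (P n) ∧
      IntervalIntegrable
        (fun s => HarmonicChain.force θ Fbar Fhat n s * ∫ ω, p n n s ω ∂(P n)) volume 0 t) ∧
    -- the series that defines `W^Q` converges
    (Summable fun ℓ : ℕ => HarmonicChain.thermalTerm γ θ Fhat (ℓ + 1)) ∧
    -- the macroscopic stretch profile is well defined, and the work converges
    ∃ (m : ℝ → SignedMeasure I) (ρ : ℝ → ℝ → ℝ),
      HarmonicChain.IsWeakStretch γ Fbar r₀ m ∧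
      (∀ m' : ℝ → SignedMeasure I, HarmonicChain.IsWeakStretch γ Fbar r₀ m' →
        ∀ t, 0 ≤ t → m' t = m t) ∧
      HarmonicChain.HasSmoothDensity m ρ ∧
      ∀ t, 0 < t →
        IntervalIntegrable (HarmonicChain.boundaryDeriv ρ) volume 0 t ∧
        Tendsto
          (fun n : ℕ => HarmonicChain.work n (HarmonicChain.force θ Fbar Fhat n)
            (fun s => ∫ ω, p n n s ω ∂(P n)) t)
          atTop
          (𝓝 (Fbar / (2 * γ) * (∫ s in (0 : ℝ)..t, HarmonicChain.boundaryDeriv ρ s)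
            + t * HarmonicChain.thermalWork γ θ Fhat)) := by
  -- The value of `Fhat` at `0` is not part of the force; setting it to `0` turns the sums into sums
  -- over all integers.
  set a := HarmonicChain.oscillation Fhat with ha
  have hasum := HarmonicChain.summable_oscillation hsum
  have hareal := HarmonicChain.oscillation_neg hreal
  have hazero : a 0 = 0 := by simp [ha, HarmonicChain.oscillation]
  set f : ℝ → ℝ := fun s => (HarmonicChain.harmonicSum a (HarmonicChain.angFreq θ) s).re with hf
  have hfc : Continuous f :=
    Complex.continuous_re.comp (HarmonicChain.continuous_harmonicSum hasum _)
  have hfb : ∀ s, |f s| ≤ ∑' ℓ, ‖a ℓ‖ := fun s =>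
    (Complex.abs_re_le_norm _).trans (HarmonicChain.norm_harmonicSum_le hasum _ s)
  have hforce : ∀ n, HarmonicChain.force θ Fbar Fhat n = fun t => Fbar + 1 / √(n : ℝ) * f t :=
    fun n => HarmonicChain.force_eq θ Fbar Fhat n
  have hFc : ∀ n, Continuous (HarmonicChain.force θ Fbar Fhat n) := fun n => by
    rw [hforce]
    fun_prop
  have hFb : ∀ n t, |HarmonicChain.force θ Fbar Fhat n t| ≤
      |Fbar| + |1 / √(n : ℝ)| * ∑' ℓ, ‖a ℓ‖ := fun n t => by
    rw [hforce]
    refine (abs_add_le _ _).trans ?_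
    rw [abs_mul]
    gcongr
    exact hfb t
  set Q : ℕ → ℕ → ℝ → ℝ := fun n x t => ∫ ω, p n x t ω ∂(P n) with hQ
  set R : ℕ → ℕ → ℝ → ℝ := fun n x t =>
    if x = n + 1 then HarmonicChain.force θ Fbar Fhat n t else ∫ ω, r n x t ω ∂(P n) with hR
  have hmean : ∀ n, 1 ≤ n →
      HarmonicChain.IsMeanChain n γ (HarmonicChain.force θ Fbar Fhat n) (R n) (Q n) := fun n hn =>
    (hchain n hn).isMeanChain hγ hn (hFc n) (hFb n) (fun x hx => (hint n hn x hx).1)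
      fun x hx => (hint n hn x hx).2
  have hRx : ∀ n x, x ≤ n → R n x 0 = ∫ ω, r n x 0 ω ∂(P n) := fun n x hx => by
    simp only [hR]
    rw [if_neg (by omega)]
  obtain ⟨H, hH, hE⟩ := hbound
  have hfam : HarmonicChain.IsMeanChainFamily γ Fbar (∑' ℓ, ‖a ℓ‖) H f R Q :=
    { pos := hγ
      chain := fun n hn => by
        have := hmean n hn
        rwa [hforce] at this
      cont := hfc
      bound := hfb
      energy_zero := fun n hn => by
        have hn0 : (0 : ℝ) < n := by exact_mod_cast hn
        have h1 := hE n hn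
        rw [one_div_mul_eq_div, div_le_iff₀ hn0] at h1
        refine le_trans (le_of_eq ?_) h1
        refine Finset.sum_congr rfl fun x hx => ?_
        rw [hRx n x (by have := Finset.mem_range.1 hx; omega)] }
  -- The profile is continuous only on `[0,1]`; its constant extension is continuous on the line and
  -- agrees with it wherever it is evaluated.
  set r₁ : ℝ → ℝ := fun u => r₀ (max 0 (min 1 u)) with hr₁
  have hr₁c : Continuous r₁ := hr₀.comp_continuous (by fun_prop) fun u =>
    ⟨le_max_left _ _, max_le zero_le_one (min_le_left _ _)⟩
  have hr₁eq : EqOn r₁ r₀ (Icc 0 1) := fun u hu => by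
    simp only [hr₁]
    rw [min_eq_right hu.2, max_eq_right hu.1]
  have hprofile₁ : Tendsto (fun n : ℕ => (1 / (n : ℝ)) * ∑ x ∈ Finset.Icc 1 n,
      (R n x 0 - r₁ ((x : ℝ) / n)) ^ 2) atTop (𝓝 0) := by
    refine hprofile.congr fun n => ?_
    congr 1
    refine Finset.sum_congr rfl fun x hx => ?_
    obtain ⟨h1, h2⟩ := Finset.mem_Icc.1 hx
    have hn0 : (0 : ℝ) < n := by exact_mod_cast (by omega : 0 < n)
    rw [hRx n x h2, hr₁eq ⟨by positivity, (div_le_one hn0).2 (by exact_mod_cast h2)⟩]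
  have hweak := (HarmonicChain.isWeakStretch_heatFlow hγ Fbar hr₁c).congr hr₁eq
  have hthermal : HarmonicChain.thermalWork γ θ a = HarmonicChain.thermalWork γ θ Fhat :=
    tsum_congr fun ℓ => HarmonicChain.thermalTerm_oscillation γ θ Fhat ℓ
  refine ⟨fun n hn t ht => ⟨?_, ?_⟩, ?_, HarmonicChain.heatFlow γ Fbar r₁,
    HarmonicChain.heatDensity γ Fbar r₁, hweak, fun m' hm' t ht => hweak.unique hγ hm' ht,
    HarmonicChain.hasSmoothDensity_heatFlow hγ Fbar hr₁c, fun t ht => ⟨?_, ?_⟩⟩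
  · exact ((hchain n hn).isAverageable_p hγ hn (hFc n) (hFb n) (fun x hx => (hint n hn x hx).1)
      (fun x hx => (hint n hn x hx).2) le_rfl).integrable t ht
  · exact HarmonicChain.intervalIntegrable_of_continuousOn_Ici
      ((hFc n).continuousOn.mul ((hmean n hn).cont_p n le_rfl)) le_rfl ht
  -- Convergence of the series does not involve time; any positive time serves, here `1`.
  · have h1 := (HarmonicChain.IsMeanChainFamily.tendsto_thermal hθ hareal hasum hazero hfam
      one_pos).1
    exact h1.congr fun ℓ => HarmonicChain.thermalTerm_oscillation γ θ Fhat ℓ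
  · exact (HarmonicChain.boundaryDeriv_integral hγ Fbar hr₁c ht).1
  · have h1 := HarmonicChain.IsMeanChainFamily.tendsto_work hθ hareal hasum hazero hfam hr₁c
      hprofile₁ ht
    rw [hthermal] at h1
    simpa only [hforce] using h1
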